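/- All rings are commutative with identity, and matroids are finite. A partial field is a set $P$ with distinguished elements $0,1$, a binary operation $\cdot$ and a partial binary operation $+$ such that: (P1) $(P\setminus\{0\},\cdot,1)$ is an abelian group, and $0\cdot p=p\cdot 0=0$ for all $p$; (P2) $p+0=p$ for all $p$; (P3) for every $p$ there is a unique element $-p$ with $p+(-p)=0$; (P4) if $p+q$ is defined, then $q+p$ is defined and equal to it; (P5) for all $p,q,r\in P$ with $p\neq 0$, $q+r$ is defined if and only if $pq+pr$ is defined, and then $p(q+r)=pq+pr$; (P6) the associative law. Here an association of a finite multiset $S$ of elements of $P$ is a full binary tree whose leaves are labelled by the elements of $S$ (one leaf for each element), in which each non-leaf node is labelled by the sum of the labels of its children, all these sums being defined. The associative law says: if $S$ has an association with root label $r$, and $S=S_1\uplus S_2$ where $S_1$, $S_2$ have associations with root labels $u$, $w$, then $u+w$ is defined and equal to $r$. A sum $p_1+\cdots+p_n$ is defined, with value $r$, if there is a finite multiset $Z=\{z_1,-z_1,\ldots,z_k,-z_k\}$ such that $\{p_1,\ldots,p_n\}\uplus Z$ has an association with root label $r$. The determinant of an $n\times n$ matrix $A$ over $P$ is the sum $\sum_{\sigma\in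 S_n}\operatorname{sgn}(\sigma)a_{1\sigma(1)}\cdots a_{n\sigma(n)}$, if this is defined. A $P$-matrix is a matrix over $P$ all of whose square submatrices have a defined determinant; its rank is the largest $r$ such that it has an $r\times r$ submatrix with nonzero determinant. A matroid $M$ on the set $E$ is $P$-representable if there are an $r$ and an $r\times E$ $P$-matrix $A$ of rank $r$ such that the bases of $M$ are exactly the sets $B\subseteq E$ with $|B|=r$ for which the submatrix of $A$ with column set $B$ has nonzero determinant. For a ring $R$ and a set $S$ of units of $R$, let $\mathbb{P}(R,S)$ be the set $\langle S\cup\{-1\}\rangle\cup\{0\}$, where $\langle\cdot\rangle$ is the generated subgroup of the group of units, with the multiplication of $R$ and with the partial addition for which $p+q$ is defined if and only if the sum of $p$ and $q$ in $R$ lies in this set, and is then equal to it. Let $P$ be a partial field, and let $F=\{p\in P : 1-p \text{ is defined}\}$ be its set of fundamental elements. Let $\tilde p$ ($p\in F$) be indeterminates, let $R_P=\mathbb{Z}[\tilde p : p\in F]$, and let $I_P$ be the ideal of $R_P$ generated by the polynomials $\tilde 0$; $\tilde 1-1$; $\widetilde{-1}+1$ if $-1\in F$; $\tilde p+\tilde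 q-1$ for all $p,q\in F$ such that $p+q$ is defined and equal to $1$; $\tilde p\tilde q-1$ for all $p,q\in F$ with $pq=1$; and $\tilde p\tilde q\tilde r-1$ for all $p,q,r\in F$ with $pqr=1$. The lift of $P$ is $$\mathbb{L}P:=\mathbb{P}\bigl(R_P/I_P,\ \tilde F_P\bigr),$$ where $\tilde F_P$ is the set of those images of the indeterminates in $R_P/I_P$ that are units (this includes the image of $\tilde p$ for every nonzero $p\in F$). Then $\mathbb{L}P$ is a partial field, and a matroid is $P$-representable if and only if it is $\mathbb{L}P$-representable. -/

import Mathlib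

/-- The raw data of a partial field: a commutative multiplication with `0` and `1`, a negation, and
a partial addition. `padd p q` is the sum `p + q`, which may be undefined; `r ∈ padd p q` means
that `p + q` is defined and equal to `r`. The axioms are in `IsPartialField`. -/
class PartialFieldData (P : Type*) extends CommMonoidWithZero P, Neg P where
  /-- The partial addition. -/
  padd : P → P → Part P

open PartialFieldData

/-- `Assoc S r`: there is an association of the multiset `S` whose root is labelled `r`, that is, a
full binary tree whose leaves are labelled by the elements of `S`, in which the label of every
other node is the (defined) sum of the labels of its two children. -/
inductive Assoc {P : Type*} [PartialFieldData P] : Multiset P → P → Prop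
  | leaf (p : P) : Assoc {p} p
  | node {S T : Multiset P} {u w r : P} :
      Assoc S u → Assoc T w → r ∈ padd u w → Assoc (S + T) r

/-- The axioms of a partial field. -/
class IsPartialField (P : Type*) [PartialFieldData P] : Prop where
  /-- Together with `exists_inv` and the commutative monoid laws: the nonzero elements form an
  abelian group. -/
  zero_ne_one : (0 : P) ≠ 1
  exists_inv : ∀ p : P, p ≠ 0 → ∃ q : P, p * q = 1
  padd_zero : ∀ p : P, p ∈ padd p 0
  /-- `-p` is the unique `q` with `p + q = 0`. -/
  padd_eq_zero_iff : ∀ p q : P, 0 ∈ padd p q ↔ q = -p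
  padd_comm : ∀ p q : P, padd p q = padd q p
  /-- `p * (q + r)` is defined if and only if `p * q + p * r` is, and then both are equal. -/
  mul_padd : ∀ p q r : P, p ≠ 0 → (padd q r).map (fun s => p * s) = padd (p * q) (p * r)
  /-- The associative law: if `S` has an association with root `r`, and a pre-association of `S` is
  given (two associations with roots `u`, `w`, whose leaves together are `S`), then `u + w` is
  defined and equal to `r`. -/
  assoc : ∀ (S T : Multiset P) (r u w : P),
    Assoc (S + T) r → Assoc S u → Assoc T w → r ∈ padd u w

section Determinants

variable {P : Type*} [PartialFieldData P]

/-- `SumsTo S r`: the sum of the elements of the multiset `S` is defined, with value `r`. This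
means that for some multiset `Z = {z₁, -z₁, …, zₖ, -zₖ}` there is an association of `S ∪ Z` with
root `r`. -/
def SumsTo (S : Multiset P) (r : P) : Prop :=
  ∃ Z : Multiset P, Assoc (S + (Z + Z.map (fun z => -z))) r

/-- The terms `sign(σ) a_{1σ(1)} ⋯ a_{nσ(n)}` of the formal determinant of `A`. -/
def detTerms {n : ℕ} (A : Matrix (Fin n) (Fin n) P) : Multiset P :=
  (Finset.univ : Finset (Equiv.Perm (Fin n))).val.map fun σ =>
    if Equiv.Perm.sign σ = 1 then ∏ i, A i (σ i) else -∏ i, A i (σ i)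

/-- `HasDet A d`: the determinant of `A` is defined, with value `d`. -/
def HasDet {n : ℕ} (A : Matrix (Fin n) (Fin n) P) (d : P) : Prop :=
  SumsTo (detTerms A) d

/-- The determinant of `A` is defined and nonzero. -/
def DetNeZero {n : ℕ} (A : Matrix (Fin n) (Fin n) P) : Prop :=
  ∃ d, HasDet A d ∧ d ≠ 0

/-- All determinants of square submatrices of `A` are defined. Square submatrices are taken with
all orderings of their rows and columns; reordering changes a determinant only by a sign. -/
def IsPMatrix {X Y : Type*} (A : Matrix X Y P) : Prop :=
  ∀ (n : ℕ) (f : Fin n ↪ X) (g : Fin n ↪ Y), ∃ d, HasDet (A.submatrix f g) d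

/-- `A` has rank `r`: the largest order of a square submatrix with nonzero determinant is `r`. -/
def HasRank {X Y : Type*} (A : Matrix X Y P) (r : ℕ) : Prop :=
  IsGreatest {n : ℕ | ∃ (f : Fin n ↪ X) (g : Fin n ↪ Y), DetNeZero (A.submatrix f g)} r

end Determinants

/-- A matroid `M` is representable over `P` if `M = M[A]` for some `r × E(M)` matrix `A` over `P`,
all of whose subdeterminants are defined, and that has rank `r`: the bases of `M` are exactly the
`r`-element sets `B` of columns with `det A[r, B] ≠ 0`. -/
def IsRepresentableOver (P : Type*) [PartialFieldData P] {α : Type*} (M : Matroid α) : Prop :=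
  ∃ (r : ℕ) (A : Matrix (Fin r) M.E P), IsPMatrix A ∧ HasRank A r ∧
    ∀ B : Set α, M.IsBase B ↔
      ∃ g : Fin r ↪ M.E, B = Set.range (fun i => (g i : α)) ∧ DetNeZero (A.submatrix id g)

section OfRing

variable {R : Type*} [CommRing R]

/-- The set `⟨S ∪ {-1}⟩ ∪ {0}`, as a multiplicative submonoid of `R`. -/
def ofRingCarrier (S : Set Rˣ) : Submonoid R where
  carrier := {x | x = 0 ∨ ∃ u ∈ Subgroup.closure (S ∪ {-1}), (u : R) = x}
  one_mem' := Or.inr ⟨1, one_mem _, Units.val_one⟩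
  mul_mem' := by
    rintro x y (rfl | ⟨u, hu, rfl⟩) (rfl | ⟨v, hv, rfl⟩)
    · exact Or.inl (mul_zero 0)
    · exact Or.inl (zero_mul _)
    · exact Or.inl (mul_zero _)
    · exact Or.inr ⟨u * v, mul_mem hu hv, Units.val_mul u v⟩

theorem ofRingCarrier_neg_mem (S : Set Rˣ) {x : R} (hx : x ∈ ofRingCarrier S) :
    -x ∈ ofRingCarrier S := by
  have h : (-1 : R) ∈ ofRingCarrier S :=
    Or.inr ⟨-1, Subgroup.subset_closure (Or.inr rfl), by simp⟩
  simpa using mul_mem h hx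

/-- The underlying set of the partial field `ℙ(R, S)`, where `S` is a set of units of `R`. -/
def OfRing (S : Set Rˣ) : Type _ := ofRingCarrier S

/-- The inclusion of `ℙ(R, S)` in `R`. -/
def OfRing.val {S : Set Rˣ} (x : OfRing S) : R := Subtype.val x

/-- The operations of `ℙ(R, S)` are the restrictions of those of `R`: the sum of `p` and `q` is
defined if and only if their sum in `R` lies in `⟨S ∪ {-1}⟩ ∪ {0}`. -/
instance OfRing.instPartialFieldData (S : Set Rˣ) : PartialFieldData (OfRing S) where
  mul x y := ⟨x.val * y.val, mul_mem x.2 y.2⟩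
  one := ⟨1, one_mem _⟩
  zero := ⟨0, Or.inl rfl⟩
  neg x := ⟨-x.val, ofRingCarrier_neg_mem S x.2⟩
  mul_assoc x y z := Subtype.ext (mul_assoc x.val y.val z.val)
  one_mul x := Subtype.ext (one_mul x.val)
  mul_one x := Subtype.ext (mul_one x.val)
  mul_comm x y := Subtype.ext (mul_comm x.val y.val)
  zero_mul x := Subtype.ext (zero_mul x.val)
  mul_zero x := Subtype.ext (mul_zero x.val)
  padd x y := ⟨x.val + y.val ∈ ofRingCarrier S, fun h => ⟨x.val + y.val, h⟩⟩

end OfRing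

section Lift

variable (P : Type*) [PartialFieldData P]

/-- The fundamental elements of `P`: those `p` for which `1 - p` is defined. -/
def Fundamental : Type _ := {p : P // (padd 1 (-p)).Dom}

/-- The polynomial ring over `ℤ` with one indeterminate for every fundamental element. -/
abbrev LiftPoly : Type _ := MvPolynomial (Fundamental P) ℤ

variable {P} in
/-- The indeterminate of a fundamental element. -/
noncomputable def tilde (p : Fundamental P) : LiftPoly P := MvPolynomial.X p

/-- The generators of the ideal that defines the lift. -/
inductive LiftRel : LiftPoly P → Prop
  | zero (p : Fundamental P) : p.1 = 0 → LiftRel (tilde p)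
  | one (p : Fundamental P) : p.1 = 1 → LiftRel (tilde p - 1)
  | neg_one (p : Fundamental P) : p.1 = -1 → LiftRel (tilde p + 1)
  | add (p q : Fundamental P) : 1 ∈ padd p.1 q.1 → LiftRel (tilde p + tilde q - 1)
  | inv (p q : Fundamental P) : p.1 * q.1 = 1 → LiftRel (tilde p * tilde q - 1)
  | triple (p q r : Fundamental P) : p.1 * q.1 * r.1 = 1 →
      LiftRel (tilde p * tilde q * tilde r - 1)

/-- The ideal generated by the polynomials in `LiftRel`. -/
noncomputable def liftIdeal : Ideal (LiftPoly P) := Ideal.span {f | LiftRel P f}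

/-- The ring in which the lift lives. -/
abbrev LiftRing : Type _ := LiftPoly P ⧸ liftIdeal P

/-- The images of the indeterminates, as units of `LiftRing P`. The image of the indeterminate of
`0` is `0`; the indeterminate of any other fundamental element `p` is a unit, by the relation for
the pair `p`, `p⁻¹`. -/
def liftGenerators : Set (LiftRing P)ˣ :=
  {u | ∃ p : Fundamental P, (u : LiftRing P) = Ideal.Quotient.mk (liftIdeal P) (tilde p)}

/-- The lift `𝕃P` of the partial field `P`. -/
abbrev Lift : Type _ := OfRing (liftGenerators P)

end Lift

open scoped Matroid

set_option linter.unusedSectionVars false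

/-! The monoid ring of `P` modulo the formal sums of value zero is a ring in which `P` embeds so
that `p + q` is defined exactly when the sum of the images lies in the image of `P`
(`toRing_add_eq_iff`). Hence `P` may be treated as a group `G` of units of a ring. A representation
is replaced by its system of coordinates: for every base `X` the matrix with respect to `X`, with
entries zero or in `G`, different bases being related by pivoting (`IsTableau`). Representations and
tableaux determine each other through Cramer's rule and `IsTableau.det_submatrix`. Sending each
indeterminate to its fundamental element induces a homomorphism from the lift to `P`, which carries
tableaux to tableaux; this is the easy direction.

For the other direction, consider the cross ratios of two by two submatrices without zeros. They are
invariant under scaling, and they are fundamental elements, because `1 - p` arises by pivoting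
(`Quad.fund`). The relations of the lift say how they interact: `p + q = 1` describes pivoting, `p q
r = 1` describes composing cross ratios along a common row or column, and the relation for `-1` is
needed in one exceptional configuration. A lift of a tableau `A` is a tableau over the lift whose
cross ratios are the lifts of those of `A`.

Every tableau has a lift (`exists_isLift`), by induction on the number of elements. Lifts are unique
up to scaling (`scaleEq_of_isLift`), so for two columns `u`, `v` lifts of `M ＼ {u}` and `M ＼ {v}`
can be scaled to agree on the common part and glued to one matrix. What remains are the cross ratios
in the columns `u` and `v`. If the rest is connected, two rows are joined by a path avoiding `u` and
`v`, and induction on its length applies (`good_of_rowPath`); if `u` and `v` are separated, there is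
no such cross ratio. Bases containing `u` or `v` follow by pivoting (`isLift_of_goodOff`), and
duality covers the case of two rows. A suitable pair exists, possibly after a pivot, in a connected
tableau with at least five elements (`exists_pair`), and in every disconnected one whose base has
two elements. The cases left are rank or corank at most one and two by two tableaux. -/

namespace PartialField

/-! ### The universal ring of a partial field. -/

section Basic

variable {P : Type*} [PartialFieldData P] [IsPartialField P]

theorem zero_mem_padd_neg (p : P) : 0 ∈ padd p (-p) :=
  (IsPartialField.padd_eq_zero_iff p (-p)).2 rfl

protected theorem neg_zero : -(0 : P) = 0 :=
  ((IsPartialField.padd_eq_zero_iff (0 : P) 0).1 (IsPartialField.padd_zero 0)).symm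

protected theorem neg_neg (p : P) : - -p = p := by
  have h := zero_mem_padd_neg p
  rw [IsPartialField.padd_comm] at h
  exact ((IsPartialField.padd_eq_zero_iff (-p) p).1 h).symm

theorem mul_mem_padd {a b c : P} (x : P) (h : c ∈ padd a b) : x * c ∈ padd (x * a) (x * b) := by
  by_cases hx : x = 0
  · subst hx
    simpa using IsPartialField.padd_zero (0 : P)
  · rw [← IsPartialField.mul_padd x a b hx]
    exact Part.mem_map _ h

protected theorem mul_neg (x p : P) : x * -p = -(x * p) := by
  have h := mul_mem_padd x (zero_mem_padd_neg p)
  rw [mul_zero] at h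
  exact (IsPartialField.padd_eq_zero_iff _ _).1 h

/-- Each pair `a`, `-a` is joined to the root as a subtree with label `0`, and `r + 0 = r`. -/
theorem assoc_add_pairs {S : Multiset P} {r : P} (h : Assoc S r) (Z : Multiset P) :
    Assoc (S + (Z + Z.map (fun z => -z))) r := by
  induction Z using Multiset.induction_on with
  | empty => simpa using h
  | cons a Z ih =>
    have h2 : Assoc (({a} : Multiset P) + {-a}) 0 :=
      Assoc.node (Assoc.leaf a) (Assoc.leaf (-a)) (zero_mem_padd_neg a)
    have h3 := Assoc.node ih h2 (IsPartialField.padd_zero r)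
    convert h3 using 1
    simp only [← Multiset.singleton_add, Multiset.map_add, Multiset.map_singleton]
    abel

theorem SumsTo.add {S T : Multiset P} {u w r : P} (hS : SumsTo S u) (hT : SumsTo T w)
    (hr : r ∈ padd u w) : SumsTo (S + T) r := by
  obtain ⟨Z, hZ⟩ := hS
  obtain ⟨Y, hY⟩ := hT
  refine ⟨Z + Y, ?_⟩
  convert Assoc.node hZ hY hr using 1
  simp only [Multiset.map_add]
  abel

theorem SumsTo.singleton (p : P) : SumsTo {p} p := ⟨0, by simpa using Assoc.leaf p⟩

theorem SumsTo.zero : SumsTo (0 : Multiset P) 0 := by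
  -- A tree has at least one leaf, so the empty sum needs an auxiliary pair `1`, `-1`.
  refine ⟨{1}, ?_⟩
  simpa using Assoc.node (Assoc.leaf (1 : P)) (Assoc.leaf (-1)) (zero_mem_padd_neg 1)

theorem SumsTo.of_add_pairs {S : Multiset P} {r : P} (T : Multiset P)
    (h : SumsTo (S + (T + T.map (fun z => -z))) r) : SumsTo S r := by
  obtain ⟨Z, hZ⟩ := h
  refine ⟨T + Z, ?_⟩
  convert hZ using 1
  simp only [Multiset.map_add]
  abel

theorem SumsTo.add_pairs {S : Multiset P} {r : P} (T : Multiset P) (h : SumsTo S r) :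
    SumsTo (S + (T + T.map (fun z => -z))) r := by
  obtain ⟨Z, hZ⟩ := h
  refine ⟨Z, ?_⟩
  convert assoc_add_pairs hZ T using 1
  abel

theorem Assoc.map_mul (x : P) {S : Multiset P} {r : P} (h : Assoc S r) :
    Assoc (S.map (fun s => x * s)) (x * r) := by
  induction h with
  | leaf p => simpa using Assoc.leaf (x * p)
  | node _ _ hr ih1 ih2 =>
    rw [Multiset.map_add]
    exact Assoc.node ih1 ih2 (mul_mem_padd x hr)

theorem SumsTo.map_mul (x : P) {S : Multiset P} {r : P} (h : SumsTo S r) :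
    SumsTo (S.map (fun s => x * s)) (x * r) := by
  obtain ⟨Z, hZ⟩ := h
  refine ⟨Z.map (fun s => x * s), ?_⟩
  convert PartialField.Assoc.map_mul x hZ using 1
  simp [Multiset.map_map, PartialField.mul_neg]

/-- The formal sum of a multiset in the monoid ring. -/
noncomputable def formalSum (S : Multiset P) : MonoidAlgebra ℤ P :=
  (S.map (MonoidAlgebra.of ℤ P)).sum

theorem formalSum_add (S T : Multiset P) : formalSum (S + T) = formalSum S + formalSum T := by
  simp [formalSum]

theorem formalSum_map_mul (x : P) (S : Multiset P) :
    formalSum (S.map (fun s => x * s)) = MonoidAlgebra.of ℤ P x * formalSum S := by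
  simp only [formalSum, Multiset.map_map, ← Multiset.sum_map_mul_left]
  congr 1
  refine Multiset.map_congr rfl fun s _ => ?_
  simp only [Function.comp, map_mul]

theorem formalSum_injective : Function.Injective (formalSum (P := P)) := by
  classical
  have key : ∀ (S : Multiset P) (p : P), (formalSum S).coeff p = (S.count p : ℤ) := by
    intro S p
    induction S using Multiset.induction_on with
    | empty => simp [formalSum]
    | cons a S ih =>
      rw [← Multiset.singleton_add, formalSum_add, Multiset.count_add]
      simp only [MonoidAlgebra.coeff_add, Finsupp.add_apply, ih]
      simp [formalSum, MonoidAlgebra.of_apply, Finsupp.single_apply, Multiset.count_singleton, eq_comm]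
  intro S T h
  ext p
  have := key S p
  rw [h, key T p] at this
  exact_mod_cast this.symm

/-- The formal sums whose value is forced to be zero. -/
def IsNull (f : MonoidAlgebra ℤ P) : Prop :=
  ∃ S T : Multiset P, f = formalSum S - formalSum T ∧ SumsTo (S + T.map (fun t => -t)) 0

/-- Nullity does not depend on how a formal sum is written as a difference: `S - T = S' - T'` means
`S + T' = S' + T` as multisets, and inserting or removing cancelling pairs does not change the value
of a sum. -/
theorem isNull_iff (S T : Multiset P) :
    IsNull (formalSum S - formalSum T) ↔ SumsTo (S + T.map (fun t => -t)) 0 := by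
  refine ⟨?_, fun h => ⟨S, T, rfl, h⟩⟩
  rintro ⟨S', T', h, h'⟩
  have e : S + T' = S' + T := by
    apply formalSum_injective
    rw [formalSum_add, formalSum_add]
    linear_combination h
  have h2 := SumsTo.add_pairs T h'
  apply SumsTo.of_add_pairs T'
  convert h2 using 1
  calc _ = (S + T') + (T.map (fun t => -t) + T'.map (fun t => -t)) := by abel
    _ = _ := by rw [e]; abel

theorem IsNull.add {f g : MonoidAlgebra ℤ P} (hf : IsNull f) (hg : IsNull g) : IsNull (f + g) := by
  obtain ⟨S, T, rfl, h⟩ := hf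
  obtain ⟨S', T', rfl, h'⟩ := hg
  refine ⟨S + S', T + T', ?_, ?_⟩
  · rw [formalSum_add, formalSum_add]; ring
  · convert SumsTo.add h h' (IsPartialField.padd_zero 0) using 1
    rw [Multiset.map_add]; abel

theorem IsNull.neg {f : MonoidAlgebra ℤ P} (hf : IsNull f) : IsNull (-f) := by
  obtain ⟨S, T, rfl, h⟩ := hf
  refine ⟨T, S, by ring, ?_⟩
  have := SumsTo.map_mul (-1) h
  simpa [Multiset.map_map, mul_comm (-1 : P), PartialField.mul_neg, PartialField.neg_neg,
    PartialField.neg_zero, add_comm] using this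

theorem isNull_zero : IsNull (0 : MonoidAlgebra ℤ P) :=
  ⟨0, 0, by simp, by simpa using SumsTo.zero⟩

theorem IsNull.of_mul (x : P) {f : MonoidAlgebra ℤ P} (hf : IsNull f) :
    IsNull (MonoidAlgebra.of ℤ P x * f) := by
  obtain ⟨S, T, rfl, h⟩ := hf
  refine ⟨S.map (fun s => x * s), T.map (fun s => x * s), ?_, ?_⟩
  · rw [formalSum_map_mul, formalSum_map_mul, mul_sub]
  · have := SumsTo.map_mul x h
    simpa [Multiset.map_map, PartialField.mul_neg] using this

variable (P) in
/-- The additive group of null formal sums. -/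
def nullSubgroup : AddSubgroup (MonoidAlgebra ℤ P) where
  carrier := {f | IsNull f}
  add_mem' := IsNull.add
  zero_mem' := isNull_zero
  neg_mem' := IsNull.neg

variable (P) in
/-- The ideal of null formal sums. -/
def nullIdeal : Ideal (MonoidAlgebra ℤ P) where
  carrier := {f | IsNull f}
  add_mem' := IsNull.add
  zero_mem' := isNull_zero
  smul_mem' := by
    intro c f hf
    induction c using MonoidAlgebra.induction_on with
    | of x => exact IsNull.of_mul x hf
    | add a b ha hb =>
      rw [smul_eq_mul, add_mul]; exact IsNull.add ha hb
    | smul n a ha =>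
      rw [smul_eq_mul, smul_mul_assoc]
      exact (nullSubgroup P).zsmul_mem ha n

variable (P) in
/-- The universal ring of a partial field. -/
abbrev UniversalRing : Type _ := MonoidAlgebra ℤ P ⧸ nullIdeal P

variable (P) in
/-- The canonical map of a partial field to its universal ring. -/
noncomputable def toRing : P →* UniversalRing P :=
  ((Ideal.Quotient.mk (nullIdeal P)) : MonoidAlgebra ℤ P →* UniversalRing P).comp
    (MonoidAlgebra.of ℤ P)

theorem mk_formalSum (S : Multiset P) :
    Ideal.Quotient.mk (nullIdeal P) (formalSum S) = (S.map (toRing P)).sum := by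
  simp [formalSum, map_multiset_sum, Multiset.map_map, toRing, Function.comp_def]

theorem sum_toRing_eq_iff_sumsTo {S : Multiset P} {r : P} :
    (S.map (toRing P)).sum = toRing P r ↔ SumsTo S r := by
  have e : toRing P r = (({r} : Multiset P).map (toRing P)).sum := by simp
  rw [e, ← mk_formalSum, ← mk_formalSum, Ideal.Quotient.eq]
  change IsNull _ ↔ _
  rw [isNull_iff]
  constructor
  · intro h
    have h2 := SumsTo.add (SumsTo.singleton r) h (IsPartialField.padd_zero r)
    apply SumsTo.of_add_pairs {r}
    convert h2 using 1
    simp only [Multiset.map_singleton]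
    abel
  · intro h
    exact SumsTo.add h (by simpa using SumsTo.singleton (-r)) (zero_mem_padd_neg r)

/-- The only use of the associative law. An association of `{p, q} ∪ Z` with root `r`, compared with
those of `{p} ∪ Z` with root `p` and of `{q}` with root `q`, forces `p + q` to be defined and equal
to `r`. -/
theorem toRing_add_eq_iff {p q r : P} : toRing P p + toRing P q = toRing P r ↔ r ∈ padd p q := by
  have e : toRing P p + toRing P q = ((({p} : Multiset P) + {q}).map (toRing P)).sum := by simp
  rw [e, sum_toRing_eq_iff_sumsTo]
  constructor
  · rintro ⟨Z, hZ⟩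
    refine IsPartialField.assoc (({p} : Multiset P) + (Z + Z.map (fun z => -z))) {q} r p q ?_
      (assoc_add_pairs (Assoc.leaf p) Z) (Assoc.leaf q)
    convert hZ using 1
    abel
  · exact fun h => SumsTo.add (SumsTo.singleton p) (SumsTo.singleton q) h

theorem toRing_zero : toRing P 0 = 0 := by
  have := toRing_add_eq_iff.2 (IsPartialField.padd_zero (0 : P))
  simpa using this

theorem toRing_neg (p : P) : toRing P (-p) = -toRing P p := by
  have := toRing_add_eq_iff.2 (zero_mem_padd_neg p)
  rw [toRing_zero] at this
  linear_combination this

theorem toRing_injective : Function.Injective (toRing P) := by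
  intro p q h
  have h1 : toRing P p + toRing P (-q) = toRing P 0 := by
    rw [toRing_neg, toRing_zero, h, add_neg_cancel]
  have h2 := (IsPartialField.padd_eq_zero_iff _ _).1 (toRing_add_eq_iff.1 h1)
  rw [← PartialField.neg_neg p, ← h2, PartialField.neg_neg]

theorem toRing_eq_zero_iff {p : P} : toRing P p = 0 ↔ p = 0 := by
  rw [← toRing_zero, toRing_injective.eq_iff]

instance : Nontrivial (UniversalRing P) :=
  ⟨⟨toRing P 0, toRing P 1, fun h => IsPartialField.zero_ne_one (toRing_injective h)⟩⟩

/-- This makes row operations, expansion and Cramer's rule available. The transposition reconciles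
`a_{iσ(i)}` with the convention of `Matrix.det_apply`. -/
theorem hasDet_iff {n : ℕ} (A : Matrix (Fin n) (Fin n) P) (d : P) :
    HasDet A d ↔ (A.map (toRing P)).det = toRing P d := by
  rw [HasDet, ← sum_toRing_eq_iff_sumsTo, ← Matrix.det_transpose, Matrix.det_apply, detTerms,
    Multiset.map_map, Finset.sum_eq_multiset_sum]
  refine Eq.congr (congrArg Multiset.sum (Multiset.map_congr rfl fun σ _ => ?_)) rfl
  rcases Int.units_eq_one_or (Equiv.Perm.sign σ) with h | h
  · simp [h]
  · simp [h, toRing_neg]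

/-- The ring homomorphism induced by a homomorphism from a partial field to a ring. -/
noncomputable def liftHom {T : Type*} [CommRing T] (h : P →* T)
    (hadd : ∀ a b c : P, c ∈ padd a b → h a + h b = h c) : UniversalRing P →+* T :=
  Ideal.Quotient.lift (nullIdeal P) (MonoidAlgebra.lift ℤ T P h).toRingHom (by
    have h0 : h 0 = 0 := by simpa using hadd 0 0 0 (IsPartialField.padd_zero 0)
    have hneg : ∀ z, h (-z) = - h z := fun z => by
      have := hadd _ _ _ (zero_mem_padd_neg z)
      rw [h0] at this
      linear_combination this
    have hA : ∀ (S : Multiset P) (r : P), Assoc S r → (S.map h).sum = h r := by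
      intro S r hS
      induction hS with
      | leaf p => simp
      | node _ _ hr ih1 ih2 => rw [Multiset.map_add, Multiset.sum_add, ih1, ih2, hadd _ _ _ hr]
    have hS : ∀ (S : Multiset P), (MonoidAlgebra.lift ℤ T P h) (formalSum S) = (S.map h).sum := by
      intro S
      simp [formalSum, map_multiset_sum, Multiset.map_map]
    rintro f ⟨S, U, rfl, Z, hZ⟩
    have := hA _ _ hZ
    have hm : ∀ W : Multiset P, (W.map fun x => -h x).sum = -(W.map h).sum := fun W => by
      induction W using Multiset.induction_on with
      | empty => simp
      | cons a W ih => simp only [Multiset.map_cons, Multiset.sum_cons, ih]; ring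
    simp only [Multiset.map_add, Multiset.sum_add, Multiset.map_map, Function.comp_def, hneg,
      hm, h0] at this
    change (MonoidAlgebra.lift ℤ T P h) _ = 0
    rw [map_sub, hS, hS]
    linear_combination this)

theorem liftHom_toRing {T : Type*} [CommRing T] (h : P →* T)
    (hadd : ∀ a b c : P, c ∈ padd a b → h a + h b = h c) (p : P) :
    liftHom h hadd (toRing P p) = h p := by
  simp [liftHom, toRing]

variable (P) in
/-- The units of the universal ring that come from the partial field. -/
def unitSubgroup : Subgroup (UniversalRing P)ˣ where
  carrier := {u | ∃ p : P, toRing P p = u}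
  one_mem' := ⟨1, by simp⟩
  mul_mem' := by
    rintro u v ⟨p, hp⟩ ⟨q, hq⟩
    exact ⟨p * q, by simp [hp, hq]⟩
  inv_mem' := by
    rintro u ⟨p, hp⟩
    have hp0 : p ≠ 0 := by
      rintro rfl
      rw [toRing_zero] at hp
      exact u.ne_zero hp.symm
    obtain ⟨q, hq⟩ := IsPartialField.exists_inv p hp0
    refine ⟨q, ?_⟩
    have := congrArg (toRing P) hq
    rw [map_mul, map_one, hp] at this
    exact (Units.inv_eq_of_mul_eq_one_right this).symm

end Basic

/-! ### Elements of a group of units. -/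

section UnitsIn

variable {R : Type*} [CommRing R]

/-- The element `a` is a unit that belongs to the subgroup `G`. -/
def UnitsIn (G : Subgroup Rˣ) (a : R) : Prop := ∃ u ∈ G, (u : R) = a

variable {G : Subgroup Rˣ} {a b c : R}

theorem UnitsIn.isUnit (h : UnitsIn G a) : IsUnit a := by
  obtain ⟨u, -, rfl⟩ := h
  exact u.isUnit

theorem UnitsIn.ne_zero [Nontrivial R] (h : UnitsIn G a) : a ≠ 0 := h.isUnit.ne_zero

theorem UnitsIn.one : UnitsIn G (1 : R) := ⟨1, one_mem _, rfl⟩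

theorem UnitsIn.mul (ha : UnitsIn G a) (hb : UnitsIn G b) : UnitsIn G (a * b) := by
  obtain ⟨u, hu, rfl⟩ := ha
  obtain ⟨v, hv, rfl⟩ := hb
  exact ⟨u * v, mul_mem hu hv, by simp⟩

theorem UnitsIn.exists_inv (ha : UnitsIn G a) : ∃ b, UnitsIn G b ∧ a * b = 1 := by
  obtain ⟨u, hu, rfl⟩ := ha
  exact ⟨(u⁻¹ : Rˣ), ⟨u⁻¹, inv_mem hu, rfl⟩, by simp⟩

theorem UnitsIn.of_mul_eq (hb : UnitsIn G b) (hc : UnitsIn G c) (h : a * b = c) : UnitsIn G a := by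
  obtain ⟨d, hd, hbd⟩ := hb.exists_inv
  have : a = c * d := by linear_combination -a * hbd + d * h
  rw [this]
  exact hc.mul hd

theorem UnitsIn.neg (hG : -1 ∈ G) (ha : UnitsIn G a) : UnitsIn G (-a) := by
  have h : UnitsIn G (-1 : R) := ⟨-1, hG, by simp⟩
  simpa using h.mul ha

theorem UnitsIn.exists_div (ha : UnitsIn G a) (hb : UnitsIn G b) :
    ∃ c, UnitsIn G c ∧ a = c * b := by
  obtain ⟨d, hd, h⟩ := hb.exists_inv
  exact ⟨a * d, ha.mul hd, by linear_combination -a * h⟩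

theorem UnitsIn.cancel (ha : UnitsIn G a) (h : a * b = a * c) : b = c :=
  ha.isUnit.mul_left_cancel h

end UnitsIn

/-! ### Basis exchange. -/

section Swap

variable {α : Type*}

/-- The set `X - x + e`. -/
abbrev swap (X : Set α) (x e : α) : Set α := insert e (X \ {x})

theorem swap_swap {X : Set α} {x e : α} (hx : x ∈ X) (he : e ∉ X) :
    swap (swap X x e) e x = X := by
  ext y
  simp only [swap, Set.mem_insert_iff, Set.mem_sdiff, Set.mem_singleton_iff]
  grind

theorem diff_swap {E X : Set α} {x e : α} (hx : x ∈ X) (hX : X ⊆ E) (he : e ∈ E \ X) :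
    E \ swap X x e = swap (E \ X) e x := by
  ext y
  have := hX hx
  simp only [swap, Set.mem_insert_iff, Set.mem_sdiff, Set.mem_singleton_iff] at he ⊢
  grind

/-- Any base can be reached from any other one by exchanges, avoiding a given set. -/
theorem base_induction {M : Matroid α} [M.Finite] (C : Set α) {X₀ : Set α} (hX₀ : M.IsBase X₀)
    (hC₀ : Disjoint X₀ C) {Q : Set α → Prop} (h0 : Q X₀)
    (step : ∀ X x e, M.IsBase X → Disjoint X C → x ∈ X → e ∈ M.E \ X → e ∉ C →
      M.IsBase (swap X x e) → Q X → Q (swap X x e))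
    {Y : Set α} (hY : M.IsBase Y) (hYC : Disjoint Y C) : Q Y := by
  have hfin : M.E.Finite := M.ground_finite
  -- Induction on the size of `X \ Y`. The new element always comes from `Y`, which is disjoint from
  -- `C`.
  have key : ∀ n : ℕ, ∀ X, M.IsBase X → Disjoint X C → Q X → (X \ Y).ncard = n → Q Y := by
    intro n
    induction n with
    | zero =>
      intro X hX hXC hQ h
      have hf : (X \ Y).Finite := (hfin.subset hX.subset_ground).subset Set.sdiff_subset
      rw [Set.ncard_eq_zero hf, Set.sdiff_eq_empty] at h
      rwa [← hX.eq_of_subset_isBase hY h]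
    | succ n ih =>
      intro X hX hXC hQ h
      have hne : (X \ Y).Nonempty := by
        apply Set.nonempty_of_ncard_ne_zero; omega
      obtain ⟨x, hx⟩ := hne
      obtain ⟨y, hy, hb⟩ := hX.exchange hY hx
      have hyC : y ∉ C := fun hc => Set.disjoint_left.1 hYC hy.1 hc
      refine ih (swap X x y) hb ?_ (step X x y hX hXC hx.1 ⟨hY.subset_ground hy.1, hy.2⟩ hyC hb hQ) ?_
      · rw [Set.disjoint_left] at hXC ⊢
        rintro z (rfl | hz)
        · exact hyC
        · exact hXC hz.1
      · have hf : (X \ Y).Finite := (hfin.subset hX.subset_ground).subset Set.sdiff_subset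
        have e : swap X x y \ Y = (X \ Y) \ {x} := by
          ext z
          simp only [swap, Set.mem_insert_iff, Set.mem_sdiff, Set.mem_singleton_iff] at hx hy ⊢
          grind
        rw [e, Set.ncard_sdiff_singleton_of_mem hx, h]
        rfl
  exact key _ X₀ hX₀ hC₀ h0 rfl

end Swap

/-! ### Systems of coordinates; duality, deletion and scaling. -/

section Tableau

variable {α : Type*} {R : Type*} [CommRing R]

/-- A system of coordinates for a matroid: `A X x e` is the coordinate at `x` of the element `e`
with respect to the base `X`. The nonzero coordinates are units from `G`, and the coordinates for
different bases are related by pivoting. -/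
structure IsTableau (M : Matroid α) (G : Subgroup Rˣ) (A : Set α → α → α → R) : Prop where
  self : ∀ X x, M.IsBase X → x ∈ X → A X x x = 1
  off : ∀ X x y, M.IsBase X → x ∈ X → y ∈ X → y ≠ x → A X x y = 0
  zero_or : ∀ X x e, M.IsBase X → x ∈ X → e ∈ M.E \ X → A X x e = 0 ∨ UnitsIn G (A X x e)
  base_iff : ∀ X x e, M.IsBase X → x ∈ X → e ∈ M.E \ X → (M.IsBase (swap X x e) ↔ A X x e ≠ 0)
  piv_row : ∀ X x e f, M.IsBase X → x ∈ X → e ∈ M.E \ X → A X x e ≠ 0 → f ∈ M.E →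
    A (swap X x e) e f * A X x e = A X x f
  piv : ∀ X x e y f, M.IsBase X → x ∈ X → e ∈ M.E \ X → A X x e ≠ 0 → y ∈ X → y ≠ x → f ∈ M.E →
    A (swap X x e) y f * A X x e = A X y f * A X x e - A X y e * A X x f

variable {M : Matroid α} {G : Subgroup Rˣ} {A : Set α → α → α → R}

theorem IsTableau.unit (hA : IsTableau M G A) {X : Set α} {x e : α} (hX : M.IsBase X) (hx : x ∈ X)
    (he : e ∈ M.E \ X) (h : A X x e ≠ 0) : UnitsIn G (A X x e) :=
  (hA.zero_or X x e hX hx he).resolve_left h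

open Classical in
/-- The coordinates of the dual matroid. -/
noncomputable def dualTableau (E : Set α) (A : Set α → α → α → R) : Set α → α → α → R :=
  fun Y y e => if e ∈ Y then (if e = y then 1 else 0) else -A (E \ Y) e y

theorem dualTableau_of_notMem {E : Set α} {A : Set α → α → α → R} {Y : Set α} {y e : α}
    (h : e ∉ Y) : dualTableau E A Y y e = -A (E \ Y) e y := by
  simp [dualTableau, h]

theorem dualTableau_compl {X : Set α} (hX : X ⊆ M.E) {x e : α} (hx : x ∈ X) :
    dualTableau M.E A (M.E \ X) e x = -A X x e := by
  rw [dualTableau_of_notMem (fun h => h.2 hx), Set.sdiff_sdiff_cancel_left hX]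

/-- Coordinates `[I | D]` at `X` become `[-Dᵀ | I]` at the complement, and a pivot on `(x, e)`
becomes a pivot on `(e, x)`. The cases below ask whether the column `f` belongs to an identity
matrix before and after the pivot. -/
theorem IsTableau.dual [Nontrivial R] (hG : -1 ∈ G) (hA : IsTableau M G A) :
    IsTableau M✶ G (dualTableau M.E A) := by
  have main : ∀ Y, M✶.IsBase Y → ∃ X, M.IsBase X ∧ X ⊆ M.E ∧ Y = M.E \ X ∧ M.E \ Y = X := by
    intro Y hY
    exact ⟨M.E \ Y, hY.compl_isBase_of_dual, Set.sdiff_subset,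
      (Set.sdiff_sdiff_cancel_left hY.subset_ground).symm, rfl⟩
  refine ⟨?_, ?_, ?_, ?_, ?_, ?_⟩
  · intro Y y hY hy
    simp [dualTableau, hy]
  · intro Y y z hY hy hz hne
    simp [dualTableau, hz, hne]
  · intro Y y e hY hy he
    obtain ⟨X, hX, hXE, rfl, -⟩ := main Y hY
    have heX : e ∈ X := by by_contra h; exact he.2 ⟨he.1, h⟩
    rw [dualTableau_compl hXE heX]
    rcases hA.zero_or X e y hX heX hy with h | h
    · exact Or.inl (by simp [h])
    · exact Or.inr (h.neg hG)
  · intro Y y e hY hy he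
    obtain ⟨X, hX, hXE, rfl, -⟩ := main Y hY
    have heX : e ∈ X := by by_contra h; exact he.2 ⟨he.1, h⟩
    rw [dualTableau_compl hXE heX, neg_ne_zero, ← hA.base_iff X e y hX heX hy,
      ← diff_swap heX hXE hy, Matroid.dual_isBase_iff', Set.sdiff_sdiff_cancel_left]
    · simp
    · rintro z (rfl | hz)
      · exact hy.1
      · exact hXE hz.1
  · intro Y y e f hY hy he h hf
    obtain ⟨X, hX, hXE, rfl, -⟩ := main Y hY
    have heX : e ∈ X := by by_contra h; exact he.2 ⟨he.1, h⟩
    have hsub : swap X e y ⊆ M.E := by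
      rintro z (rfl | hz)
      · exact hy.1
      · exact hXE hz.1
    rw [dualTableau_compl hXE heX, neg_ne_zero] at h
    rw [dualTableau_compl hXE heX, ← diff_swap heX hXE hy]
    by_cases hfX : f ∈ X
    · rw [dualTableau_compl hXE hfX]
      by_cases hfe : f = e
      · subst hfe
        have : f ∈ M.E \ swap X f y := ⟨hXE hfX, by
          rintro (rfl | h')
          · exact hy.2 heX
          · exact h'.2 rfl⟩
        simp [dualTableau, if_pos this]
      · have : f ∈ swap X e y := Or.inr ⟨hfX, hfe⟩
        rw [dualTableau_compl hsub this]
        have := hA.piv X e y f e hX heX hy h hfX hfe (hXE heX)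
        rw [hA.self X e hX heX, hA.off X f e hX hfX heX (Ne.symm hfe)] at this
        linear_combination this
    · by_cases hfy : f = y
      · subst hfy
        have h1 : f ∈ swap X e f := Or.inl rfl
        rw [dualTableau_compl hsub h1]
        have := hA.piv_row X e f e hX heX hy h (hXE heX)
        rw [hA.self X e hX heX] at this
        simp only [dualTableau, if_pos hy, if_true]
        linear_combination this
      · have h1 : f ∈ M.E \ X := ⟨hf, hfX⟩
        have h2 : f ∈ M.E \ swap X e y := ⟨hf, by
          rintro (rfl | h')
          · exact hfy rfl
          · exact hfX h'.1⟩
        have hfe : f ≠ e := by rintro rfl; exact hfX heX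
        simp only [dualTableau, if_pos h1, if_pos h2, if_neg hfe, if_neg hfy]
        ring
  · intro Y y e z f hY hy he h hz hzy hf
    obtain ⟨X, hX, hXE, rfl, -⟩ := main Y hY
    have heX : e ∈ X := by by_contra h; exact he.2 ⟨he.1, h⟩
    have hsub : swap X e y ⊆ M.E := by
      rintro z (rfl | hz)
      · exact hy.1
      · exact hXE hz.1
    rw [dualTableau_compl hXE heX, neg_ne_zero] at h
    rw [dualTableau_compl hXE heX, dualTableau_compl hXE heX, ← diff_swap heX hXE hy]
    by_cases hfX : f ∈ X
    · rw [dualTableau_compl hXE hfX, dualTableau_compl hXE hfX]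
      by_cases hfe : f = e
      · subst hfe
        have h1 : f ∈ M.E \ swap X f y := ⟨hXE hfX, by
          rintro (rfl | h')
          · exact hy.2 heX
          · exact h'.2 rfl⟩
        have h2 : f ≠ z := by rintro rfl; exact hz.2 heX
        simp only [dualTableau, if_pos h1, if_neg h2]
        ring
      · have : f ∈ swap X e y := Or.inr ⟨hfX, hfe⟩
        rw [dualTableau_compl hsub this]
        have := hA.piv X e y f z hX heX hy h hfX hfe hz.1
        linear_combination this
    · by_cases hfy : f = y
      · subst hfy
        have h1 : f ∈ swap X e f := Or.inl rfl
        rw [dualTableau_compl hsub h1]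
        have := hA.piv_row X e f z hX heX hy h hz.1
        simp only [dualTableau, if_pos hy, if_true, if_neg (Ne.symm hzy)]
        linear_combination this
      · have h1 : f ∈ M.E \ X := ⟨hf, hfX⟩
        have h2 : f ∈ M.E \ swap X e y := ⟨hf, by
          rintro (rfl | h')
          · exact hfy rfl
          · exact hfX h'.1⟩
        simp only [dualTableau, if_pos h1, if_pos h2, if_neg hfy]
        ring

/-- The base `X₀` witnesses that `u` is not a coloop, so deletion preserves the rank. -/
theorem delete_isBase_iff_of_notMem {X₀ : Set α} {u : α} (hX₀ : M.IsBase X₀) (hu : u ∈ M.E \ X₀)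
    {X : Set α} : (M ＼ {u}).IsBase X ↔ M.IsBase X ∧ u ∉ X := by
  have h : M.Coindep {u} := by
    rw [Matroid.coindep_iff_subset_compl_isBase]
    exact ⟨X₀, hX₀, by simpa using hu⟩
  rw [h.delete_isBase_iff, Set.disjoint_singleton_right]

theorem IsTableau.delete (hA : IsTableau M G A) {X₀ : Set α} {u : α} (hX₀ : M.IsBase X₀)
    (hu : u ∈ M.E \ X₀) : IsTableau (M ＼ {u}) G A := by
  have hE : ∀ {e : α} {X : Set α}, e ∈ (M ＼ {u}).E \ X → e ∈ M.E \ X := fun h => ⟨h.1.1, h.2⟩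
  refine ⟨?_, ?_, ?_, ?_, ?_, ?_⟩
  all_goals simp only [delete_isBase_iff_of_notMem hX₀ hu]
  · exact fun X x hX hx => hA.self X x hX.1 hx
  · exact fun X x y hX hx => hA.off X x y hX.1 hx
  · exact fun X x e hX hx he => hA.zero_or X x e hX.1 hx (hE he)
  · intro X x e hX hx he
    rw [← hA.base_iff X x e hX.1 hx (hE he)]
    refine ⟨fun h => h.1, fun h => ⟨h, ?_⟩⟩
    rintro (rfl | h')
    · exact he.1.2 rfl
    · exact hX.2 h'.1
  · exact fun X x e f hX hx he h hf => hA.piv_row X x e f hX.1 hx (hE he) h hf.1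
  · exact fun X x e y f hX hx he h hy hne hf => hA.piv X x e y f hX.1 hx (hE he) h hy hne hf.1

/-- Rescaling the elements of the ground set. -/
def scaleTableau (k : α → Rˣ) (A : Set α → α → α → R) : Set α → α → α → R :=
  fun X x e => ((k x)⁻¹ : Rˣ) * k e * A X x e

theorem scaleTableau_ne_zero {k : α → Rˣ} {X : Set α} {x e : α} :
    scaleTableau k A X x e ≠ 0 ↔ A X x e ≠ 0 := by
  rw [scaleTableau, ← Units.val_mul, Ne, Units.mul_right_eq_zero]

theorem IsTableau.scale (hA : IsTableau M G A) {k : α → Rˣ} (hk : ∀ e, k e ∈ G) :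
    IsTableau M G (scaleTableau k A) := by
  have hz : ∀ {X x e}, scaleTableau k A X x e ≠ 0 → A X x e ≠ 0 := fun h =>
    scaleTableau_ne_zero.1 h
  have hinv : ∀ x, ((k x)⁻¹ : Rˣ) * (k x : R) = 1 := fun x => by simp
  refine ⟨?_, ?_, ?_, ?_, ?_, ?_⟩
  · intro X x hX hx
    simp [scaleTableau, hA.self X x hX hx]
  · intro X x y hX hx hy hne
    simp [scaleTableau, hA.off X x y hX hx hy hne]
  · intro X x e hX hx he
    rcases hA.zero_or X x e hX hx he with h | h
    · left; simp [scaleTableau, h]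
    · right
      exact UnitsIn.mul ⟨(k x)⁻¹ * k e, mul_mem (inv_mem (hk x)) (hk e), by simp⟩ h
  · intro X x e hX hx he
    rw [scaleTableau_ne_zero, hA.base_iff X x e hX hx he]
  · intro X x e f hX hx he h hf
    have := hA.piv_row X x e f hX hx he (hz h) hf
    simp only [scaleTableau]
    linear_combination (↑(k x)⁻¹ * k f * ↑(k e)⁻¹ * k e : R) * this +
      (↑(k x)⁻¹ * k f * A X x f) * hinv e
  · intro X x e y f hX hx he h hy hne hf
    have := hA.piv X x e y f hX hx he (hz h) hy hne hf
    simp only [scaleTableau]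
    linear_combination (↑(k y)⁻¹ * k f * ↑(k x)⁻¹ * k e : R) * this

end Tableau

/-! ### Formal properties of the lifting map on fundamental elements. -/

section LiftMap

variable {R S : Type*} [CommRing R] [CommRing S]

/-- The fundamental elements with respect to a group of units. -/
def Fund (G : Subgroup Rˣ) (p : R) : Prop := UnitsIn G p ∧ (1 - p = 0 ∨ UnitsIn G (1 - p))

/-- The properties of the map from the fundamental elements of a partial field to its lift. -/
structure IsLiftMap (G : Subgroup Rˣ) (H : Subgroup Sˣ) (lam : R → S) : Prop where
  neg_mem : -1 ∈ G
  neg_mem' : -1 ∈ H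
  mem : ∀ p, Fund G p → UnitsIn H (lam p)
  one : lam 1 = 1
  sub : ∀ p, Fund G p → p ≠ 1 → lam (1 - p) = 1 - lam p
  triple : ∀ p q r, Fund G p → Fund G q → Fund G r → p * q * r = 1 → lam p * lam q * lam r = 1
  neg_one : Fund G (-1) → lam (-1) = -1

variable {G : Subgroup Rˣ} {H : Subgroup Sˣ} {lam : R → S} {p q r : R}

theorem Fund.one : Fund G (1 : R) := ⟨UnitsIn.one, Or.inl (by ring)⟩

theorem Fund.sub (hp : Fund G p) (h : p ≠ 1) : Fund G (1 - p) := by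
  refine ⟨hp.2.resolve_left fun h' => h ?_, Or.inr ?_⟩
  · linear_combination -h'
  · rw [sub_sub_cancel]; exact hp.1

theorem Fund.inv (hG : -1 ∈ G) (hp : Fund G p) (h : p * q = 1) : Fund G q := by
  have hq : UnitsIn G q := by
    refine UnitsIn.of_mul_eq hp.1 UnitsIn.one (by rw [mul_comm, h])
  refine ⟨hq, ?_⟩
  have e : 1 - q = -q * (1 - p) := by linear_combination -h
  rcases hp.2 with h' | h'
  · left; rw [e, h', mul_zero]
  · right; rw [e]; exact (hq.neg hG).mul h'

namespace IsLiftMap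

variable (hl : IsLiftMap G H lam)
include hl

theorem inv (hp : Fund G p) (h : p * q = 1) : lam p * lam q = 1 := by
  have := hl.triple p q 1 hp (hp.inv hl.neg_mem h) Fund.one (by rw [mul_one, h])
  rwa [hl.one, mul_one] at this

/-- The triple relation for `p⁻¹`, `q`, `r`. -/
theorem mul (hp : Fund G p) (hq : Fund G q) (hr : Fund G r) (h : p = q * r) :
    lam p = lam q * lam r := by
  obtain ⟨s, -, hs⟩ := hp.1.exists_inv
  have h1 := hl.triple s q r (hp.inv hl.neg_mem hs) hq hr (by rw [mul_assoc, ← h, mul_comm, hs])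
  have h2 := hl.inv hp hs
  linear_combination -(lam p) * h1 + lam q * lam r * h2

/-- Apply `lam` to `1 - p = (-p)(1 - p⁻¹)` and cancel the unit `1 - lam p⁻¹`. For `p = 1` both sides
of the identity vanish, and the relation for `-1` is needed. -/
theorem neg (hp : Fund G p) (hn : Fund G (-p)) : lam (-p) = -lam p := by
  by_cases h1 : p = 1
  · subst h1
    rw [hl.neg_one hn, hl.one]
  · obtain ⟨s, -, hs⟩ := hp.1.exists_inv
    have hsF := hp.inv hl.neg_mem hs
    have hs1 : s ≠ 1 := by
      rintro rfl
      exact h1 (by simpa using hs)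
    have h2 := hl.mul (hp.sub h1) hn (hsF.sub hs1) (by linear_combination -hs)
    rw [hl.sub p hp h1, hl.sub s hsF hs1] at h2
    have h3 := hl.inv hp hs
    have h4 : UnitsIn H (1 - lam s) := by
      rw [← hl.sub s hsF hs1]; exact hl.mem _ (hsF.sub hs1)
    apply h4.cancel
    linear_combination -h2 - h3

end IsLiftMap

end LiftMap

/-! ### Cross ratios and lifts of tableaux. -/

section Lift

variable {α R S : Type*} [CommRing R] [CommRing S] [Nontrivial R] [Nontrivial S]

/-- A two by two submatrix without zero entries of the coordinate matrix of a base. -/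
structure Quad (M : Matroid α) (A : Set α → α → α → R) (X : Set α) (a b c d : α) : Prop where
  base : M.IsBase X
  ha : a ∈ X
  hb : b ∈ X
  hc : c ∈ M.E \ X
  hd : d ∈ M.E \ X
  ac : A X a c ≠ 0
  ad : A X a d ≠ 0
  bc : A X b c ≠ 0
  bd : A X b d ≠ 0

/-- The cross ratio of a two by two submatrix of `B` is the lift of that of `A`. -/
def Good (lam : R → S) (A : Set α → α → α → R) (B : Set α → α → α → S) (X : Set α)
    (a b c d : α) : Prop :=
  ∀ p, A X a c * A X b d = p * (A X a d * A X b c) →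
    B X a c * B X b d = lam p * (B X a d * B X b c)

/-- The tableau `B` is a lift of `A`. -/
structure IsLift (M : Matroid α) (H : Subgroup Sˣ) (lam : R → S) (A : Set α → α → α → R)
    (B : Set α → α → α → S) : Prop where
  tab : IsTableau M H B
  good : ∀ X a b c d, Quad M A X a b c d → Good lam A B X a b c d

variable {M : Matroid α} {G : Subgroup Rˣ} {H : Subgroup Sˣ} {lam : R → S}
  {A : Set α → α → α → R} {B : Set α → α → α → S} {X : Set α} {a b c d : α} {p : R}

theorem Quad.swap_row (h : Quad M A X a b c d) : Quad M A X b a c d :=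
  ⟨h.base, h.hb, h.ha, h.hc, h.hd, h.bc, h.bd, h.ac, h.ad⟩

theorem Quad.swap_col (h : Quad M A X a b c d) : Quad M A X a b d c :=
  ⟨h.base, h.ha, h.hb, h.hd, h.hc, h.ad, h.ac, h.bd, h.bc⟩

/-- Pivoting on `(a, d)` multiplies the entry at `(b, c)` by `1 - p`, so `1 - p` is zero or a
quotient of elements of `G`. With a repeated row or column, `p = 1`. -/
theorem Quad.fund (hA : IsTableau M G A) (h : Quad M A X a b c d)
    (hp : A X a c * A X b d = p * (A X a d * A X b c)) : Fund G p := by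
  have uac := hA.unit h.base h.ha h.hc h.ac
  have uad := hA.unit h.base h.ha h.hd h.ad
  have ubc := hA.unit h.base h.hb h.hc h.bc
  have ubd := hA.unit h.base h.hb h.hd h.bd
  have up : UnitsIn G p := UnitsIn.of_mul_eq (uad.mul ubc) (uac.mul ubd) hp.symm
  refine ⟨up, ?_⟩
  by_cases hab : a = b
  · subst hab
    left
    apply (uad.mul ubc).cancel
    linear_combination hp
  by_cases hcd : c = d
  · subst hcd
    left
    apply (uad.mul ubc).cancel
    linear_combination hp
  · have h1 := hA.piv X a d b c h.base h.ha h.hd h.ad h.hb (Ne.symm hab) h.hc.1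
    have hb' : M.IsBase (swap X a d) := (hA.base_iff X a d h.base h.ha h.hd).2 h.ad
    have hc' : c ∈ M.E \ swap X a d := ⟨h.hc.1, by
      rintro (rfl | h')
      · exact hcd rfl
      · exact h.hc.2 h'.1⟩
    have e : (1 - p) * (A X b c * A X a d) = A (swap X a d) b c * A X a d := by
      linear_combination -h1 + hp
    rcases hA.zero_or (swap X a d) b c hb' (Or.inr ⟨h.hb, Ne.symm hab⟩) hc' with h0 | h0
    · left
      rw [h0, zero_mul] at e
      apply (ubc.mul uad).cancel
      rw [mul_comm, e, mul_zero]
    · right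
      exact UnitsIn.of_mul_eq (ubc.mul uad) (h0.mul uad) e

theorem Quad.exists_ratio (hA : IsTableau M G A) (h : Quad M A X a b c d) :
    ∃ p, A X a c * A X b d = p * (A X a d * A X b c) ∧ Fund G p := by
  obtain ⟨p, -, hp⟩ := ((hA.unit h.base h.ha h.hc h.ac).mul
    (hA.unit h.base h.hb h.hd h.bd)).exists_div ((hA.unit h.base h.ha h.hd h.ad).mul
    (hA.unit h.base h.hb h.hc h.bc))
  exact ⟨p, hp, h.fund hA hp⟩

section

variable (hl : IsLiftMap G H lam) (hA : IsTableau M G A)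
include hl hA

/-- Exchanging the rows inverts the cross ratio, and `lam` respects inverses. -/
theorem Good.swap_row (hq : Quad M A X a b c d) (h : Good lam A B X a b c d) :
    Good lam A B X b a c d := by
  intro p hp
  have hF := hq.swap_row.fund hA hp
  obtain ⟨q, -, hpq⟩ := hF.1.exists_inv
  have h1 := h q (by linear_combination -q * hp - (A X b d * A X a c) * hpq)
  have h2 := hl.inv hF hpq
  linear_combination - lam p * h1 - (B X b c * B X a d) * h2

theorem Good.swap_col (hq : Quad M A X a b c d) (h : Good lam A B X a b c d) :
    Good lam A B X a b d c := by
  have := Good.swap_row hl hA hq h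
  intro p hp
  have := this p (by linear_combination hp)
  linear_combination this

theorem good_same_row (hq : Quad M A X a a c d) : Good lam A B X a a c d := by
  intro p hp
  have : p = 1 := by
    apply ((hA.unit hq.base hq.ha hq.hd hq.ad).mul (hA.unit hq.base hq.ha hq.hc hq.ac)).cancel
    linear_combination -hp
  subst this
  rw [hl.one]; ring

theorem good_same_col (hq : Quad M A X a b c c) : Good lam A B X a b c c := by
  intro p hp
  have : p = 1 := by
    apply ((hA.unit hq.base hq.ha hq.hc hq.ac).mul (hA.unit hq.base hq.hb hq.hc hq.bc)).cancel
    linear_combination -hp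
  subst this
  rw [hl.one, one_mul]

/-- The cross ratio of the rows `a`, `e` is the product of those of `a`, `b` and of `b`, `e`. All
three are fundamental, so `lam` respects this product. -/
theorem Good.trans_row {e : α} (hq : Quad M A X a b c d) (hq' : Quad M A X b e c d)
    (hc : UnitsIn H (B X b c)) (hd : UnitsIn H (B X b d))
    (h : Good lam A B X a b c d) (h' : Good lam A B X b e c d) : Good lam A B X a e c d := by
  intro p hp
  have hq2 : Quad M A X a e c d :=
    ⟨hq.base, hq.ha, hq'.hb, hq.hc, hq.hd, hq.ac, hq.ad, hq'.bc, hq'.bd⟩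
  have hF := hq2.fund hA hp
  obtain ⟨q, eq, hqF⟩ := hq.exists_ratio hA
  obtain ⟨r, er, hrF⟩ := hq'.exists_ratio hA
  have e1 : p = q * r := by
    apply ((((hA.unit hq.base hq.ha hq.hd hq.ad).mul (hA.unit hq.base hq'.hb hq.hc hq'.bc)).mul
      (hA.unit hq.base hq.hb hq.hc hq.bc)).mul (hA.unit hq.base hq.hb hq.hd hq.bd)).cancel
    linear_combination -(A X b c * A X b d) * hp + (A X b c * A X e d) * eq +
      q * (A X a d * A X b c) * er
  have e2 := hl.mul hF hqF hrF e1
  have g1 := h q eq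
  have g2 := h' r er
  apply (hc.mul hd).cancel
  rw [e2]
  linear_combination (B X b c * B X e d) * g1 + lam q * (B X a d * B X b c) * g2

theorem Good.trans_col {e : α} (hq : Quad M A X a b c d) (hq' : Quad M A X a b d e)
    (ha : UnitsIn H (B X a d)) (hb : UnitsIn H (B X b d))
    (h : Good lam A B X a b c d) (h' : Good lam A B X a b d e) : Good lam A B X a b c e := by
  intro p hp
  have hq2 : Quad M A X a b c e :=
    ⟨hq.base, hq.ha, hq'.hb, hq.hc, hq'.hd, hq.ac, hq'.ad, hq.bc, hq'.bd⟩
  have hF := hq2.fund hA hp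
  obtain ⟨q, eq, hqF⟩ := hq.exists_ratio hA
  obtain ⟨r, er, hrF⟩ := hq'.exists_ratio hA
  have e1 : p = q * r := by
    apply ((((hA.unit hq.base hq.ha hq'.hd hq'.ad).mul (hA.unit hq.base hq.hb hq.hc hq.bc)).mul
      (hA.unit hq.base hq.ha hq.hd hq.ad)).mul (hA.unit hq.base hq.hb hq.hd hq.bd)).cancel
    linear_combination -(A X a d * A X b d) * hp + (A X a d * A X b e) * eq +
      q * (A X a d * A X b c) * er
  have e2 := hl.mul hF hqF hrF e1
  have g1 := h q eq
  have g2 := h' r er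
  apply (ha.mul hb).cancel
  rw [e2]
  linear_combination (B X a d * B X b e) * g1 + lam q * (B X a d * B X b c) * g2

end

/-- A partial system of coordinates: it is closed under pivoting on units. -/
structure IsFrameSystem (E : Set α) (Fr : Set α → Prop) (B : Set α → α → α → S) : Prop where
  self : ∀ X x, Fr X → x ∈ X → B X x x = 1
  off : ∀ X x y, Fr X → x ∈ X → y ∈ X → y ≠ x → B X x y = 0
  frame : ∀ X x e, Fr X → x ∈ X → e ∈ E \ X → IsUnit (B X x e) → Fr (swap X x e)
  piv_row : ∀ X x e f, Fr X → x ∈ X → e ∈ E \ X → IsUnit (B X x e) → f ∈ E →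
    B (swap X x e) e f * B X x e = B X x f
  piv : ∀ X x e y f, Fr X → x ∈ X → e ∈ E \ X → IsUnit (B X x e) → y ∈ X → y ≠ x → f ∈ E →
    B (swap X x e) y f * B X x e = B X y f * B X x e - B X y e * B X x f

theorem IsTableau.frameSystem (hB : IsTableau M H B) : IsFrameSystem M.E M.IsBase B where
  self := hB.self
  off := hB.off
  frame X x e hX hx he h := (hB.base_iff X x e hX hx he).2 h.ne_zero
  piv_row X x e f hX hx he h hf := hB.piv_row X x e f hX hx he h.ne_zero hf
  piv X x e y f hX hx he h hy hne hf := hB.piv X x e y f hX hx he h.ne_zero hy hne hf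

/-- The entry of `B` is zero or a unit from `H` according to the entry of `A`. -/
def Match (H : Subgroup Sˣ) (A : Set α → α → α → R) (B : Set α → α → α → S) (X : Set α)
    (x e : α) : Prop :=
  (A X x e = 0 → B X x e = 0) ∧ (A X x e ≠ 0 → UnitsIn H (B X x e))

/-- At the base `X`, the coordinates `B` have the same zeros as `A`. -/
def Supp (M : Matroid α) (H : Subgroup Sˣ) (A : Set α → α → α → R) (B : Set α → α → α → S)
    (X : Set α) : Prop :=
  ∀ x ∈ X, ∀ e ∈ M.E \ X, Match H A B X x e

/-- At the base `X`, the coordinates `B` have the same zeros as `A`, and all cross ratios are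
lifts of those of `A`. -/
structure LocGood (M : Matroid α) (H : Subgroup Sˣ) (lam : R → S) (A : Set α → α → α → R)
    (Fr : Set α → Prop) (B : Set α → α → α → S) (X : Set α) : Prop where
  frame : Fr X
  supp : Supp M H A B X
  good : ∀ a b c d, Quad M A X a b c d → Good lam A B X a b c d

theorem IsLift.match_entry (hA : IsTableau M G A) (hB : IsLift M H lam A B) (hX : M.IsBase X)
    {x e : α} (hx : x ∈ X) (he : e ∈ M.E \ X) : Match H A B X x e := by
  have h := hA.base_iff X x e hX hx he
  rw [hB.tab.base_iff X x e hX hx he] at h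
  exact ⟨fun h0 => by by_contra h1; exact h.1 h1 h0, fun h0 => hB.tab.unit hX hx he (h.2 h0)⟩

section

variable {Fr : Set α → Prop}

theorem Supp.extend (hA : IsTableau M G A) (hB : IsFrameSystem M.E Fr B) (hX : M.IsBase X)
    (hF : Fr X) (h : Supp M H A B X) {x e : α} (hx : x ∈ X) (he : e ∈ M.E) :
    Match H A B X x e := by
  by_cases heX : e ∈ X
  · by_cases hex : e = x
    · subst hex
      refine ⟨fun h0 => ?_, fun _ => ?_⟩
      · rw [hA.self X e hX hx] at h0
        exact absurd h0 one_ne_zero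
      · rw [hB.self X e hF hx]; exact UnitsIn.one
    · refine ⟨fun _ => hB.off X x e hF hx heX hex, fun h0 => absurd (hA.off X x e hX hx heX hex) h0⟩
  · exact h x hx e ⟨he, heX⟩

/-- In the critical case the pivoted entry at `(y, f)` is, up to a unit, `1 - p` for a cross ratio
`p`, and over the lift it is `1 - lam p`. This is `0` for `p = 1` and otherwise the unit `lam (1 -
p)`, so the zeros agree. The cross ratios at the new base are a separate matter. -/
theorem LocGood.pivot (hl : IsLiftMap G H lam) (hA : IsTableau M G A)
    (hB : IsFrameSystem M.E Fr B) (hX : M.IsBase X) (h : LocGood M H lam A Fr B X)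
    {x e : α} (hx : x ∈ X) (he : e ∈ M.E \ X) (hne : A X x e ≠ 0) :
    Fr (swap X x e) ∧ Supp M H A B (swap X x e) := by
  have ue := (h.supp x hx e he).2 hne
  have uA := hA.unit hX hx he hne
  have hF' := hB.frame X x e h.frame hx he ue.isUnit
  refine ⟨hF', ?_⟩
  have hext : ∀ y ∈ X, ∀ f ∈ M.E, Match H A B X y f := fun y hy f hf =>
    h.supp.extend hA hB hX h.frame hy hf
  rintro y hy f hf
  rcases hy with rfl | hy
  · have h1 := hA.piv_row X x y f hX hx he hne hf.1
    have h2 := hB.piv_row X x y f h.frame hx he ue.isUnit hf.1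
    have h3 := hext x hx f hf.1
    refine ⟨fun h0 => ?_, fun h0 => ?_⟩
    · rw [h0, zero_mul] at h1
      rw [h3.1 h1.symm] at h2
      exact (ue.isUnit.mul_left_eq_zero).1 h2
    · refine UnitsIn.of_mul_eq ue (h3.2 ?_) h2
      rw [← h1]
      exact fun h' => h0 ((uA.isUnit.mul_left_eq_zero).1 h')
  · have hyX := hy.1
    have hyx : y ≠ x := hy.2
    have h1 := hA.piv X x e y f hX hx he hne hyX hyx hf.1
    have h2 := hB.piv X x e y f h.frame hx he ue.isUnit hyX hyx hf.1
    have m1 := hext y hyX f hf.1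
    have m2 := hext y hyX e he.1
    have m3 := hext x hx f hf.1
    by_cases z : A X y e = 0 ∨ A X x f = 0
    · have hz : A X y e * A X x f = 0 := by rcases z with z | z <;> simp [z]
      have hz' : B X y e * B X x f = 0 := by
        rcases z with z | z
        · simp [m2.1 z]
        · simp [m3.1 z]
      rw [hz, sub_zero] at h1
      rw [hz', sub_zero] at h2
      have e1 := uA.isUnit.mul_right_cancel h1
      have e2 := ue.isUnit.mul_right_cancel h2
      rw [Match, e1, e2]
      exact m1
    · push Not at z
      by_cases z1 : A X y f = 0
      · rw [m1.1 z1, zero_mul, zero_sub] at h2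
        rw [z1, zero_mul, zero_sub] at h1
        refine ⟨fun h0 => ?_, fun _ => UnitsIn.of_mul_eq ue
          (((m2.2 z.1).mul (m3.2 z.2)).neg hl.neg_mem') h2⟩
        rw [h0, zero_mul] at h1
        have uye := hA.unit hX hyX he z.1
        have : A X x f = 0 := (uye.isUnit.mul_right_eq_zero).1 (neg_eq_zero.1 h1.symm)
        exact absurd this z.2
      · have hfX : f ∉ X := by
          intro hfX
          by_cases hfy : f = y
          · exact z.2 (hA.off X x f hX hx hfX (by rw [hfy]; exact hyx))
          · exact z1 (hA.off X y f hX hyX hfX hfy)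
        have hq : Quad M A X y x f e := ⟨hX, hyX, hx, ⟨hf.1, hfX⟩, he, z1, z.1, z.2, hne⟩
        obtain ⟨p, hp, hpF⟩ := hq.exists_ratio hA
        have g := h.good _ _ _ _ hq p hp
        have uye := hA.unit hX hyX he z.1
        have uxf := hA.unit hX hx ⟨hf.1, hfX⟩ z.2
        have e1 : A (swap X x e) y f * A X x e = -(A X y e * A X x f) * (1 - p) := by
          linear_combination h1 + hp
        have e2 : B (swap X x e) y f * B X x e = -(B X y e * B X x f) * (1 - lam p) := by
          linear_combination h2 + g
        refine ⟨fun h0 => ?_, fun h0 => ?_⟩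
        · rw [h0, zero_mul] at e1
          have hp1 : 1 - p = 0 := (((uye.mul uxf).neg hl.neg_mem).isUnit.mul_right_eq_zero).1 e1.symm
          have hp2 : p = 1 := by linear_combination -hp1
          rw [hp2, hl.one, sub_self, mul_zero] at e2
          exact (ue.isUnit.mul_left_eq_zero).1 e2
        · have hp1 : p ≠ 1 := by
            rintro rfl
            rw [sub_self, mul_zero] at e1
            exact h0 ((uA.isUnit.mul_left_eq_zero).1 e1)
          refine UnitsIn.of_mul_eq ue ((((m2.2 z.1).mul (m3.2 z.2)).neg hl.neg_mem').mul ?_) e2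
          rw [← hl.sub p hpF hp1]
          exact hl.mem _ (hpF.sub hp1)

/-- A cross ratio at `X` is determined by the corresponding one after pivoting. -/
theorem LocGood.of_pivot (hl : IsLiftMap G H lam) (hA : IsTableau M G A)
    (hB : IsFrameSystem M.E Fr B) (hF : Fr X) (hq : Quad M A X a b c d)
    (uac : UnitsIn H (B X a c)) (h : LocGood M H lam A Fr B (swap X a c)) :
    Good lam A B X a b c d := by
  by_cases hab : a = b
  · subst hab; exact good_same_row hl hA hq
  by_cases hcd : c = d
  · subst hcd; exact good_same_col hl hA hq
  intro p hp
  have hpF := hq.fund hA hp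
  have hX := hq.base
  have haE := hX.subset_ground hq.ha
  have hX' : M.IsBase (swap X a c) := (hA.base_iff X a c hX hq.ha hq.hc).2 hq.ac
  have ta := hA.piv_row X a c a hX hq.ha hq.hc hq.ac haE
  have tad := hA.piv_row X a c d hX hq.ha hq.hc hq.ac hq.hd.1
  have tba := hA.piv X a c b a hX hq.ha hq.hc hq.ac hq.hb (Ne.symm hab) haE
  have tbd := hA.piv X a c b d hX hq.ha hq.hc hq.ac hq.hb (Ne.symm hab) hq.hd.1
  have sa := hB.piv_row X a c a hF hq.ha hq.hc uac.isUnit haE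
  have sad := hB.piv_row X a c d hF hq.ha hq.hc uac.isUnit hq.hd.1
  have sba := hB.piv X a c b a hF hq.ha hq.hc uac.isUnit hq.hb (Ne.symm hab) haE
  have sbd := hB.piv X a c b d hF hq.ha hq.hc uac.isUnit hq.hb (Ne.symm hab) hq.hd.1
  rw [hA.self X a hX hq.ha] at ta tba
  rw [hB.self X a hF hq.ha] at sa sba
  rw [hA.off X b a hX hq.hb hq.ha hab] at tba
  rw [hB.off X b a hF hq.hb hq.ha hab] at sba
  have hbX' : b ∈ swap X a c := Or.inr ⟨hq.hb, Ne.symm hab⟩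
  have hcX' : c ∈ swap X a c := Or.inl rfl
  have haX' : a ∈ M.E \ swap X a c := ⟨haE, by
    rintro (rfl | h')
    · exact hq.hc.2 hq.ha
    · exact h'.2 rfl⟩
  have hdX' : d ∈ M.E \ swap X a c := ⟨hq.hd.1, by
    rintro (rfl | h')
    · exact hcd rfl
    · exact hq.hd.2 h'.1⟩
  have uA := hA.unit hX hq.ha hq.hc hq.ac
  have uad := hA.unit hX hq.ha hq.hd hq.ad
  have ubc := hA.unit hX hq.hb hq.hc hq.bc
  by_cases hz : A (swap X a c) b d = 0
  · have h0 := (h.supp b hbX' d hdX').1 hz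
    rw [hz, zero_mul] at tbd
    rw [h0, zero_mul] at sbd
    have hp1 : p = 1 := by
      apply (uad.mul ubc).cancel
      linear_combination -hp - tbd
    rw [hp1, hl.one]
    linear_combination -sbd
  · have e1 : A (swap X a c) b d * A X a c = (p - 1) * (A X a d * A X b c) := by
      linear_combination tbd + hp
    have hp1 : p ≠ 1 := by
      rintro rfl
      rw [sub_self, zero_mul] at e1
      exact hz ((uA.isUnit.mul_left_eq_zero).1 e1)
    have hq' : Quad M A (swap X a c) c b a d := by
      refine ⟨hX', hcX', hbX', haX', hdX', ?_, ?_, ?_, hz⟩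
      · intro h0; rw [h0, zero_mul] at ta; exact zero_ne_one ta
      · intro h0; rw [h0, zero_mul] at tad; exact hq.ad tad.symm
      · intro h0; rw [h0, zero_mul] at tba; exact hq.bc (by linear_combination tba)
    -- Pivoting on `(a, c)` turns the cross ratio `p` into `1 - p`.
    have g := h.good c b a d hq' (1 - p) (by
      apply (uA.mul uA).cancel
      linear_combination (A (swap X a c) b d * A X a c) * ta + e1 -
        ((1 - p) * A (swap X a c) b a * A X a c) * tad - (1 - p) * A X a d * tba)
    rw [hl.sub p hpF hp1] at g
    linear_combination -sbd + (B X a c * B X a c) * g - (B (swap X a c) b d * B X a c) * sa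
      + (1 - lam p) * (B (swap X a c) b a * B X a c) * sad + (1 - lam p) * B X a d * sba

end

theorem IsLift.delete (hB : IsLift M H lam A B) {X₀ : Set α} {u : α} (hX₀ : M.IsBase X₀)
    (hu : u ∈ M.E \ X₀) : IsLift (M ＼ {u}) H lam A B := by
  refine ⟨hB.tab.delete hX₀ hu, fun X a b c d hq => hB.good X a b c d ?_⟩
  exact ⟨((delete_isBase_iff_of_notMem hX₀ hu).1 hq.base).1, hq.ha, hq.hb, ⟨hq.hc.1.1, hq.hc.2⟩,
    ⟨hq.hd.1.1, hq.hd.2⟩, hq.ac, hq.ad, hq.bc, hq.bd⟩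

theorem IsLift.scale (hB : IsLift M H lam A B) {k : α → Sˣ} (hk : ∀ e, k e ∈ H) :
    IsLift M H lam A (scaleTableau k B) := by
  refine ⟨hB.tab.scale hk, fun X a b c d hq p hp => ?_⟩
  have := hB.good X a b c d hq p hp
  simp only [scaleTableau]
  linear_combination (↑(k a)⁻¹ * k c * ↑(k b)⁻¹ * k d : S) * this

/-- Transposition does not change a cross ratio, and the four signs cancel. -/
theorem IsLift.dual (hl : IsLiftMap G H lam) (hB : IsLift M H lam A B) :
    IsLift M✶ H lam (dualTableau M.E A) (dualTableau M.E B) := by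
  refine ⟨hB.tab.dual hl.neg_mem', fun Y c d a b hq p hp => ?_⟩
  obtain ⟨X, hX, hXE, rfl⟩ : ∃ X, M.IsBase X ∧ X ⊆ M.E ∧ Y = M.E \ X :=
    ⟨M.E \ Y, hq.base.compl_isBase_of_dual, Set.sdiff_subset,
      (Set.sdiff_sdiff_cancel_left hq.base.subset_ground).symm⟩
  have haX : a ∈ X := by by_contra h; exact hq.hc.2 ⟨hq.hc.1, h⟩
  have hbX : b ∈ X := by by_contra h; exact hq.hd.2 ⟨hq.hd.1, h⟩
  obtain ⟨-, hc, hd, -, -, h1, h2, h3, h4⟩ := hq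
  rw [dualTableau_compl hXE (by assumption), neg_ne_zero] at h1 h2 h3 h4
  simp only [dualTableau_compl hXE haX, dualTableau_compl hXE hbX] at hp ⊢
  have hq' : Quad M A X a b c d := ⟨hX, haX, hbX, hc, hd, h1, h3, h2, h4⟩
  have := hB.good X a b c d hq' p (by linear_combination hp)
  linear_combination this

theorem IsLift.congr {A' : Set α → α → α → R} (hB : IsLift M H lam A B)
    (h : ∀ X x e, M.IsBase X → x ∈ X → e ∈ M.E \ X → A X x e = A' X x e) :
    IsLift M H lam A' B := by
  refine ⟨hB.tab, fun X a b c d hq p hp => ?_⟩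
  obtain ⟨hX, ha, hb, hc, hd, h1, h2, h3, h4⟩ := hq
  rw [← h X _ _ hX (by assumption) (by assumption)] at h1 h2 h3 h4
  rw [← h X a c hX ha hc, ← h X b d hX hb hd, ← h X a d hX ha hd, ← h X b c hX hb hc] at hp
  exact hB.good X a b c d ⟨hX, ha, hb, hc, hd, h1, h2, h3, h4⟩ p hp

/-- Dualizing twice restores the coordinates only outside the base, which is all that `IsLift.congr`
requires. -/
theorem IsLift.of_dual (hl : IsLiftMap G H lam) (hB : IsLift M✶ H lam (dualTableau M.E A) B) :
    IsLift M H lam A (dualTableau M.E B) := by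
  have := hB.dual hl
  rw [Matroid.dual_dual, Matroid.dual_ground] at this
  refine this.congr fun X x e hX hx he => ?_
  rw [dualTableau_of_notMem he.2, dualTableau_compl hX.subset_ground hx, neg_neg]

end Lift

/-! ### Coordinates defined by a row space. -/

section RowSpace

variable {α S : Type*} [CommRing S]

/-- The vector `l` of the row space `L` is the row of `x` with respect to `X`. -/
def IsRow (L : Submodule S (α → S)) (X : Set α) (x : α) (l : α → S) : Prop :=
  l ∈ L ∧ l x = 1 ∧ ∀ y ∈ X, y ≠ x → l y = 0

/-- The vectors of `L` are determined by their entries in `X`, which are arbitrary. -/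
structure IsFrame (L : Submodule S (α → S)) (E X : Set α) : Prop where
  ext : ∀ l ∈ L, (∀ x ∈ X, l x = 0) → ∀ e ∈ E, l e = 0
  exists_row : ∀ x ∈ X, ∃ l, IsRow L X x l

open Classical in
/-- The coordinates with respect to a row space. -/
noncomputable def rowCoord (L : Submodule S (α → S)) (X : Set α) (x : α) : α → S :=
  if h : ∃ l, IsRow L X x l then h.choose else 0

variable {L : Submodule S (α → S)} {E X : Set α}

theorem IsFrame.isRow (h : IsFrame L E X) {x : α} (hx : x ∈ X) :
    IsRow L X x (rowCoord L X x) := by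
  have h1 := h.exists_row x hx
  rw [rowCoord, dif_pos h1]
  exact h1.choose_spec

theorem IsFrame.eq_rowCoord (h : IsFrame L E X) {x : α} (hx : x ∈ X) {l : α → S}
    (hl : IsRow L X x l) {e : α} (he : e ∈ E) : l e = rowCoord L X x e := by
  have h2 := h.isRow hx
  have := h.ext (l - rowCoord L X x) (L.sub_mem hl.1 h2.1) (fun y hy => by
    by_cases hyx : y = x
    · subst hyx; simp [hl.2.1, h2.2.1]
    · simp [hl.2.2 y hy hyx, h2.2.2 y hy hyx]) e he
  exact sub_eq_zero.1 this

/-- The usual row operations give the rows after a pivot; they require only an inverse `u` of the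
pivot entry. A glued matrix thus has coordinates before it is known to define a tableau. -/
theorem isFrameSystem_rowCoord (L : Submodule S (α → S)) (E : Set α) :
    IsFrameSystem E (IsFrame L E) (rowCoord L) := by
  have key : ∀ X x e, IsFrame L E X → x ∈ X → e ∈ E \ X → ∀ u : S, u * rowCoord L X x e = 1 →
      IsFrame L E (swap X x e) ∧ IsRow L (swap X x e) e (u • rowCoord L X x) ∧
      ∀ y ∈ X, y ≠ x → IsRow L (swap X x e) y
        (rowCoord L X y - (rowCoord L X y e * u) • rowCoord L X x) := by
    intro X x e hX hx he u hu
    have hr := hX.isRow hx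
    have r1 : IsRow L (swap X x e) e (u • rowCoord L X x) := by
      refine ⟨L.smul_mem _ hr.1, by simpa using hu, ?_⟩
      rintro y (rfl | hy) hne
      · exact absurd rfl hne
      · simp [hr.2.2 y hy.1 hy.2]
    have r2 : ∀ y ∈ X, y ≠ x → IsRow L (swap X x e) y
        (rowCoord L X y - (rowCoord L X y e * u) • rowCoord L X x) := by
      intro y hy hyx
      have hs := hX.isRow hy
      refine ⟨L.sub_mem hs.1 (L.smul_mem _ hr.1), ?_, ?_⟩
      · simp [hs.2.1, hr.2.2 y hy hyx]
      · rintro z (rfl | hz) hne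
        · simp only [Pi.sub_apply, Pi.smul_apply, smul_eq_mul]
          linear_combination -rowCoord L X y z * hu
        · simp [hs.2.2 z hz.1 hne, hr.2.2 z hz.1 hz.2]
    refine ⟨⟨fun l hl h0 => ?_, ?_⟩, r1, r2⟩
    · have h1 := hX.ext (l - l x • rowCoord L X x) (L.sub_mem hl (L.smul_mem _ hr.1)) (by
        intro y hy
        by_cases hyx : y = x
        · subst hyx; simp [hr.2.1]
        · simp [hr.2.2 y hy hyx, h0 y (Or.inr ⟨hy, hyx⟩)])
      have h2 := h1 e he.1
      simp only [Pi.sub_apply, Pi.smul_apply, smul_eq_mul, h0 e (Or.inl rfl)] at h2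
      have h3 : l x = 0 := by linear_combination -u * h2 - l x * hu
      intro f hf
      simpa [h3] using h1 f hf
    · rintro y (rfl | hy)
      · exact ⟨_, r1⟩
      · exact ⟨_, r2 y hy.1 hy.2⟩
  refine ⟨?_, ?_, ?_, ?_, ?_⟩
  · exact fun X x hX hx => (hX.isRow hx).2.1
  · exact fun X x y hX hx hy hne => (hX.isRow hx).2.2 y hy hne
  · intro X x e hX hx he h
    obtain ⟨u, hu⟩ := h.exists_left_inv
    exact (key X x e hX hx he u hu).1
  · intro X x e f hX hx he h hf
    obtain ⟨u, hu⟩ := h.exists_left_inv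
    obtain ⟨h1, h2, -⟩ := key X x e hX hx he u hu
    rw [← h1.eq_rowCoord (Or.inl rfl) h2 hf]
    simp only [Pi.smul_apply, smul_eq_mul]
    linear_combination rowCoord L X x f * hu
  · intro X x e y f hX hx he h hy hne hf
    obtain ⟨u, hu⟩ := h.exists_left_inv
    obtain ⟨h1, -, h2⟩ := key X x e hX hx he u hu
    rw [← h1.eq_rowCoord (Or.inr ⟨hy, hne⟩) (h2 y hy hne) hf]
    simp only [Pi.sub_apply, Pi.smul_apply, smul_eq_mul]
    linear_combination (-rowCoord L X y e * rowCoord L X x f) * hu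

/-- The row space of a matrix that is given by its entries outside an identity matrix. -/
def rowSpace (E : Set α) (X : Finset α) (D : α → α → S) : Submodule S (α → S) where
  carrier := {l | ∀ y ∈ E \ X, l y = ∑ x ∈ X, l x * D x y}
  add_mem' := by
    intro l m hl hm y hy
    simp [hl y hy, hm y hy, add_mul, Finset.sum_add_distrib]
  zero_mem' := by intro y hy; simp
  smul_mem' := by
    intro c l hl y hy
    simp [hl y hy, Finset.mul_sum, mul_assoc]

theorem isFrame_rowSpace (E : Set α) (X : Finset α) (D : α → α → S) :
    IsFrame (rowSpace E X D) E X ∧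
      ∀ x ∈ X, ∀ y ∈ E \ X, rowCoord (rowSpace E X D) X x y = D x y := by
  classical
  have hr : ∀ x ∈ X, IsRow (rowSpace E X D) X x
      (fun e => if e ∈ X then (if e = x then 1 else 0) else D x e) := by
    intro x hx
    refine ⟨?_, by simp [hx], ?_⟩
    · intro y hy
      have : y ∉ X := hy.2
      simp only [this, if_false]
      rw [Finset.sum_eq_single x]
      · simp [hx]
      · intro b hb hne; simp [hb, hne]
      · exact fun h => absurd hx h
    · intro y hy hne
      have : y ∈ X := hy
      simp [this, hne]
  have hF : IsFrame (rowSpace E X D) E X := by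
    refine ⟨fun l hl h0 e he => ?_, fun x hx => ⟨_, hr x hx⟩⟩
    by_cases heX : e ∈ X
    · exact h0 e heX
    · rw [hl e ⟨he, heX⟩]
      exact Finset.sum_eq_zero fun x hx => by rw [h0 x hx, zero_mul]
  refine ⟨hF, fun x hx y hy => ?_⟩
  rw [← hF.eq_rowCoord hx (hr x hx) hy.1]
  have : y ∉ X := hy.2
  simp [this]

end RowSpace

/-! ### From local correctness at every base to a lift. -/

section Complete

variable {α R S : Type*} [CommRing R] [CommRing S] [Nontrivial R] [Nontrivial S]
  {M : Matroid α} {G : Subgroup Rˣ} {H : Subgroup Sˣ} {lam : R → S}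
  {A : Set α → α → α → R} {B : Set α → α → α → S} {Fr : Set α → Prop}

theorem isLift_of_locGood (hA : IsTableau M G A) (hB : IsFrameSystem M.E Fr B)
    (h : ∀ X, M.IsBase X → LocGood M H lam A Fr B X) : IsLift M H lam A B := by
  have hu : ∀ {X x e}, M.IsBase X → x ∈ X → e ∈ M.E \ X → B X x e ≠ 0 → A X x e ≠ 0 :=
    fun hX hx he hne h0 => hne (((h _ hX).supp _ hx _ he).1 h0)
  have hu' : ∀ {X x e}, M.IsBase X → x ∈ X → e ∈ M.E \ X → B X x e ≠ 0 → IsUnit (B X x e) :=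
    fun hX hx he hne => (((h _ hX).supp _ hx _ he).2 (hu hX hx he hne)).isUnit
  refine ⟨⟨?_, ?_, ?_, ?_, ?_, ?_⟩, fun X a b c d hq => (h X hq.base).good a b c d hq⟩
  · exact fun X x hX hx => hB.self X x (h X hX).frame hx
  · exact fun X x y hX hx hy hne => hB.off X x y (h X hX).frame hx hy hne
  · intro X x e hX hx he
    by_cases h0 : A X x e = 0
    · exact Or.inl (((h X hX).supp x hx e he).1 h0)
    · exact Or.inr (((h X hX).supp x hx e he).2 h0)
  · intro X x e hX hx he
    rw [hA.base_iff X x e hX hx he]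
    exact ⟨fun h0 => (((h X hX).supp x hx e he).2 h0).ne_zero, hu hX hx he⟩
  · exact fun X x e f hX hx he hne hf =>
      hB.piv_row X x e f (h X hX).frame hx he (hu' hX hx he hne) hf
  · exact fun X x e y f hX hx he hne hy hyx hf =>
      hB.piv X x e y f (h X hX).frame hx he (hu' hX hx he hne) hy hyx hf

end Complete

/-! ### Connectivity of a set under a relation. -/

section Conn

variable {α : Type*} {r : α → α → Prop} {W C : Set α}

/-- The set `W` cannot be split into two nonempty parts that are not joined by the relation. -/
def Conn (r : α → α → Prop) (W : Set α) : Prop :=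
  ∀ K ⊆ W, (∀ e ∈ K, ∀ f ∈ W, f ∉ K → ¬ r e f) → K = ∅ ∨ K = W

theorem conn_empty : Conn r ∅ := fun _ hK _ => Or.inl (Set.subset_empty_iff.1 hK)

theorem conn_singleton (w : α) : Conn r {w} := fun _ hK _ => Set.subset_singleton_iff_eq.1 hK

theorem Conn.insert (hr : ∀ e f, r e f → r f e) (hC : Conn r C) {z c : α} (hc : c ∈ C)
    (hzc : r z c) : Conn r (insert z C) := by
  intro K hK hsep
  rcases hC (K ∩ C) Set.inter_subset_right (fun e he f hf hfK =>
    hsep e he.1 f (Or.inr hf) fun h => hfK ⟨h, hf⟩) with h | h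
  · left
    have hzK : z ∉ K := fun hz =>
      hsep z hz c (Or.inr hc) (fun h' => by
        have : c ∈ K ∩ C := ⟨h', hc⟩
        rw [h] at this; exact this) hzc
    ext e
    refine ⟨fun he => ?_, fun he => he.elim⟩
    rcases hK he with rfl | h'
    · exact hzK he
    · have : e ∈ K ∩ C := ⟨he, h'⟩
      rwa [h] at this
  · right
    have hCK : C ⊆ K := fun e he => by rw [← h] at he; exact he.1
    have hzK : z ∈ K := by
      by_contra hz
      exact hsep c (hCK hc) z (Or.inl rfl) hz (hr _ _ hzc)
    refine Set.Subset.antisymm hK ?_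
    rintro e (rfl | he)
    · exact hzK
    · exact hCK he

theorem Conn.exists_adj (hr : ∀ e f, r e f → r f e) (hW : Conn r W) (hC : C ⊆ W)
    (hne : C.Nonempty) (h : C ≠ W) : ∃ z ∈ W, z ∉ C ∧ ∃ c ∈ C, r z c := by
  by_contra hcon
  push Not at hcon
  rcases hW C hC (fun e he f hf hfC hef => hcon f hf hfC e he (hr _ _ hef)) with h' | h'
  · exact hne.ne_empty h'
  · exact h h'

/-- A maximal connected proper subset misses exactly one element: adding a neighbour keeps it
connected, so by maximality the result is everything. -/
theorem Conn.exists_remove (hr : ∀ e f, r e f → r f e) (hfin : W.Finite) (hne : W.Nonempty)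
    (hW : Conn r W) : ∃ z ∈ W, Conn r (W \ {z}) := by
  have hF : {C : Set α | C ⊆ W ∧ C ≠ W ∧ Conn r C}.Finite :=
    hfin.finite_subsets.subset fun C hC => hC.1
  obtain ⟨C, hC⟩ := hF.exists_maximal ⟨∅, Set.empty_subset _, hne.ne_empty.symm, conn_empty⟩
  obtain ⟨⟨hCW, hCne, hCc⟩, hmax⟩ := hC
  have key : ∀ z ∈ W, z ∉ C → Conn r (Insert.insert z C) → ∃ z ∈ W, Conn r (W \ {z}) := by
    intro z hz hzC hc
    have : Insert.insert z C = W := by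
      by_contra h
      exact hzC (hmax ⟨Set.insert_subset hz hCW, h, hc⟩ (Set.subset_insert _ _) (Or.inl rfl))
    refine ⟨z, hz, ?_⟩
    rwa [← this, Set.insert_sdiff_of_mem _ (Set.mem_singleton z), Set.sdiff_singleton_eq_self hzC]
  rcases C.eq_empty_or_nonempty with rfl | hCn
  · obtain ⟨w, hw⟩ := hne
    exact key w hw (fun h => h) (by simpa using conn_singleton w)
  · obtain ⟨z, hz, hzC, c, hc, hzc⟩ := hW.exists_adj hr hCW hCn hCne
    exact key z hz hzC (hCc.insert hr hc hzc)

end Conn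

/-! ### Paths in the bipartite graph of a base. -/

section Path

variable {α R S : Type*} [CommRing R] [CommRing S] [Nontrivial R] [Nontrivial S]
  {M : Matroid α} {G : Subgroup Rˣ} {H : Subgroup Sˣ} {lam : R → S}
  {A : Set α → α → α → R} {B B₁ B₂ : Set α → α → α → S} {Fr : Set α → Prop}
  {X W E : Set α} {a b x y e f : α} {n : ℕ}

theorem IsFrameSystem.piv_eq (hB : IsFrameSystem E Fr B) (hX : Fr X) (hx : x ∈ X)
    (he : e ∈ E \ X) (hu : IsUnit (B X x e)) (hy : y ∈ X) (hyx : y ≠ x) (hf : f ∈ E)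
    (h0 : B X y e = 0 ∨ B X x f = 0) : B (swap X x e) y f = B X y f := by
  have h := hB.piv X x e y f hX hx he hu hy hyx hf
  have : B X y e * B X x f = 0 := by rcases h0 with h0 | h0 <;> simp [h0]
  rw [this, sub_zero] at h
  exact hu.mul_right_cancel h

theorem IsTableau.piv_eq (hA : IsTableau M G A) (hX : M.IsBase X) (hx : x ∈ X)
    (he : e ∈ M.E \ X) (hne : A X x e ≠ 0) (hy : y ∈ X) (hyx : y ≠ x) (hf : f ∈ M.E)
    (h0 : A X y e = 0 ∨ A X x f = 0) : A (swap X x e) y f = A X y f :=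
  hA.frameSystem.piv_eq hX hx he (hA.unit hX hx he hne).isUnit hy hyx hf h0

/-- Two elements are adjacent if the corresponding coordinate is not zero. -/
def Adj (A : Set α → α → α → R) (X : Set α) (e f : α) : Prop :=
  (e ∈ X ∧ f ∉ X ∧ A X e f ≠ 0) ∨ (f ∈ X ∧ e ∉ X ∧ A X f e ≠ 0)

theorem Adj.symm (h : Adj A X e f) : Adj A X f e := Or.symm h

theorem adj_dual (hX : X ⊆ M.E) (he : e ∈ M.E) (hf : f ∈ M.E) :
    Adj (dualTableau M.E A) (M.E \ X) e f ↔ Adj A X e f := by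
  have key : ∀ e f, e ∈ M.E → f ∈ M.E →
      ((e ∈ M.E \ X ∧ f ∉ M.E \ X ∧ dualTableau M.E A (M.E \ X) e f ≠ 0) ↔
      (f ∈ X ∧ e ∉ X ∧ A X f e ≠ 0)) := by
    intro e f he hf
    constructor
    · rintro ⟨h1, h2, h3⟩
      have hfX : f ∈ X := by by_contra h; exact h2 ⟨hf, h⟩
      rw [dualTableau_compl hX hfX, neg_ne_zero] at h3
      exact ⟨hfX, h1.2, h3⟩
    · rintro ⟨h1, h2, h3⟩
      refine ⟨⟨he, h2⟩, fun h => h.2 h1, ?_⟩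
      rwa [dualTableau_compl hX h1, neg_ne_zero]
  rw [Adj, key e f he hf, key f e hf he, or_comm]
  rfl

theorem conn_dual (hX : X ⊆ M.E) (hW : W ⊆ M.E) :
    Conn (Adj (dualTableau M.E A) (M.E \ X)) W ↔ Conn (Adj A X) W := by
  constructor <;> intro h K hK hs <;> refine h K hK fun e he f hf hfK => ?_
  · rw [adj_dual hX (hW (hK he)) (hW hf)]; exact hs e he f hf hfK
  · rw [← adj_dual hX (hW (hK he)) (hW hf)]; exact hs e he f hf hfK

/-- There is a path of `n` double steps in `W` between the elements `a` and `b` of `X`. -/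
def RowPath (W : Set α) (A : Set α → α → α → R) (X : Set α) : ℕ → α → α → Prop
  | 0, a, b => a = b
  | n + 1, a, b => ∃ y x, y ∈ W \ X ∧ x ∈ X ∩ W ∧ A X a y ≠ 0 ∧ A X x y ≠ 0 ∧
      RowPath W A X n x b

theorem RowPath.snoc {c : α} (h : RowPath W A X n a b) (hy : y ∈ W \ X) (hc : c ∈ X ∩ W)
    (h1 : A X b y ≠ 0) (h2 : A X c y ≠ 0) : RowPath W A X (n + 1) a c := by
  induction n generalizing a with
  | zero =>
    cases h
    exact ⟨y, c, hy, hc, h1, h2, rfl⟩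
  | succ n ih =>
    obtain ⟨y', x', hy', hx', h1', h2', h3⟩ := h
    exact ⟨y', x', hy', hx', h1', h2', ih h3⟩

/-- The elements of `W` reachable from `a` are not adjacent to the others, so they exhaust `W`. -/
theorem Conn.exists_rowPath (h : Conn (Adj A X) W) (ha : a ∈ X ∩ W) (hb : b ∈ X ∩ W) :
    ∃ n, RowPath W A X n a b := by
  have := h {e | e ∈ W ∧ ((e ∈ X ∧ ∃ n, RowPath W A X n a e) ∨
    (e ∉ X ∧ ∃ x ∈ X ∩ W, ∃ n, RowPath W A X n a x ∧ A X x e ≠ 0))} (fun e he => he.1) (by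
      rintro e ⟨heW, he⟩ f hf hfK hef
      apply hfK
      refine ⟨hf, ?_⟩
      rcases hef with ⟨h1, h2, h3⟩ | ⟨h1, h2, h3⟩
      · rcases he with ⟨-, n, hn⟩ | ⟨h', -⟩
        · exact Or.inr ⟨h2, e, ⟨h1, heW⟩, n, hn, h3⟩
        · exact absurd h1 h'
      · rcases he with ⟨h', -⟩ | ⟨-, x, hx, n, hn, hxe⟩
        · exact absurd h' h2
        · exact Or.inl ⟨h1, n + 1, hn.snoc ⟨heW, h2⟩ ⟨h1, hf⟩ hxe h3⟩)
  rcases this with h0 | h0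
  · have : a ∈ (∅ : Set α) := by
      rw [← h0]; exact ⟨ha.2, Or.inl ⟨ha.1, 0, rfl⟩⟩
    exact this.elim
  · have hbW := hb.2
    rw [← h0] at hbW
    rcases hbW.2 with ⟨-, h1⟩ | ⟨h1, -⟩
    · exact h1
    · exact absurd hb.1 h1

/-- As `x` is too far from `b`, it does not occur on the path and its row vanishes in the columns of
the path. A pivot in this row therefore changes no entry used by the path. -/
theorem RowPath.pivot (hA : IsTableau M G A) (hX : M.IsBase X) (hW : W ⊆ M.E) (hx : x ∈ X)
    (hy : y ∈ W \ X) (hne : A X x y ≠ 0) (ha : a ∈ X) (hax : a ≠ x)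
    (hmin : ∀ k ≤ n, ¬ RowPath W A X k x b) (h : RowPath W A X n a b) :
    RowPath W A (swap X x y) n a b := by
  induction n generalizing a with
  | zero => exact h
  | succ n ih =>
    obtain ⟨y', x', hy', hx', h1, h2, h3⟩ := h
    have h0 : A X x y' = 0 := by
      by_contra h0
      exact hmin (n + 1) le_rfl ⟨y', x', hy', hx', h0, h2, h3⟩
    have hx'x : x' ≠ x := by
      rintro rfl
      exact hmin n (Nat.le_succ n) h3
    have hyE : y ∈ M.E \ X := ⟨hW hy.1, hy.2⟩
    refine ⟨y', x', ⟨hy'.1, ?_⟩, ⟨Or.inr ⟨hx'.1, hx'x⟩, hx'.2⟩, ?_, ?_,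
      ih hx'.1 hx'x (fun k hk => hmin k (hk.trans (Nat.le_succ n))) h3⟩
    · rintro (rfl | h')
      · exact hne h0
      · exact hy'.2 h'.1
    · rwa [hA.piv_eq hX hx hyE hne ha hax (hW hy'.1) (Or.inr h0)]
    · rwa [hA.piv_eq hX hx hyE hne hx'.1 hx'x (hW hy'.1) (Or.inr h0)]

/-- A shortest path becomes shorter by pivoting on its second edge. -/
theorem RowPath.shorten (hA : IsTableau M G A) (hX : M.IsBase X) (hW : W ⊆ M.E) (ha : a ∈ X)
    (h : RowPath W A X (n + 2) a b) (hmin : ∀ k < n + 2, ¬ RowPath W A X k a b) :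
    ∃ x ∈ X ∩ W, ∃ y ∈ W \ X, A X x y ≠ 0 ∧ A X a y = 0 ∧ a ≠ x ∧ b ≠ x ∧
      RowPath W A X 1 a x ∧ RowPath W A X (n + 1) x b ∧ (0 < n → b ∈ X → b ∈ W → A X b y = 0) ∧
      RowPath W A (swap X x y) (n + 1) a b := by
  obtain ⟨y₁, x₁, hy₁, hx₁, h1, h2, y₂, x₂, hy₂, hx₂, h3, h4, h5⟩ := h
  have hy₂E : y₂ ∈ M.E \ X := ⟨hW hy₂.1, hy₂.2⟩
  have hax : a ≠ x₁ := by
    rintro rfl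
    exact hmin (n + 1) (by omega) ⟨y₂, x₂, hy₂, hx₂, h3, h4, h5⟩
  have hbx : b ≠ x₁ := by
    rintro rfl
    exact hmin 1 (by omega) ⟨y₁, b, hy₁, hx₁, h1, h2, rfl⟩
  have hay : A X a y₂ = 0 := by
    by_contra h0
    exact hmin (n + 1) (by omega) ⟨y₂, x₂, hy₂, hx₂, h0, h4, h5⟩
  have hxy : A X x₂ y₁ = 0 := by
    by_contra h0
    exact hmin (n + 1) (by omega) ⟨y₁, x₂, hy₁, hx₂, h1, h0, h5⟩
  have hx21 : x₂ ≠ x₁ := by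
    rintro rfl
    exact h2 hxy
  have hy12 : y₁ ≠ y₂ := by
    rintro rfl
    exact h1 hay
  have hm : ∀ k ≤ n, ¬ RowPath W A X k x₁ b := fun k hk hp =>
    hmin (k + 1) (by omega) ⟨y₁, x₁, hy₁, hx₁, h1, h2, hp⟩
  -- The pivot is on `(x₁, y₂)`. Row `a` vanishes at `y₂` and is unchanged, while the entry at `(x₂,
  -- y₁)` changes from zero to nonzero, so that `a, y₁, x₂` replaces `a, y₁, x₁, y₂, x₂`.
  refine ⟨x₁, hx₁, y₂, hy₂, h3, hay, hax, hbx, ⟨y₁, x₁, hy₁, hx₁, h1, h2, rfl⟩,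
    ⟨y₂, x₂, hy₂, hx₂, h3, h4, h5⟩, ?_, y₁, x₂, ⟨hy₁.1, ?_⟩, ⟨Or.inr ⟨hx₂.1, hx21⟩, hx₂.2⟩, ?_, ?_,
    h5.pivot hA hX hW hx₁.1 hy₂ h3 hx₂.1 hx21 hm⟩
  · intro hn hb hbW
    by_contra h0
    exact hm 1 (by omega) ⟨y₂, b, hy₂, ⟨hb, hbW⟩, h3, h0, rfl⟩
  · rintro (rfl | h')
    · exact hy12 rfl
    · exact hy₁.2 h'.1
  · rwa [hA.piv_eq hX hx₁.1 hy₂E h3 ha hax (hW hy₁.1) (Or.inl hay)]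
  · intro h0
    have := hA.piv X x₁ y₂ x₂ y₁ hX hx₁.1 hy₂E h3 hx₂.1 hx21 (hW hy₁.1)
    rw [h0, hxy, zero_mul, zero_sub, eq_comm, neg_eq_zero] at this
    exact h4 (((hA.unit hX hx₁.1 ⟨hW hy₁.1, hy₁.2⟩ h2).isUnit.mul_left_eq_zero).1 this)

/-- Two systems of coordinates agree on `W` at the base `X`. -/
def Agree (B₁ B₂ : Set α → α → α → S) (W X : Set α) : Prop :=
  ∀ x ∈ X, x ∈ W → ∀ e ∈ W, B₁ X x e = B₂ X x e

theorem Agree.of_notMem {E₁ E₂ : Set α} {Fr₁ Fr₂ : Set α → Prop} (h₁ : IsFrameSystem E₁ Fr₁ B₁)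
    (h₂ : IsFrameSystem E₂ Fr₂ B₂) (hX₁ : Fr₁ X) (hX₂ : Fr₂ X)
    (h : ∀ x ∈ X, x ∈ W → ∀ e ∈ W, e ∉ X → B₁ X x e = B₂ X x e) : Agree B₁ B₂ W X := by
  intro x hx hxW e he
  by_cases heX : e ∈ X
  · by_cases hex : e = x
    · subst hex; rw [h₁.self X e hX₁ hx, h₂.self X e hX₂ hx]
    · rw [h₁.off X x e hX₁ hx heX hex, h₂.off X x e hX₂ hx heX hex]
  · exact h x hx hxW e he heX

theorem Agree.pivot {E₁ E₂ : Set α} {Fr₁ Fr₂ : Set α → Prop} (h₁ : IsFrameSystem E₁ Fr₁ B₁)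
    (h₂ : IsFrameSystem E₂ Fr₂ B₂) (hX₁ : Fr₁ X) (hX₂ : Fr₂ X) (hW₁ : W ⊆ E₁) (hW₂ : W ⊆ E₂)
    (hxX : x ∈ X) (hxW : x ∈ W) (heX : e ∉ X) (heW : e ∈ W) (hu : IsUnit (B₁ X x e))
    (h : Agree B₁ B₂ W X) : Agree B₁ B₂ W (swap X x e) := by
  have hxe := h x hxX hxW e heW
  have hu' : IsUnit (B₂ X x e) := by rwa [← hxe]
  rintro y (rfl | hy) hyW f hf
  · apply hu.mul_right_cancel
    have e1 := h₁.piv_row X x y f hX₁ hxX ⟨hW₁ heW, heX⟩ hu (hW₁ hf)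
    have e2 := h₂.piv_row X x y f hX₂ hxX ⟨hW₂ heW, heX⟩ hu' (hW₂ hf)
    rw [← hxe] at e2
    rw [e1, e2, h x hxX hxW f hf]
  · apply hu.mul_right_cancel
    have e1 := h₁.piv X x e y f hX₁ hxX ⟨hW₁ heW, heX⟩ hu hy.1 hy.2 (hW₁ hf)
    have e2 := h₂.piv X x e y f hX₂ hxX ⟨hW₂ heW, heX⟩ hu' hy.1 hy.2 (hW₂ hf)
    rw [← hxe] at e2
    rw [e1, e2, h x hxX hxW f hf, h y hy.1 hyW f hf, h y hy.1 hyW e heW, hxe]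

variable (hl : IsLiftMap G H lam) (hA : IsTableau M G A) (h₁ : IsLift M H lam A B₁)
  (h₂ : IsLift M H lam A B₂)
include hl hA h₁ h₂

/-- For a path of one double step, the cross ratio with its middle column fixes the ratio. A longer
shortest path is split at its first inner row `x` if that row is nonzero in column `z`. Otherwise
the pivot of `RowPath.shorten` leaves column `z` unchanged in the remaining rows and yields a
shorter path. -/
theorem ratio_eq_of_rowPath (hW : W ⊆ M.E) {z : α} (hz : z ∈ M.E) (hzW : z ∉ W) :
    ∀ (n : ℕ) (X : Set α) (a b : α), M.IsBase X → z ∉ X → Agree B₁ B₂ W X → a ∈ X ∩ W →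
      b ∈ X ∩ W → RowPath W A X n a b → A X a z ≠ 0 → A X b z ≠ 0 →
      B₁ X a z * B₂ X b z = B₂ X a z * B₁ X b z := by
  intro n
  induction n using Nat.strong_induction_on with
  | _ n ih =>
  intro X a b hX hzX hag ha hb hp haz hbz
  by_cases hmin : ∃ k < n, RowPath W A X k a b
  · obtain ⟨k, hk, hpk⟩ := hmin
    exact ih k hk X a b hX hzX hag ha hb hpk haz hbz
  push Not at hmin
  have hzE : z ∈ M.E \ X := ⟨hz, hzX⟩
  match n, ih, hp, hmin with
  | 0, _, hp, _ =>
    cases hp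
    exact mul_comm _ _
  | 1, _, hp, _ =>
    obtain ⟨y, x, hy, hx, h1, h2, hp⟩ := hp
    cases hp
    have hq : Quad M A X a b y z :=
      ⟨hX, ha.1, hx.1, ⟨hW hy.1, hy.2⟩, hzE, h1, haz, h2, hbz⟩
    obtain ⟨p, hp, -⟩ := hq.exists_ratio hA
    have g1 := h₁.good _ _ _ _ _ hq p hp
    have g2 := h₂.good _ _ _ _ _ hq p hp
    rw [← hag a ha.1 ha.2 y hy.1, ← hag b hx.1 hx.2 y hy.1] at g2
    have u := (h₁.match_entry hA hX ha.1 ⟨hW hy.1, hy.2⟩).2 h1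
    apply u.cancel
    linear_combination B₁ X a z * g2 - B₂ X a z * g1
  | n + 2, ih, hp, hmin =>
    obtain ⟨x, hx, y, hy, hxy, hay, hax, hbx, p1, p2, -, p3⟩ := hp.shorten hA hX hW ha.1 hmin
    have hyE : y ∈ M.E \ X := ⟨hW hy.1, hy.2⟩
    by_cases hxz : A X x z = 0
    · have hX' : M.IsBase (swap X x y) := (hA.base_iff X x y hX hx.1 hyE).2 hxy
      have u₁ := (h₁.match_entry hA hX hx.1 hyE).2 hxy
      have u₂ := (h₂.match_entry hA hX hx.1 hyE).2 hxy
      have k₁ := (h₁.match_entry hA hX hx.1 hzE).1 hxz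
      have k₂ := (h₂.match_entry hA hX hx.1 hzE).1 hxz
      have e : ∀ c ∈ X, c ≠ x → A (swap X x y) c z = A X c z ∧
          B₁ (swap X x y) c z = B₁ X c z ∧ B₂ (swap X x y) c z = B₂ X c z := fun c hc hcx =>
        ⟨hA.piv_eq hX hx.1 hyE hxy hc hcx hz (Or.inr hxz),
          h₁.tab.frameSystem.piv_eq hX hx.1 hyE u₁.isUnit hc hcx hz (Or.inr k₁),
          h₂.tab.frameSystem.piv_eq hX hx.1 hyE u₂.isUnit hc hcx hz (Or.inr k₂)⟩
      have := ih (n + 1) (by omega) (swap X x y) a b hX' (by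
          rintro (rfl | h')
          · exact hzW hy.1
          · exact hzX h'.1)
        (hag.pivot h₁.tab.frameSystem h₂.tab.frameSystem hX hX hW hW hx.1 hx.2 hy.2 hy.1 u₁.isUnit)
        ⟨Or.inr ⟨ha.1, hax⟩, ha.2⟩ ⟨Or.inr ⟨hb.1, hbx⟩, hb.2⟩ p3
        (by rwa [(e a ha.1 hax).1]) (by rwa [(e b hb.1 hbx).1])
      rwa [(e a ha.1 hax).2.1, (e a ha.1 hax).2.2, (e b hb.1 hbx).2.1, (e b hb.1 hbx).2.2] at this
    · have g1 := ih 1 (by omega) X a x hX hzX hag ha hx p1 haz hxz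
      have g2 := ih (n + 1) (by omega) X x b hX hzX hag hx hb p2 hxz hbz
      have u₁ := (h₁.match_entry hA hX hx.1 hzE).2 hxz
      have u₂ := (h₂.match_entry hA hX hx.1 hzE).2 hxz
      apply (u₁.mul u₂).cancel
      linear_combination (B₁ X x z * B₂ X b z) * g1 + (B₂ X a z * B₁ X x z) * g2

end Path

/-! ### Uniqueness of lifts up to scaling. -/

section Uniqueness

variable {α R S : Type*} [CommRing R] [CommRing S] [Nontrivial R] [Nontrivial S]
  {M : Matroid α} {G : Subgroup Rˣ} {H : Subgroup Sˣ} {lam : R → S}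
  {A : Set α → α → α → R} {B B₁ B₂ : Set α → α → α → S} {X W : Set α}

/-- At the base `X`, and on the set `W`, the coordinates `B₂` are obtained from `B₁` by scaling. -/
def ScaleEq (H : Subgroup Sˣ) (B₁ B₂ : Set α → α → α → S) (X W : Set α) : Prop :=
  ∃ k : α → Sˣ, (∀ e, k e ∈ H) ∧
    ∀ x ∈ X, x ∈ W → ∀ e ∈ W, e ∉ X → scaleTableau k B₁ X x e = B₂ X x e

/-- Any two rows in which column `z` is nonzero are joined by a path in the rest, so the two
versions of this column are proportional; the factor is absorbed in the scalar of `z`. -/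
theorem ScaleEq.add_column (hl : IsLiftMap G H lam) (hA : IsTableau M G A)
    (h₁ : IsLift M H lam A B₁) (h₂ : IsLift M H lam A B₂) (hX : M.IsBase X) (hW : W ⊆ M.E)
    {z : α} (hz : z ∈ W) (hzX : z ∉ X) (hc : Conn (Adj A X) (W \ {z}))
    (h : ScaleEq H B₁ B₂ X (W \ {z})) : ScaleEq H B₁ B₂ X W := by
  classical
  obtain ⟨k, hk, hkeq⟩ := h
  have hzE : z ∈ M.E \ X := ⟨hW hz, hzX⟩
  by_cases hnb : ∃ a ∈ X, a ∈ W ∧ A X a z ≠ 0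
  · obtain ⟨a, ha, haW, haz⟩ := hnb
    have h₃ := h₁.scale hk
    have hag : Agree (scaleTableau k B₁) B₂ (W \ {z}) X :=
      Agree.of_notMem h₃.tab.frameSystem h₂.tab.frameSystem hX hX hkeq
    have hne : ∀ {b}, b ∈ X → b ≠ z := fun hb h => hzX (h ▸ hb)
    obtain ⟨t, ⟨u, hu, rfl⟩, ht⟩ := ((h₂.match_entry hA hX ha hzE).2 haz).exists_div
      ((h₃.match_entry hA hX ha hzE).2 haz)
    have hcol : ∀ x ∈ X, x ∈ W → B₂ X x z = u * scaleTableau k B₁ X x z := by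
      intro x hx hxW
      by_cases hxz : A X x z = 0
      · rw [(h₂.match_entry hA hX hx hzE).1 hxz, (h₃.match_entry hA hX hx hzE).1 hxz, mul_zero]
      · have haW' : a ∈ X ∩ (W \ {z}) := ⟨ha, haW, hne ha⟩
        have hxW' : x ∈ X ∩ (W \ {z}) := ⟨hx, hxW, hne hx⟩
        obtain ⟨n, hn⟩ := hc.exists_rowPath haW' hxW'
        have := ratio_eq_of_rowPath hl hA h₃ h₂ (Set.sdiff_subset.trans hW) hzE.1
          (fun h => h.2 (Set.mem_singleton z)) n X a x hX hzX hag haW' hxW' hn haz hxz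
        apply ((h₃.match_entry hA hX ha hzE).2 haz).cancel
        rw [this, ht]
        ring
    refine ⟨fun e => if e = z then k e * u else k e, fun e => ?_, ?_⟩
    · dsimp only
      split_ifs
      · exact mul_mem (hk e) hu
      · exact hk e
    · intro x hx hxW e he heX
      by_cases hez : e = z
      · subst hez
        rw [hcol x hx hxW]
        simp only [scaleTableau, if_neg (hne hx), if_true, Units.val_mul]
        ring
      · rw [← hkeq x hx ⟨hxW, hne hx⟩ e ⟨he, hez⟩ heX]
        simp only [scaleTableau, if_neg (hne hx), if_neg hez]
  · push Not at hnb
    refine ⟨k, hk, fun x hx hxW e he heX => ?_⟩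
    have hxz : x ≠ z := fun h => hzX (h ▸ hx)
    by_cases hez : e = z
    · subst hez
      have h0 := hnb x hx hxW
      rw [(h₂.match_entry hA hX hx hzE).1 h0, scaleTableau,
        (h₁.match_entry hA hX hx hzE).1 h0, mul_zero]
    · exact hkeq x hx ⟨hxW, hxz⟩ e ⟨he, hez⟩ heX

/-- Transposition interchanges row and column factors, so the scalars are inverted. -/
theorem ScaleEq.of_dual {E : Set α} (hX : X ⊆ E) (hW : W ⊆ E)
    (h : ScaleEq H (dualTableau E B₁) (dualTableau E B₂) (E \ X) W) : ScaleEq H B₁ B₂ X W := by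
  obtain ⟨k, hk, h⟩ := h
  refine ⟨fun e => (k e)⁻¹, fun e => inv_mem (hk e), fun x hx hxW e he heX => ?_⟩
  have hxE : x ∉ E \ X := fun h => h.2 hx
  have := h e ⟨hW he, heX⟩ he x hxW hxE
  simp only [scaleTableau, dualTableau_of_notMem hxE, Set.sdiff_sdiff_cancel_left hX] at this
  simp only [scaleTableau, inv_inv]
  linear_combination -this

/-- Lifts are unique up to scaling. -/
theorem scaleEq_of_isLift (hl : IsLiftMap G H lam) : ∀ (n : ℕ) (M : Matroid α)
    (A : Set α → α → α → R) (B₁ B₂ : Set α → α → α → S) (X W : Set α), IsTableau M G A →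
    IsLift M H lam A B₁ → IsLift M H lam A B₂ → M.IsBase X → W ⊆ M.E → W.Finite →
    W.ncard = n → ScaleEq H B₁ B₂ X W := by
  classical
  intro n
  induction n using Nat.strong_induction_on with
  | _ n ih =>
  intro M A B₁ B₂ X W hA h₁ h₂ hX hW hfin hn
  rcases W.eq_empty_or_nonempty with rfl | hne
  · exact ⟨fun _ => 1, fun _ => one_mem _, fun x hx hxW => hxW.elim⟩
  by_cases hc : Conn (Adj A X) W
  · obtain ⟨z, hz, hcz⟩ := hc.exists_remove (fun _ _ h => h.symm) hfin hne
    have hsub : W \ {z} ⊆ M.E := Set.sdiff_subset.trans hW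
    have hlt : (W \ {z}).ncard < n := by
      rw [← hn]; exact Set.ncard_sdiff_singleton_lt_of_mem hz hfin
    by_cases hzX : z ∈ X
    · have hXE := hX.subset_ground
      apply ScaleEq.of_dual hXE hW
      refine ScaleEq.add_column hl (hA.dual hl.neg_mem) (h₁.dual hl) (h₂.dual hl)
        hX.compl_isBase_dual (by simpa using hW) hz (fun h => h.2 hzX) ?_ ?_
      · exact (conn_dual hXE hsub).2 hcz
      · exact ih _ hlt M✶ _ _ _ _ _ (hA.dual hl.neg_mem) (h₁.dual hl) (h₂.dual hl)
          hX.compl_isBase_dual hsub (hfin.subset Set.sdiff_subset) rfl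
    · exact ScaleEq.add_column hl hA h₁ h₂ hX hW hz hzX hcz
        (ih _ hlt M A B₁ B₂ X _ hA h₁ h₂ hX hsub (hfin.subset Set.sdiff_subset) rfl)
  -- The entries between two separated parts vanish, so the parts are scaled independently.
  · rw [Conn] at hc
    push Not at hc
    obtain ⟨K, hKW, hsep, hK0, hK1⟩ := hc
    have hlt1 : K.ncard < n := by
      rw [← hn]; exact Set.ncard_lt_ncard (hKW.ssubset_of_ne hK1) hfin
    have hlt2 : (W \ K).ncard < n := by
      rw [← hn]
      refine Set.ncard_lt_ncard (Set.sdiff_subset.ssubset_of_ne fun h => ?_) hfin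
      obtain ⟨e, he⟩ := hK0
      have := hKW he
      rw [← h] at this
      exact this.2 he
    obtain ⟨k₁, hk₁, e₁⟩ := ih _ hlt1 M A B₁ B₂ X K hA h₁ h₂ hX (hKW.trans hW) (hfin.subset hKW) rfl
    obtain ⟨k₂, hk₂, e₂⟩ := ih _ hlt2 M A B₁ B₂ X (W \ K) hA h₁ h₂ hX
      (Set.sdiff_subset.trans hW) (hfin.subset Set.sdiff_subset) rfl
    refine ⟨fun e => if e ∈ K then k₁ e else k₂ e, fun e => ?_, ?_⟩
    · dsimp only
      split_ifs
      · exact hk₁ e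
      · exact hk₂ e
    · intro x hx hxW e he heX
      by_cases hxK : x ∈ K
      · by_cases heK : e ∈ K
        · rw [← e₁ x hx hxK e heK heX]
          simp only [scaleTableau, if_pos hxK, if_pos heK]
        · have h0 : A X x e = 0 := by
            by_contra h0
            exact hsep x hxK e he heK (Or.inl ⟨hx, heX, h0⟩)
          rw [(h₂.match_entry hA hX hx ⟨hW he, heX⟩).1 h0, scaleTableau,
            (h₁.match_entry hA hX hx ⟨hW he, heX⟩).1 h0, mul_zero]
      · by_cases heK : e ∈ K
        · have h0 : A X x e = 0 := by
            by_contra h0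
            exact hsep e heK x hxW hxK (Or.inr ⟨hx, heX, h0⟩)
          rw [(h₂.match_entry hA hX hx ⟨hW he, heX⟩).1 h0, scaleTableau,
            (h₁.match_entry hA hX hx ⟨hW he, heX⟩).1 h0, mul_zero]
        · rw [← e₂ x hx ⟨hxW, hxK⟩ e ⟨he, heK⟩ heX]
          simp only [scaleTableau, if_neg hxK, if_neg heK]

end Uniqueness

/-! ### Cross ratios of two glued columns. -/

section TwoColumns

variable {α R S : Type*} [CommRing R] [CommRing S] [Nontrivial R] [Nontrivial S]
  {M : Matroid α} {G : Subgroup Rˣ} {H : Subgroup Sˣ} {lam : R → S}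
  {A : Set α → α → α → R} {B : Set α → α → α → S} {Fr : Set α → Prop} {X W : Set α}
  {u v a b c d x y z e f : α}

/-- The coordinates `B` lift those of `A` as long as the element `u` is avoided. -/
structure GoodOff (M : Matroid α) (H : Subgroup Sˣ) (lam : R → S) (A : Set α → α → α → R)
    (Fr : Set α → Prop) (B : Set α → α → α → S) (u : α) : Prop where
  frame : ∀ X, M.IsBase X → u ∉ X → Fr X
  entry : ∀ X x e, M.IsBase X → u ∉ X → x ∈ X → e ∈ M.E \ X → e ≠ u → Match H A B X x e
  good : ∀ X a b c d, Quad M A X a b c d → u ∉ X → c ≠ u → d ≠ u → Good lam A B X a b c d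

theorem Good.of_eq {X' : Set α} (hac : A X' a c = A X a c) (had : A X' a d = A X a d)
    (hbc : A X' b c = A X b c) (hbd : A X' b d = A X b d) (hac' : B X' a c = B X a c)
    (had' : B X' a d = B X a d) (hbc' : B X' b c = B X b c) (hbd' : B X' b d = B X b d)
    (h : Good lam A B X' a b c d) : Good lam A B X a b c d := by
  rw [Good, hac, had, hbc, hbd, hac', had', hbc', hbd'] at h
  exact h

theorem notMem_swap (he : e ∉ X) (hne : e ≠ f) : e ∉ swap X x f := by
  rintro (rfl | h)
  · exact hne rfl
  · exact he h.1

variable (hl : IsLiftMap G H lam) (hA : IsTableau M G A) (hB : IsFrameSystem M.E Fr B)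
  (hu : GoodOff M H lam A Fr B u) (hv : GoodOff M H lam A Fr B v) (huv : u ≠ v)

include huv hu hv in
theorem supp_of_goodOff (hX : M.IsBase X) (huX : u ∉ X) (hvX : v ∉ X) : Supp M H A B X := by
  intro x hx e he
  by_cases heu : e = u
  · exact hv.entry X x e hX hvX hx he (heu ▸ huv)
  · exact hu.entry X x e hX huX hx he heu

include hl hA hu hv huv

/-- The cross ratio of the columns `u`, `v` is the product of those of `u`, `y` and of `y`, `v`,
each of which avoids `v` or `u`. -/
theorem good_of_common (huX : u ∉ X) (hvX : v ∉ X) (hq : Quad M A X a b u v)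
    (hy : y ∈ M.E \ X) (hyu : y ≠ u) (hyv : y ≠ v) (hay : A X a y ≠ 0) (hby : A X b y ≠ 0) :
    Good lam A B X a b u v := by
  have hs := supp_of_goodOff hu hv huv hq.base huX hvX
  have q1 : Quad M A X a b u y :=
    ⟨hq.base, hq.ha, hq.hb, hq.hc, hy, hq.ac, hay, hq.bc, hby⟩
  have q2 : Quad M A X a b y v :=
    ⟨hq.base, hq.ha, hq.hb, hy, hq.hd, hay, hq.ad, hby, hq.bd⟩
  exact Good.trans_col hl hA q1 q2 ((hs a hq.ha y hy).2 hay) ((hs b hq.hb y hy).2 hby)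
    (hv.good X a b u y q1 hvX huv hyv) (hu.good X a b y v q2 huX hyu huv.symm)

include hB

/-- After a pivot on `(x, y₁)` the column `y₂` is nonzero in both rows, so `good_of_common` applies.
Of the four entries in question only that at `(a, v)` can change: it is multiplied by `1 - t`, where
`t` is a cross ratio avoiding `u` (`t` is not needed if `A X x v = 0`). The hypothesis `hne` says
that the new entry is not zero. -/
theorem good_of_path_two_of_ne {y₁ y₂ : α} (huX : u ∉ X) (hvX : v ∉ X) (hq : Quad M A X a b u v)
    (hx : x ∈ X) (hax : a ≠ x) (hbx : b ≠ x)
    (hy₁ : y₁ ∈ M.E \ X) (hyu₁ : y₁ ≠ u) (hyv₁ : y₁ ≠ v)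
    (hy₂ : y₂ ∈ M.E \ X) (hyu₂ : y₂ ≠ u) (hyv₂ : y₂ ≠ v)
    (h1 : A X a y₁ ≠ 0) (h2 : A X x y₁ ≠ 0) (h3 : A X x y₂ ≠ 0) (h4 : A X b y₂ ≠ 0)
    (h5 : A X a y₂ = 0) (h6 : A X b y₁ = 0) (hxu : A X x u = 0)
    (hne : A X a v * A X x y₁ - A X a y₁ * A X x v ≠ 0) :
    Good lam A B X a b u v := by
  have hX := hq.base
  have hs := supp_of_goodOff hu hv huv hX huX hvX
  have hF := hu.frame X hX huX
  have hX' : M.IsBase (swap X x y₁) := (hA.base_iff X x y₁ hX hx hy₁).2 h2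
  have uA := hA.unit hX hx hy₁ h2
  have uB := (hs x hx y₁ hy₁).2 h2
  have hy21 : y₂ ≠ y₁ := by rintro rfl; exact h1 h5
  have huX' : u ∉ swap X x y₁ := notMem_swap huX hyu₁.symm
  have hvX' : v ∉ swap X x y₁ := notMem_swap hvX hyv₁.symm
  have hyX' : y₂ ∈ M.E \ swap X x y₁ := ⟨hy₂.1, notMem_swap hy₂.2 hy21⟩
  have hxu' := (hs x hx u hq.hc).1 hxu
  have eau := hA.piv_eq hX hx hy₁ h2 hq.ha hax hq.hc.1 (Or.inr hxu)
  have ebu := hA.piv_eq hX hx hy₁ h2 hq.hb hbx hq.hc.1 (Or.inr hxu)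
  have ebv := hA.piv_eq hX hx hy₁ h2 hq.hb hbx hq.hd.1 (Or.inl h6)
  have eby := hA.piv_eq hX hx hy₁ h2 hq.hb hbx hy₂.1 (Or.inl h6)
  have eay := hA.piv X x y₁ a y₂ hX hx hy₁ h2 hq.ha hax hy₂.1
  rw [h5, zero_mul, zero_sub] at eay
  have h6' := (hs b hq.hb y₁ hy₁).1 h6
  have fau := hB.piv_eq hF hx hy₁ uB.isUnit hq.ha hax hq.hc.1 (Or.inr hxu')
  have fbu := hB.piv_eq hF hx hy₁ uB.isUnit hq.hb hbx hq.hc.1 (Or.inr hxu')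
  have fbv := hB.piv_eq hF hx hy₁ uB.isUnit hq.hb hbx hq.hd.1 (Or.inl h6')
  have eav := hA.piv X x y₁ a v hX hx hy₁ h2 hq.ha hax hq.hd.1
  have fav := hB.piv X x y₁ a v hF hx hy₁ uB.isUnit hq.ha hax hq.hd.1
  have hay' : A (swap X x y₁) a y₂ ≠ 0 := by
    intro h0
    rw [h0, zero_mul, eq_comm, neg_eq_zero] at eay
    exact h3 ((hA.unit hX hq.ha hy₁ h1).isUnit.mul_right_eq_zero.1 eay)
  have hav' : A (swap X x y₁) a v ≠ 0 := by
    intro h0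
    rw [h0, zero_mul] at eav
    exact hne eav.symm
  have hq' : Quad M A (swap X x y₁) a b u v :=
    ⟨hX', Or.inr ⟨hq.ha, hax⟩, Or.inr ⟨hq.hb, hbx⟩, ⟨hq.hc.1, huX'⟩, ⟨hq.hd.1, hvX'⟩,
      by rw [eau]; exact hq.ac, hav', by rw [ebu]; exact hq.bc, by rw [ebv]; exact hq.bd⟩
  have g := good_of_common hl hA hu hv huv huX' hvX' hq' hyX' hyu₂ hyv₂ hay' (by rwa [eby])
  intro p hp
  have hpF := hq.fund hA hp
  obtain ⟨p₁, hp₁, hp₁F⟩ := hq'.exists_ratio hA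
  have g1 := g p₁ hp₁
  rw [eau, ebv, ebu] at hp₁
  rw [fau, fbv, fbu] at g1
  by_cases hxv : A X x v = 0
  · rw [hxv, mul_zero, sub_zero] at eav
    rw [(hs x hx v hq.hd).1 hxv, mul_zero, sub_zero] at fav
    rw [uA.isUnit.mul_right_cancel eav] at hp₁
    rw [uB.isUnit.mul_right_cancel fav] at g1
    have : p = p₁ := by
      apply ((hA.unit hX hq.ha hq.hd hq.ad).mul (hA.unit hX hq.hb hq.hc hq.bc)).cancel
      linear_combination hp₁ - hp
    rw [this, g1]
  · have hqt : Quad M A X a x y₁ v := ⟨hX, hq.ha, hx, hy₁, hq.hd, h1, hq.ad, h2, hxv⟩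
    obtain ⟨t, ht, htF⟩ := hqt.exists_ratio hA
    have g2 := hu.good _ _ _ _ _ hqt huX hyu₁ huv.symm t ht
    have e1 : A (swap X x y₁) a v = (1 - t) * A X a v := by
      apply uA.isUnit.mul_right_cancel
      linear_combination eav - ht
    have f1 : B (swap X x y₁) a v = (1 - lam t) * B X a v := by
      apply uB.isUnit.mul_right_cancel
      linear_combination fav - g2
    have ht1 : t ≠ 1 := by
      rintro rfl
      rw [sub_self, zero_mul] at e1
      exact hav' e1
    have : p = p₁ * (1 - t) := by
      apply ((hA.unit hX hq.ha hq.hd hq.ad).mul (hA.unit hX hq.hb hq.hc hq.bc)).cancel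
      rw [e1] at hp₁
      linear_combination hp₁ - hp
    rw [hl.mul hpF hp₁F (htF.sub ht1) this, hl.sub t htF ht1, g1, f1]
    ring

/-- The remaining case is that column `v` is proportional to `y₁` in the rows `a`, `x` and to `y₂`
in the rows `b`, `x`. After the pivot on `(x, y₁)`, the cross ratio of the columns `y₂`, `u` avoids
`v` and equals `-p⁻¹`. -/
theorem good_of_path_two {y₁ y₂ : α} (huX : u ∉ X) (hvX : v ∉ X) (hq : Quad M A X a b u v)
    (hx : x ∈ X) (hax : a ≠ x) (hbx : b ≠ x)
    (hy₁ : y₁ ∈ M.E \ X) (hyu₁ : y₁ ≠ u) (hyv₁ : y₁ ≠ v)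
    (hy₂ : y₂ ∈ M.E \ X) (hyu₂ : y₂ ≠ u) (hyv₂ : y₂ ≠ v)
    (h1 : A X a y₁ ≠ 0) (h2 : A X x y₁ ≠ 0) (h3 : A X x y₂ ≠ 0) (h4 : A X b y₂ ≠ 0)
    (h5 : A X a y₂ = 0) (h6 : A X b y₁ = 0) (hxu : A X x u = 0) :
    Good lam A B X a b u v := by
  have hX := hq.base
  by_cases hne : A X a v * A X x y₁ - A X a y₁ * A X x v = 0
  swap
  · exact good_of_path_two_of_ne hl hA hB hu hv huv huX hvX hq hx hax hbx hy₁ hyu₁ hyv₁ hy₂ hyu₂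
      hyv₂ h1 h2 h3 h4 h5 h6 hxu hne
  by_cases hne' : A X b v * A X x y₂ - A X b y₂ * A X x v = 0
  swap
  · exact Good.swap_row hl hA hq.swap_row (good_of_path_two_of_ne hl hA hB hu hv huv huX hvX
      hq.swap_row hx hbx hax hy₂ hyu₂ hyv₂ hy₁ hyu₁ hyv₁ h4 h3 h2 h1 h6 h5 hxu hne')
  have hs := supp_of_goodOff hu hv huv hX huX hvX
  have hF := hu.frame X hX huX
  have hX' : M.IsBase (swap X x y₁) := (hA.base_iff X x y₁ hX hx hy₁).2 h2
  have uA := hA.unit hX hx hy₁ h2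
  have uB := (hs x hx y₁ hy₁).2 h2
  have hy21 : y₂ ≠ y₁ := by rintro rfl; exact h1 h5
  have huX' : u ∉ swap X x y₁ := notMem_swap huX hyu₁.symm
  have hvX' : v ∉ swap X x y₁ := notMem_swap hvX hyv₁.symm
  have hyX' : y₂ ∈ M.E \ swap X x y₁ := ⟨hy₂.1, notMem_swap hy₂.2 hy21⟩
  have hxu' := (hs x hx u hq.hc).1 hxu
  have h6' := (hs b hq.hb y₁ hy₁).1 h6
  have h5' := (hs a hq.ha y₂ hy₂).1 h5
  have eau := hA.piv_eq hX hx hy₁ h2 hq.ha hax hq.hc.1 (Or.inr hxu)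
  have ebu := hA.piv_eq hX hx hy₁ h2 hq.hb hbx hq.hc.1 (Or.inr hxu)
  have eby := hA.piv_eq hX hx hy₁ h2 hq.hb hbx hy₂.1 (Or.inl h6)
  have eay := hA.piv X x y₁ a y₂ hX hx hy₁ h2 hq.ha hax hy₂.1
  have fau := hB.piv_eq hF hx hy₁ uB.isUnit hq.ha hax hq.hc.1 (Or.inr hxu')
  have fbu := hB.piv_eq hF hx hy₁ uB.isUnit hq.hb hbx hq.hc.1 (Or.inr hxu')
  have fby := hB.piv_eq hF hx hy₁ uB.isUnit hq.hb hbx hy₂.1 (Or.inl h6')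
  have fay := hB.piv X x y₁ a y₂ hF hx hy₁ uB.isUnit hq.ha hax hy₂.1
  rw [h5, zero_mul, zero_sub] at eay
  rw [h5', zero_mul, zero_sub] at fay
  have hay' : A (swap X x y₁) a y₂ ≠ 0 := by
    intro h0
    rw [h0, zero_mul, eq_comm, neg_eq_zero] at eay
    exact h3 ((hA.unit hX hq.ha hy₁ h1).isUnit.mul_right_eq_zero.1 eay)
  have hxv : A X x v ≠ 0 := by
    intro h0
    rw [h0, mul_zero, sub_zero] at hne
    exact h2 ((hA.unit hX hq.ha hq.hd hq.ad).isUnit.mul_right_eq_zero.1 hne)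
  have hq' : Quad M A (swap X x y₁) a b y₂ u :=
    ⟨hX', Or.inr ⟨hq.ha, hax⟩, Or.inr ⟨hq.hb, hbx⟩, hyX', ⟨hq.hc.1, huX'⟩, hay',
      by rw [eau]; exact hq.ac, by rwa [eby], by rw [ebu]; exact hq.bc⟩
  obtain ⟨q, eq, hqF⟩ := hq'.exists_ratio hA
  have g := hv.good _ _ _ _ _ hq' hvX' hyv₂ huv q eq
  rw [eau, ebu, eby] at eq
  rw [fau, fbu, fby] at g
  have hq1 : Quad M A X a x y₁ v := ⟨hX, hq.ha, hx, hy₁, hq.hd, h1, hq.ad, h2, hxv⟩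
  have hq2 : Quad M A X b x y₂ v := ⟨hX, hq.hb, hx, hy₂, hq.hd, h4, hq.bd, h3, hxv⟩
  have g1 := hu.good _ _ _ _ _ hq1 huX hyu₁ huv.symm 1 (by linear_combination -hne)
  have g2 := hu.good _ _ _ _ _ hq2 huX hyu₂ huv.symm 1 (by linear_combination -hne')
  rw [hl.one, one_mul] at g1 g2
  intro p hp
  have hpF := hq.fund hA hp
  obtain ⟨s, -, hs1⟩ := hpF.1.exists_inv
  have hsF := hpF.inv hl.neg_mem hs1
  have hls := hl.inv hpF hs1
  have uxv := hA.unit hX hx hq.hd hxv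
  have uav := hA.unit hX hq.ha hq.hd hq.ad
  have ubu := hA.unit hX hq.hb hq.hc hq.bc
  have uxy₂ := hA.unit hX hx hy₂ h3
  have E1 : q * (A X a u * A X b v) = -(A X a v * A X b u) := by
    apply (uxy₂.mul uA).cancel
    linear_combination (q * A X a u * A X x y₁) * hne' -
      (A X x v * A X x y₁) * eq + A X b u * A X x v * eay - A X b u * A X x y₂ * -hne
  have hqs : q = -s := by
    have e2 : q * p = -1 := by
      apply (uav.mul ubu).cancel
      linear_combination E1 - q * hp
    linear_combination s * e2 - q * hs1
  subst hqs
  -- The only place where the relation for `-1` enters.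
  rw [hl.neg hsF hqF] at g
  have vxv := (hs x hx v hq.hd).2 hxv
  have vxy₂ := (hs x hx y₂ hy₂).2 h3
  have E2 : -lam s * (B X a u * B X b v) = -(B X a v * B X b u) := by
    apply (vxy₂.mul uB).cancel
    linear_combination (lam s * B X a u * B X x y₁) * g2 -
      (B X x v * B X x y₁) * g + B X b u * B X x v * fay - B X b u * B X x y₂ * g1
  linear_combination -lam p * E2 - B X a u * B X b v * hls

/-- The cross ratio of the columns `u` and `v` and of two rows that are connected by a path that
avoids these columns is the lift of the original cross ratio. -/
theorem good_of_rowPath (hW : W ⊆ M.E) (huW : u ∉ W) (hvW : v ∉ W) :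
    ∀ (n : ℕ) (X : Set α) (a b : α), u ∉ X → v ∉ X → Quad M A X a b u v → a ∈ W → b ∈ W →
      RowPath W A X n a b → Good lam A B X a b u v := by
  intro n
  induction n using Nat.strong_induction_on with
  | _ n ih =>
  intro X a b huX hvX hq haW hbW hp
  by_cases hmin : ∃ k < n, RowPath W A X k a b
  · obtain ⟨k, hk, hpk⟩ := hmin
    exact ih k hk X a b huX hvX hq haW hbW hpk
  push Not at hmin
  have hX := hq.base
  have hs := supp_of_goodOff hu hv huv hX huX hvX
  have hF := hu.frame X hX huX
  have hWu : ∀ {y}, y ∈ W → y ≠ u := fun hy h => huW (h ▸ hy)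
  have hWv : ∀ {y}, y ∈ W → y ≠ v := fun hy h => hvW (h ▸ hy)
  match n, ih, hp, hmin with
  | 0, _, hp, _ =>
    cases hp
    exact good_same_row hl hA hq
  | 1, _, hp, _ =>
    obtain ⟨y, x, hy, hx, h1, h2, hp⟩ := hp
    cases hp
    exact good_of_common hl hA hu hv huv huX hvX hq ⟨hW hy.1, hy.2⟩ (hWu hy.1) (hWv hy.1) h1 h2
  | 2, ih, hp, hmin =>
    obtain ⟨y₁, x, hy₁, hx, h1, h2, y₂, x', hy₂, hx', h3, h4, hp⟩ := hp
    cases hp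
    have hy₁E : y₁ ∈ M.E \ X := ⟨hW hy₁.1, hy₁.2⟩
    have hy₂E : y₂ ∈ M.E \ X := ⟨hW hy₂.1, hy₂.2⟩
    have h5 : A X a y₂ = 0 := by
      by_contra h0
      exact hmin 1 (by omega) ⟨y₂, b, hy₂, hx', h0, h4, rfl⟩
    have h6 : A X b y₁ = 0 := by
      by_contra h0
      exact hmin 1 (by omega) ⟨y₁, b, hy₁, hx', h1, h0, rfl⟩
    have hax : a ≠ x := by rintro rfl; exact h3 h5
    have hbx : b ≠ x := by rintro rfl; exact h2 h6
    -- If the middle row is nonzero in both columns, the cross ratio factors through it. Otherwise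
    -- `good_of_path_two` applies, possibly with `u` and `v` exchanged.
    by_cases hxu : A X x u = 0
    · exact good_of_path_two hl hA hB hu hv huv huX hvX hq hx.1 hax hbx hy₁E (hWu hy₁.1)
        (hWv hy₁.1) hy₂E (hWu hy₂.1) (hWv hy₂.1) h1 h2 h3 h4 h5 h6 hxu
    by_cases hxv : A X x v = 0
    · exact Good.swap_col hl hA hq.swap_col (good_of_path_two hl hA hB hv hu huv.symm hvX huX
        hq.swap_col hx.1 hax hbx hy₁E (hWv hy₁.1)
        (hWu hy₁.1) hy₂E (hWv hy₂.1) (hWu hy₂.1) h1 h2 h3 h4 h5 h6 hxv)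
    have q1 : Quad M A X a x u v := ⟨hX, hq.ha, hx.1, hq.hc, hq.hd, hq.ac, hq.ad, hxu, hxv⟩
    have q2 : Quad M A X x b u v := ⟨hX, hx.1, hq.hb, hq.hc, hq.hd, hxu, hxv, hq.bc, hq.bd⟩
    exact Good.trans_row hl hA q1 q2 ((hs x hx.1 u hq.hc).2 hxu) ((hs x hx.1 v hq.hd).2 hxv)
      (ih 1 (by omega) X a x huX hvX q1 haW hx.2 ⟨y₁, x, hy₁, hx, h1, h2, rfl⟩)
      (ih 1 (by omega) X x b huX hvX q2 hx.2 hbW ⟨y₂, b, hy₂, hx', h3, h4, rfl⟩)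
  -- For a longer path the pivot column vanishes in both end rows, so the cross ratio is unchanged
  -- by the shortening pivot.
  | n + 3, ih, hp, hmin =>
    obtain ⟨x, hx, y, hy, hxy, hay, hax, hbx, -, -, hby, p3⟩ :=
      RowPath.shorten (n := n + 1) hA hX hW hq.ha hp hmin
    have hby := hby (by omega) hq.hb hbW
    have hyE : y ∈ M.E \ X := ⟨hW hy.1, hy.2⟩
    have uB := (hs x hx.1 y hyE).2 hxy
    have hay' := (hs a hq.ha y hyE).1 hay
    have hby' := (hs b hq.hb y hyE).1 hby
    have hX' : M.IsBase (swap X x y) := (hA.base_iff X x y hX hx.1 hyE).2 hxy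
    have huX' : u ∉ swap X x y := notMem_swap huX (hWu hy.1).symm
    have hvX' : v ∉ swap X x y := notMem_swap hvX (hWv hy.1).symm
    have e1 : ∀ f ∈ M.E, A (swap X x y) a f = A X a f := fun f hf =>
      hA.piv_eq hX hx.1 hyE hxy hq.ha hax hf (Or.inl hay)
    have e2 : ∀ f ∈ M.E, A (swap X x y) b f = A X b f := fun f hf =>
      hA.piv_eq hX hx.1 hyE hxy hq.hb hbx hf (Or.inl hby)
    have f1 : ∀ f ∈ M.E, B (swap X x y) a f = B X a f := fun f hf =>
      hB.piv_eq hF hx.1 hyE uB.isUnit hq.ha hax hf (Or.inl hay')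
    have f2 : ∀ f ∈ M.E, B (swap X x y) b f = B X b f := fun f hf =>
      hB.piv_eq hF hx.1 hyE uB.isUnit hq.hb hbx hf (Or.inl hby')
    have hq' : Quad M A (swap X x y) a b u v := by
      refine ⟨hX', Or.inr ⟨hq.ha, hax⟩, Or.inr ⟨hq.hb, hbx⟩, ⟨hq.hc.1, huX'⟩, ⟨hq.hd.1, hvX'⟩,
        ?_, ?_, ?_, ?_⟩
      · rw [e1 u hq.hc.1]; exact hq.ac
      · rw [e1 v hq.hd.1]; exact hq.ad
      · rw [e2 u hq.hc.1]; exact hq.bc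
      · rw [e2 v hq.hd.1]; exact hq.bd
    exact Good.of_eq (e1 u hq.hc.1) (e1 v hq.hd.1) (e2 u hq.hc.1) (e2 v hq.hd.1) (f1 u hq.hc.1)
      (f1 v hq.hd.1) (f2 u hq.hc.1) (f2 v hq.hd.1)
      (ih (n + 2) (by omega) _ a b huX' hvX' hq' haW hbW p3)

end TwoColumns

/-! ### Extension to the bases that contain the glued elements. -/

section Closure

variable {α R S : Type*} [CommRing R] [CommRing S] [Nontrivial R] [Nontrivial S]
  {M : Matroid α} {G : Subgroup Rˣ} {H : Subgroup Sˣ} {lam : R → S}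
  {A : Set α → α → α → R} {B : Set α → α → α → S} {Fr : Set α → Prop} {X W : Set α}
  {u v a b c d x y z e f : α}

variable (hl : IsLiftMap G H lam) (hA : IsTableau M G A) (hB : IsFrameSystem M.E Fr B)
include hl hA hB

/-- This is `LocGood.pivot` for the reverse exchange. -/
theorem frame_supp_of_swap (hX : M.IsBase X) (hx : x ∈ X) (he : e ∈ M.E \ X) (hne : A X x e ≠ 0)
    (h : LocGood M H lam A Fr B (swap X x e)) : Fr X ∧ Supp M H A B X := by
  have hX' : M.IsBase (swap X x e) := (hA.base_iff X x e hX hx he).2 hne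
  have hxe : x ≠ e := fun h => he.2 (h ▸ hx)
  have hxX' : x ∈ M.E \ swap X x e := ⟨hX.subset_ground hx, by
    rintro (rfl | h')
    · exact hxe rfl
    · exact h'.2 rfl⟩
  have hss := swap_swap hx he.2
  have hne' : A (swap X x e) e x ≠ 0 := by
    rw [← hA.base_iff _ e x hX' (Or.inl rfl) hxX', hss]
    exact hX
  have := h.pivot hl hA hB hX' (Or.inl rfl) hxX' hne'
  rwa [hss] at this

theorem good_of_swap_unchanged (hF : Fr X) (hs : Supp M H A B X) (hq : Quad M A X a b c d)
    (hu : u ∈ X) (hau : a ≠ u) (hbu : b ≠ u) (hz : z ∈ M.E \ X) (huz : A X u z ≠ 0)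
    (hcz : c ≠ z) (hdz : d ≠ z) (h1 : A X a z = 0 ∨ A X u c = 0) (h2 : A X a z = 0 ∨ A X u d = 0)
    (h3 : A X b z = 0 ∨ A X u c = 0) (h4 : A X b z = 0 ∨ A X u d = 0)
    (h : LocGood M H lam A Fr B (swap X u z)) : Good lam A B X a b c d := by
  have hX := hq.base
  have hX' : M.IsBase (swap X u z) := (hA.base_iff X u z hX hu hz).2 huz
  have uB := (hs u hu z hz).2 huz
  have key : ∀ x ∈ X, x ≠ u → ∀ f ∈ M.E \ X, (A X x z = 0 ∨ A X u f = 0) →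
      A (swap X u z) x f = A X x f ∧ B (swap X u z) x f = B X x f := by
    intro x hx hxu f hf h0
    exact ⟨hA.piv_eq hX hu hz huz hx hxu hf.1 h0,
      hB.piv_eq hF hu hz uB.isUnit hx hxu hf.1 (h0.imp (hs x hx z hz).1 (hs u hu f hf).1)⟩
  have k1 := key a hq.ha hau c hq.hc h1
  have k2 := key a hq.ha hau d hq.hd h2
  have k3 := key b hq.hb hbu c hq.hc h3
  have k4 := key b hq.hb hbu d hq.hd h4
  refine Good.of_eq k1.1 k2.1 k3.1 k4.1 k1.2 k2.2 k3.2 k4.2 (h.good a b c d ?_)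
  exact ⟨hX', Or.inr ⟨hq.ha, hau⟩, Or.inr ⟨hq.hb, hbu⟩, ⟨hq.hc.1, notMem_swap hq.hc.2 hcz⟩,
    ⟨hq.hd.1, notMem_swap hq.hd.2 hdz⟩, by rw [k1.1]; exact hq.ac, by rw [k2.1]; exact hq.ad,
    by rw [k3.1]; exact hq.bc, by rw [k4.1]; exact hq.bd⟩

/-- The pivot on `(u, d)` leaves column `c` alone in the rows `a`, `b` and replaces column `d` by
column `u`, which is the old column `d` up to a common factor. -/
theorem good_of_swap_col (hF : Fr X) (hs : Supp M H A B X) (hq : Quad M A X a b c d)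
    (hu : u ∈ X) (hau : a ≠ u) (hbu : b ≠ u) (huc : A X u c = 0) (hud : A X u d ≠ 0)
    (h : LocGood M H lam A Fr B (swap X u d)) : Good lam A B X a b c d := by
  have hX := hq.base
  have hX' : M.IsBase (swap X u d) := (hA.base_iff X u d hX hu hq.hd).2 hud
  have uA := hA.unit hX hu hq.hd hud
  have uB := (hs u hu d hq.hd).2 hud
  have huc' := (hs u hu c hq.hc).1 huc
  have huE := hX.subset_ground hu
  have key : ∀ x ∈ X, x ≠ u → A (swap X u d) x c = A X x c ∧ B (swap X u d) x c = B X x c ∧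
      A (swap X u d) x u * A X u d = -A X x d ∧ B (swap X u d) x u * B X u d = -B X x d := by
    intro x hx hxu
    refine ⟨hA.piv_eq hX hu hq.hd hud hx hxu hq.hc.1 (Or.inr huc),
      hB.piv_eq hF hu hq.hd uB.isUnit hx hxu hq.hc.1 (Or.inr huc'), ?_, ?_⟩
    · rw [hA.piv X u d x u hX hu hq.hd hud hx hxu huE, hA.self X u hX hu,
        hA.off X x u hX hx hu hxu.symm]
      ring
    · rw [hB.piv X u d x u hF hu hq.hd uB.isUnit hx hxu huE, hB.self X u hF hu,
        hB.off X x u hF hx hu hxu.symm]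
      ring
  obtain ⟨k1, k2, k3, k4⟩ := key a hq.ha hau
  obtain ⟨l1, l2, l3, l4⟩ := key b hq.hb hbu
  have hcd : c ≠ d := by rintro rfl; exact hud huc
  have hudne : u ≠ d := fun h => hq.hd.2 (h ▸ hu)
  have hq' : Quad M A (swap X u d) a b c u := by
    refine ⟨hX', Or.inr ⟨hq.ha, hau⟩, Or.inr ⟨hq.hb, hbu⟩, ⟨hq.hc.1, notMem_swap hq.hc.2 hcd⟩,
      ⟨huE, ?_⟩, by rw [k1]; exact hq.ac, ?_, by rw [l1]; exact hq.bc, ?_⟩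
    · rintro (rfl | h')
      · exact hudne rfl
      · exact h'.2 rfl
    · intro h0
      rw [h0, zero_mul, eq_comm, neg_eq_zero] at k3
      exact hq.ad k3
    · intro h0
      rw [h0, zero_mul, eq_comm, neg_eq_zero] at l3
      exact hq.bd l3
  have g := h.good _ _ _ _ hq'
  intro p hp
  have := g p (by
    rw [k1, l1]
    apply uA.isUnit.mul_right_cancel
    linear_combination A X a c * l3 - p * A X b c * k3 - hp)
  rw [k2, l2] at this
  linear_combination (-B X u d) * this + B X a c * l4 - lam p * B X b c * k4

/-- If all bases avoiding `u` are good, then so are those that contain `u`. -/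
theorem locGood_of_avoid (hall : ∀ X, M.IsBase X → u ∉ X → LocGood M H lam A Fr B X)
    (hX : M.IsBase X) (hu : u ∈ X) (hz : z ∈ M.E \ X) (huz : A X u z ≠ 0) :
    LocGood M H lam A Fr B X := by
  have hL : ∀ f ∈ M.E \ X, A X u f ≠ 0 → LocGood M H lam A Fr B (swap X u f) := by
    intro f hf h
    refine hall _ ((hA.base_iff X u f hX hu hf).2 h) ?_
    rintro (rfl | h')
    · exact hf.2 hu
    · exact h'.2 rfl
  obtain ⟨hF, hs⟩ := frame_supp_of_swap hl hA hB hX hu hz huz (hL z hz huz)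
  -- A cross ratio in row `u` is read off after a pivot in that row, which leads to a base avoiding
  -- `u`.
  have hrow : ∀ b c d, Quad M A X u b c d → Good lam A B X u b c d := fun b c d hq =>
    LocGood.of_pivot hl hA hB hF hq ((hs u hu c hq.hc).2 hq.ac) (hL c hq.hc hq.ac)
  refine ⟨hF, hs, fun a b c d hq => ?_⟩
  by_cases hau : a = u
  · subst hau; exact hrow b c d hq
  by_cases hbu : b = u
  · subst hbu; exact (hrow a c d hq.swap_row).swap_row hl hA hq.swap_row
  by_cases hc : A X u c = 0
  · by_cases hd : A X u d = 0
    · exact good_of_swap_unchanged hl hA hB hF hs hq hu hau hbu hz huz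
        (by rintro rfl; exact huz hc) (by rintro rfl; exact huz hd) (Or.inr hc) (Or.inr hd)
        (Or.inr hc) (Or.inr hd) (hL z hz huz)
    · exact good_of_swap_col hl hA hB hF hs hq hu hau hbu hc hd (hL d hq.hd hd)
  · by_cases hd : A X u d = 0
    · exact (good_of_swap_col hl hA hB hF hs hq.swap_col hu hau hbu hd hc
        (hL c hq.hc hc)).swap_col hl hA hq.swap_col
    · have q1 : Quad M A X a u c d := ⟨hX, hq.ha, hu, hq.hc, hq.hd, hq.ac, hq.ad, hc, hd⟩
      have q2 : Quad M A X u b c d := ⟨hX, hu, hq.hb, hq.hc, hq.hd, hc, hd, hq.bc, hq.bd⟩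
      exact Good.trans_row hl hA q1 q2 ((hs u hu c hq.hc).2 hc) ((hs u hu d hq.hd).2 hd)
        ((hrow a c d q1.swap_row).swap_row hl hA q1.swap_row) (hrow b c d q2)

variable (hv : GoodOff M H lam A Fr B v)
  (hall : ∀ X, M.IsBase X → u ∉ X → v ∉ X → LocGood M H lam A Fr B X)
include hv hall

/-- The pivot on `(u, z)` leads to a base avoiding `u` and `v`, preserves row `a` and the entry at
`(b, d)`, and multiplies the entry at `(b, v)` by `1 - t`, where `t` is a cross ratio involving row
`u`. If the new entry is nonzero, then `p = p₁ (1 - t)`. If it is zero, a preliminary pivot on `(a,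
d)`, which preserves row `u`, leads to a base where the rows `z`, `b` and the columns `v`, `u` have
cross ratio `p⁻¹`. -/
theorem good_column_of_ne (huX : u ∈ X) (hvX : v ∉ X) (hF : Fr X) (hs : Supp M H A B X)
    (hrow : ∀ b d, Quad M A X u b v d → Good lam A B X u b v d)
    (hq : Quad M A X a b v d) (hau : a ≠ u) (hbu : b ≠ u) (hdv : d ≠ v) (huv : A X u v ≠ 0)
    (hud : A X u d = 0) (hz : z ∈ M.E \ X) (hzv : z ≠ v) (huz : A X u z ≠ 0) (haz : A X a z = 0)
    (hbz : A X b z ≠ 0) : Good lam A B X a b v d := by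
  have hX := hq.base
  have hzu : z ≠ u := fun h => hz.2 (h ▸ huX)
  have hab : a ≠ b := by rintro rfl; exact hbz haz
  have hdz : d ≠ z := by rintro rfl; exact huz hud
  have uA := hA.unit hX huX hz huz
  have uB := (hs u huX z hz).2 huz
  have hX₁ : M.IsBase (swap X u z) := (hA.base_iff X u z hX huX hz).2 huz
  have hnu : ∀ Y : Set α, u ∉ swap Y u z := by
    rintro Y (h | h')
    · exact hzu h.symm
    · exact h'.2 rfl
  have hL := hall _ hX₁ (hnu X) (notMem_swap hvX hzv.symm)
  have haz' := (hs a hq.ha z hz).1 haz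
  have hud' := (hs u huX d hq.hd).1 hud
  have qt' : Quad M A X u b v z := ⟨hX, huX, hq.hb, hq.hc, hz, huv, huz, hq.bc, hbz⟩
  have qt : Quad M A X b u z v := qt'.swap_row.swap_col
  have gt : Good lam A B X b u z v :=
    ((hrow b z qt').swap_row hl hA qt').swap_col hl hA qt'.swap_row
  have ebv := hA.piv X u z b v hX huX hz huz hq.hb hbu hq.hc.1
  have fbv := hB.piv X u z b v hF huX hz uB.isUnit hq.hb hbu hq.hc.1
  have uad := hA.unit hX hq.ha hq.hd hq.ad
  have uav := hA.unit hX hq.ha hq.hc hq.ac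
  have ubv := hA.unit hX hq.hb hq.hc hq.bc
  have ubd := hA.unit hX hq.hb hq.hd hq.bd
  intro p hp
  have hpF := hq.fund hA hp
  by_cases h0 : A (swap X u z) b v = 0
  · have huE := hX.subset_ground huX
    have vad := (hs a hq.ha d hq.hd).2 hq.ad
    rw [h0, zero_mul] at ebv
    have g1 := gt 1 (by linear_combination ebv)
    rw [hl.one, one_mul] at g1
    have hX₂ : M.IsBase (swap X a d) := (hA.base_iff X a d hX hq.ha hq.hd).2 hq.ad
    have hF₂ := hB.frame X a d hF hq.ha hq.hd vad.isUnit
    have huX₂ : u ∈ swap X a d := Or.inr ⟨huX, hau.symm⟩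
    have hbX₂ : b ∈ swap X a d := Or.inr ⟨hq.hb, hab.symm⟩
    have hzX₂ : z ∈ M.E \ swap X a d := ⟨hz.1, notMem_swap hz.2 hdz.symm⟩
    have hvX₂ : v ∉ swap X a d := notMem_swap hvX hdv.symm
    have eu : ∀ f ∈ M.E, A (swap X a d) u f = A X u f := fun f hf =>
      hA.piv_eq hX hq.ha hq.hd hq.ad huX hau.symm hf (Or.inl hud)
    have fu : ∀ f ∈ M.E, B (swap X a d) u f = B X u f := fun f hf =>
      hB.piv_eq hF hq.ha hq.hd vad.isUnit huX hau.symm hf (Or.inl hud')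
    have ebz := hA.piv_eq hX hq.ha hq.hd hq.ad hq.hb hab.symm hz.1 (Or.inr haz)
    have fbz := hB.piv_eq hF hq.ha hq.hd vad.isUnit hq.hb hab.symm hz.1 (Or.inr haz')
    have ebv₂ := hA.piv X a d b v hX hq.ha hq.hd hq.ad hq.hb hab.symm hq.hc.1
    have fbv₂ := hB.piv X a d b v hF hq.ha hq.hd vad.isUnit hq.hb hab.symm hq.hc.1
    have huz₂ : A (swap X a d) u z ≠ 0 := by rwa [eu z hz.1]
    have vuz₂ : IsUnit (B (swap X a d) u z) := by rw [fu z hz.1]; exact uB.isUnit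
    have hX₃ : M.IsBase (swap (swap X a d) u z) := (hA.base_iff _ u z hX₂ huX₂ hzX₂).2 huz₂
    have hvX₃ := notMem_swap (x := u) hvX₂ hzv.symm
    have hL₃ := hall _ hX₃ (hnu _) hvX₃
    have e1 := hA.piv_row _ u z v hX₂ huX₂ hzX₂ huz₂ hq.hc.1
    have e2 := hA.piv_row _ u z u hX₂ huX₂ hzX₂ huz₂ huE
    have e3 := hA.piv _ u z b u hX₂ huX₂ hzX₂ huz₂ hbX₂ hbu huE
    have e4 := hA.piv _ u z b v hX₂ huX₂ hzX₂ huz₂ hbX₂ hbu hq.hc.1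
    have f1 := hB.piv_row _ u z v hF₂ huX₂ hzX₂ vuz₂ hq.hc.1
    have f2 := hB.piv_row _ u z u hF₂ huX₂ hzX₂ vuz₂ huE
    have f3 := hB.piv _ u z b u hF₂ huX₂ hzX₂ vuz₂ hbX₂ hbu huE
    have f4 := hB.piv _ u z b v hF₂ huX₂ hzX₂ vuz₂ hbX₂ hbu hq.hc.1
    rw [hA.off _ b u hX₂ hbX₂ huX₂ hbu.symm] at e3
    rw [hB.off _ b u hF₂ hbX₂ huX₂ hbu.symm] at f3
    rw [hA.self _ u hX₂ huX₂] at e2 e3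
    rw [hB.self _ u hF₂ huX₂] at f2 f3
    rw [eu z hz.1] at e1 e2 e3 e4
    rw [fu z hz.1] at f1 f2 f3 f4
    rw [eu v hq.hc.1] at e1 e4
    rw [fu v hq.hc.1] at f1 f4
    rw [ebz] at e3 e4
    rw [fbz] at f3 f4
    set X₃ := swap (swap X a d) u z with hX₃def
    have e5 : A X₃ b v * A X a d = -(A X b d * A X a v) := by
      apply uA.isUnit.mul_right_cancel
      linear_combination A X a d * e4 + A X u z * ebv₂ - A X a d * ebv
    have f5 : B X₃ b v * B X a d = -(B X b d * B X a v) := by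
      apply uB.isUnit.mul_right_cancel
      linear_combination B X a d * f4 + B X u z * fbv₂ - B X a d * g1
    have hq₃ : Quad M A X₃ z b v u := by
      refine ⟨hX₃, Or.inl rfl, Or.inr ⟨hbX₂, hbu⟩, ⟨hq.hc.1, hvX₃⟩, ⟨huE, hnu _⟩, ?_, ?_, ?_, ?_⟩
      · intro h; rw [h, zero_mul] at e1; exact huv e1.symm
      · intro h; rw [h, zero_mul] at e2; exact zero_ne_one e2
      · intro h
        rw [h, zero_mul, eq_comm, neg_eq_zero] at e5
        exact hq.ac (ubd.isUnit.mul_right_eq_zero.1 e5)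
      · intro h
        rw [h, zero_mul, zero_sub, mul_one, eq_comm, neg_eq_zero] at e3
        exact hbz e3
    obtain ⟨q, eq, hqF⟩ := hq₃.exists_ratio hA
    have g := hL₃.good _ _ _ _ hq₃ q eq
    have E1 : A X b v * A X a d = q * (A X b d * A X a v) := by
      apply uA.cancel
      linear_combination (-A X u z * A X u z * A X a d) * eq + A X u z * A X a d * A X₃ b u * e1
        + A X u v * A X a d * e3 - A X a d * ebv - q * A X u z * A X a d * A X₃ b v * e2
        - q * A X u z * e5
    have F1 : B X b v * B X a d = lam q * (B X b d * B X a v) := by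
      apply uB.cancel
      linear_combination (-B X u z * B X u z * B X a d) * g + B X u z * B X a d * B X₃ b u * f1
        + B X u v * B X a d * f3 - B X a d * g1 - lam q * B X u z * B X a d * B X₃ b v * f2
        - lam q * B X u z * f5
    have hpq : p * q = 1 := by
      apply (ubd.mul uav).cancel
      linear_combination -hp - p * E1
    have h2 := hl.inv hpF hpq
    linear_combination -lam p * F1 - B X a v * B X b d * h2
  · have eav := hA.piv_eq hX huX hz huz hq.ha hau hq.hc.1 (Or.inl haz)
    have ead := hA.piv_eq hX huX hz huz hq.ha hau hq.hd.1 (Or.inl haz)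
    have ebd := hA.piv_eq hX huX hz huz hq.hb hbu hq.hd.1 (Or.inr hud)
    have fav := hB.piv_eq hF huX hz uB.isUnit hq.ha hau hq.hc.1 (Or.inl haz')
    have fad := hB.piv_eq hF huX hz uB.isUnit hq.ha hau hq.hd.1 (Or.inl haz')
    have fbd := hB.piv_eq hF huX hz uB.isUnit hq.hb hbu hq.hd.1 (Or.inr hud')
    have hq₁ : Quad M A (swap X u z) a b v d :=
      ⟨hX₁, Or.inr ⟨hq.ha, hau⟩, Or.inr ⟨hq.hb, hbu⟩, ⟨hq.hc.1, notMem_swap hvX hzv.symm⟩,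
        ⟨hq.hd.1, notMem_swap hq.hd.2 hdz⟩, by rw [eav]; exact hq.ac, by rw [ead]; exact hq.ad,
        h0, by rw [ebd]; exact hq.bd⟩
    obtain ⟨p₁, hp₁, hp₁F⟩ := hq₁.exists_ratio hA
    have g := hL.good _ _ _ _ hq₁ p₁ hp₁
    obtain ⟨t, ht, htF⟩ := qt.exists_ratio hA
    have g2 := gt t ht
    have e1 : A (swap X u z) b v = (1 - t) * A X b v := by
      apply uA.isUnit.mul_right_cancel
      linear_combination ebv - ht
    have f1 : B (swap X u z) b v = (1 - lam t) * B X b v := by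
      apply uB.isUnit.mul_right_cancel
      linear_combination fbv - g2
    have ht1 : t ≠ 1 := by
      rintro rfl
      rw [sub_self, zero_mul] at e1
      exact h0 e1
    rw [eav, ead, ebd, e1] at hp₁
    rw [fav, fad, fbd, f1] at g
    have : p = p₁ * (1 - t) := by
      apply (uad.mul ubv).cancel
      linear_combination hp₁ - hp
    rw [hl.mul hpF hp₁F (htF.sub ht1) this, hl.sub t htF ht1]
    linear_combination g

/-- Only cross ratios in column `v` are not covered by `hv`. These are transferred to bases avoiding
both elements by pivoting in row `u` on columns other than `v`. -/
theorem locGood_of_mem (hX : M.IsBase X) (hu : u ∈ X) (hvX : v ∉ X) (hz : z ∈ M.E \ X)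
    (hzv : z ≠ v) (huz : A X u z ≠ 0) : LocGood M H lam A Fr B X := by
  have hL : ∀ f ∈ M.E \ X, f ≠ v → A X u f ≠ 0 → LocGood M H lam A Fr B (swap X u f) := by
    intro f hf hfv h
    refine hall _ ((hA.base_iff X u f hX hu hf).2 h) ?_ (notMem_swap hvX hfv.symm)
    rintro (rfl | h')
    · exact hf.2 hu
    · exact h'.2 rfl
  obtain ⟨hF, hs⟩ := frame_supp_of_swap hl hA hB hX hu hz huz (hL z hz hzv huz)
  have hrow : ∀ b d, Quad M A X u b v d → Good lam A B X u b v d := by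
    intro b d hq
    by_cases hdv : d = v
    · subst hdv; exact good_same_col hl hA hq
    · exact (LocGood.of_pivot hl hA hB hF hq.swap_col ((hs u hu d hq.hd).2 hq.ad)
        (hL d hq.hd hdv hq.ad)).swap_col hl hA hq.swap_col
  have hcol2 : ∀ a b d, a ≠ u → b ≠ u → Quad M A X a b v d → A X u v ≠ 0 → A X u d ≠ 0 →
      Good lam A B X a b v d := by
    intro a b d hau hbu hq hc hd
    have q1 : Quad M A X a u v d := ⟨hX, hq.ha, hu, hq.hc, hq.hd, hq.ac, hq.ad, hc, hd⟩
    have q2 : Quad M A X u b v d := ⟨hX, hu, hq.hb, hq.hc, hq.hd, hc, hd, hq.bc, hq.bd⟩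
    exact Good.trans_row hl hA q1 q2 ((hs u hu v hq.hc).2 hc) ((hs u hu d hq.hd).2 hd)
      ((hrow a d q1.swap_row).swap_row hl hA q1.swap_row) (hrow b d q2)
  have hcol : ∀ a b d, d ≠ v → Quad M A X a b v d → Good lam A B X a b v d := by
    intro a b d hdv hq
    by_cases hau : a = u
    · subst hau; exact hrow b d hq
    by_cases hbu : b = u
    · subst hbu; exact (hrow a d hq.swap_row).swap_row hl hA hq.swap_row
    by_cases hc : A X u v = 0
    · by_cases hd : A X u d = 0
      · exact good_of_swap_unchanged hl hA hB hF hs hq hu hau hbu hz huz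
          (by rintro rfl; exact huz hc) (by rintro rfl; exact huz hd) (Or.inr hc) (Or.inr hd)
          (Or.inr hc) (Or.inr hd) (hL z hz hzv huz)
      · exact good_of_swap_col hl hA hB hF hs hq hu hau hbu hc hd (hL d hq.hd hdv hd)
    · by_cases hd : A X u d = 0
      · have hdz : d ≠ z := by rintro rfl; exact huz hd
        by_cases haz : A X a z = 0
        · by_cases hbz : A X b z = 0
          · exact good_of_swap_unchanged hl hA hB hF hs hq hu hau hbu hz huz hzv.symm hdz
              (Or.inl haz) (Or.inl haz) (Or.inl hbz) (Or.inl hbz) (hL z hz hzv huz)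
          · exact good_column_of_ne hl hA hB hv hall hu hvX hF hs hrow hq hau hbu hdv hc hd hz
              hzv huz haz hbz
        · by_cases hbz : A X b z = 0
          · exact (good_column_of_ne hl hA hB hv hall hu hvX hF hs hrow hq.swap_row hbu hau hdv hc
              hd hz hzv huz hbz haz).swap_row hl hA hq.swap_row
          · have q1 : Quad M A X a b v z := ⟨hX, hq.ha, hq.hb, hq.hc, hz, hq.ac, haz, hq.bc, hbz⟩
            have q2 : Quad M A X a b z d := ⟨hX, hq.ha, hq.hb, hz, hq.hd, haz, hq.ad, hbz, hq.bd⟩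
            exact Good.trans_col hl hA q1 q2 ((hs a hq.ha z hz).2 haz) ((hs b hq.hb z hz).2 hbz)
              (hcol2 a b z hau hbu q1 hc huz) (hv.good _ _ _ _ _ q2 hvX hzv hdv)
      · exact hcol2 a b d hau hbu hq hc hd
  refine ⟨hF, hs, fun a b c d hq => ?_⟩
  by_cases hcv : c = v
  · by_cases hdv : d = v
    · subst hcv hdv; exact good_same_col hl hA hq
    · subst hcv; exact hcol a b d hdv hq
  · by_cases hdv : d = v
    · subst hdv; exact (hcol a b c hcv hq.swap_col).swap_col hl hA hq.swap_col
    · exact hv.good _ _ _ _ _ hq hvX hcv hdv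

omit hall in
/-- Coordinates that are good when `u` or `v` are avoided are good everywhere if the cross ratios
of these two columns are. -/
theorem isLift_of_goodOff (hu : GoodOff M H lam A Fr B u) (huv : u ≠ v) {X₀ : Set α}
    (hX₀ : M.IsBase X₀) (huX₀ : u ∉ X₀) (hvX₀ : v ∉ X₀)
    (h : ∀ X a b, u ∉ X → v ∉ X → Quad M A X a b u v → Good lam A B X a b u v) :
    IsLift M H lam A B := by
  have h00 : ∀ X, M.IsBase X → u ∉ X → v ∉ X → LocGood M H lam A Fr B X := by
    intro X hX huX hvX
    refine ⟨hu.frame X hX huX, supp_of_goodOff hu hv huv hX huX hvX, fun a b c d hq => ?_⟩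
    by_cases hcv : c = v
    · by_cases hdu : d = u
      · subst hcv hdu; exact (h X a b huX hvX hq.swap_col).swap_col hl hA hq.swap_col
      · exact hu.good _ _ _ _ _ hq huX (by rw [hcv]; exact huv.symm) hdu
    · by_cases hdv : d = v
      · by_cases hcu : c = u
        · subst hcu hdv; exact h X a b huX hvX hq
        · exact hu.good _ _ _ _ _ hq huX hcu (by rw [hdv]; exact huv.symm)
      · exact hv.good _ _ _ _ _ hq hvX hcv hdv
  -- Exchanging towards `X₀` supplies a pivot column that lies in `X₀` and so differs from `u` and
  -- `v`.
  have hz : ∀ X, M.IsBase X → ∀ w ∈ X, w ∉ X₀ → ∃ z ∈ M.E \ X, z ∈ X₀ ∧ A X w z ≠ 0 := by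
    intro X hX w hw hw₀
    obtain ⟨z, hz, hb⟩ := hX.exchange hX₀ ⟨hw, hw₀⟩
    have hzE : z ∈ M.E \ X := ⟨hX₀.subset_ground hz.1, hz.2⟩
    exact ⟨z, hzE, hz.1, (hA.base_iff X w z hX hw hzE).1 hb⟩
  have h10 : ∀ X, M.IsBase X → u ∉ X → LocGood M H lam A Fr B X := by
    intro X hX huX
    by_cases hvX : v ∈ X
    · obtain ⟨z, hz, hz₀, hvz⟩ := hz X hX v hvX hvX₀
      exact locGood_of_mem hl hA hB hu (fun X hX h1 h2 => h00 X hX h2 h1) hX hvX huX hz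
        (fun h => huX₀ (h ▸ hz₀)) hvz
    · exact h00 X hX huX hvX
  refine isLift_of_locGood hA hB fun X hX => ?_
  by_cases huX : u ∈ X
  · obtain ⟨z, hz, hz₀, huz⟩ := hz X hX u huX huX₀
    exact locGood_of_avoid hl hA hB h10 hX huX hz huz
  · exact h10 X hX huX

end Closure

/-! ### Two lemmas on connected graphs. -/

section Graph

variable {α : Type*} {r : α → α → Prop} {E : Set α}

theorem union_triple_sdiff {C : Set α} {a b c : α} (hab : a ≠ b) (hac : a ≠ c) (hb : b ∉ C)
    (hc : c ∉ C) : (C ∪ {a, b, c}) \ {b, c} = insert a C := by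
  ext y
  constructor
  · rintro ⟨h | rfl | rfl | rfl, h'⟩
    · exact Or.inr h
    · exact Or.inl rfl
    · exact (h' (Or.inl rfl)).elim
    · exact (h' (Or.inr rfl)).elim
  · rintro (rfl | h)
    · exact ⟨Or.inr (Or.inl rfl), by rintro (h | h); exacts [hab h, hac h]⟩
    · exact ⟨Or.inl h, by rintro (rfl | rfl); exacts [hb h, hc h]⟩

/-- A connected graph with a vertex of degree three has two vertices on the same side whose
deletion leaves it connected. -/
theorem Conn.exists_pair (hr : ∀ e f, r e f → r f e) (s : α → Prop) (hfin : E.Finite)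
    (hE : Conn r E) {w n₁ n₂ n₃ : α} (hw : w ∈ E) (h₁ : n₁ ∈ E) (h₂ : n₂ ∈ E) (h₃ : n₃ ∈ E)
    (h12 : n₁ ≠ n₂) (h13 : n₁ ≠ n₃) (h23 : n₂ ≠ n₃) (hw1 : n₁ ≠ w) (hw2 : n₂ ≠ w) (hw3 : n₃ ≠ w)
    (r₁ : r n₁ w) (r₂ : r n₂ w) (r₃ : r n₃ w) :
    ∃ u ∈ E, ∃ v ∈ E, u ≠ v ∧ (s u ↔ s v) ∧ Conn r (E \ {u, v}) := by
  -- Choose a maximal connected `C` with three distinct neighbours outside it; `{w}` is a candidate.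
  have hF : {C : Set α | C ⊆ E ∧ Conn r C ∧ C.Nonempty ∧ ∃ l₁ l₂ l₃, l₁ ∈ E ∧ l₂ ∈ E ∧ l₃ ∈ E ∧
      l₁ ≠ l₂ ∧ l₁ ≠ l₃ ∧ l₂ ≠ l₃ ∧ l₁ ∉ C ∧ l₂ ∉ C ∧ l₃ ∉ C ∧ (∃ c ∈ C, r l₁ c) ∧
      (∃ c ∈ C, r l₂ c) ∧ (∃ c ∈ C, r l₃ c)}.Finite :=
    hfin.finite_subsets.subset fun C hC => hC.1
  obtain ⟨C, hC⟩ := hF.exists_maximal ⟨{w}, by simpa using hw, conn_singleton w, ⟨w, rfl⟩, n₁, n₂,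
    n₃, h₁, h₂, h₃, h12, h13, h23, hw1, hw2, hw3, ⟨w, rfl, r₁⟩, ⟨w, rfl, r₂⟩, ⟨w, rfl, r₃⟩⟩
  obtain ⟨⟨hCE, hCc, hCn, l₁, l₂, l₃, m₁, m₂, m₃, k12, k13, k23, c₁, c₂, c₃, a₁, a₂, a₃⟩, hmax⟩ := hC
  have hmono : ∀ (z l : α), (∃ c ∈ C, r l c) → ∃ c ∈ Insert.insert z C, r l c := fun z l ⟨c, hc, h⟩ =>
    ⟨c, Or.inr hc, h⟩
  have hno : ∀ z ∈ E, z ∉ C → Conn r (Insert.insert z C) → ∀ k₁ k₂ k₃, k₁ ∈ E → k₂ ∈ E → k₃ ∈ E →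
      k₁ ≠ k₂ → k₁ ≠ k₃ → k₂ ≠ k₃ → k₁ ∉ Insert.insert z C → k₂ ∉ Insert.insert z C → k₃ ∉ Insert.insert z C →
      (∃ c ∈ Insert.insert z C, r k₁ c) → (∃ c ∈ Insert.insert z C, r k₂ c) → (∃ c ∈ Insert.insert z C, r k₃ c) →
      False := by
    intro z hz hzC hc k₁ k₂ k₃ i1 i2 i3 i4 i5 i6 i7 i8 i9 i10 i11 i12
    exact hzC (hmax ⟨Set.insert_subset hz hCE, hc, ⟨z, Or.inl rfl⟩, k₁, k₂, k₃, i1, i2, i3, i4, i5,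
      i6, i7, i8, i9, i10, i11, i12⟩ (Set.subset_insert _ _) (Or.inl rfl))
  -- Otherwise there is a further vertex `z` adjacent to this set. If it is adjacent to `C`, then
  -- `C` can be enlarged by `z`; if it is adjacent to some `lᵢ`, then `C` can be enlarged by `lᵢ`,
  -- with `z` as the replacement neighbour.
  have hall : C ∪ {l₁, l₂, l₃} = E := by
    by_contra hne
    have hsub : C ∪ {l₁, l₂, l₃} ⊆ E := by
      rintro z (hz | rfl | rfl | rfl)
      exacts [hCE hz, m₁, m₂, m₃]
    obtain ⟨z, hz, hzD, d, hd, hzd⟩ := hE.exists_adj hr hsub ⟨l₁, by simp⟩ hne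
    simp only [Set.mem_union, Set.mem_insert_iff, Set.mem_singleton_iff, not_or] at hzD
    obtain ⟨hzC, z1, z2, z3⟩ := hzD
    have key : ∀ l l' l'', l ∈ E → l' ∈ E → l'' ∈ E → l ≠ l' → l ≠ l'' → l' ≠ l'' → l ∉ C →
        l' ∉ C → l'' ∉ C → (∃ c ∈ C, r l c) → (∃ c ∈ C, r l' c) → (∃ c ∈ C, r l'' c) →
        z ≠ l → z ≠ l' → z ≠ l'' → ¬ r z l := by
      intro l l' l'' i1 i2 i3 i4 i5 i6 i7 i8 i9 i10 i11 i12 i13 i14 i15 hzl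
      obtain ⟨c, hc, hlc⟩ := i10
      refine hno l i1 i7 (hCc.insert hr hc hlc) z l' l'' hz i2 i3 i14 i15 i6 ?_ ?_ ?_
        ⟨l, Or.inl rfl, hzl⟩ (hmono l l' i11) (hmono l l'' i12)
      · rintro (h | h)
        · exact i13 h
        · exact hzC h
      · rintro (h | h)
        · exact i4 h.symm
        · exact i8 h
      · rintro (h | h)
        · exact i5 h.symm
        · exact i9 h
    rcases hd with hd | rfl | rfl | rfl
    · refine hno z hz hzC (hCc.insert hr hd hzd) l₁ l₂ l₃ m₁ m₂ m₃ k12 k13 k23 ?_ ?_ ?_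
        (hmono z l₁ a₁) (hmono z l₂ a₂) (hmono z l₃ a₃)
      · rintro (h | h)
        · exact z1 h.symm
        · exact c₁ h
      · rintro (h | h)
        · exact z2 h.symm
        · exact c₂ h
      · rintro (h | h)
        · exact z3 h.symm
        · exact c₃ h
    · exact key d l₂ l₃ m₁ m₂ m₃ k12 k13 k23 c₁ c₂ c₃ a₁ a₂ a₃ z1 z2 z3 hzd
    · exact key d l₁ l₃ m₂ m₁ m₃ k12.symm k23 k13 c₂ c₁ c₃ a₂ a₁ a₃ z2 z1 z3 hzd
    · exact key d l₁ l₂ m₃ m₁ m₂ k13.symm k23.symm k12 c₃ c₁ c₂ a₃ a₁ a₂ z3 z1 z2 hzd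
  have fin : ∀ l l' l'', l ≠ l' → l ≠ l'' → l' ≠ l'' → l ∉ C → l' ∉ C → l'' ∉ C →
      (∃ c ∈ C, r l c) → ({l, l', l''} : Set α) = {l₁, l₂, l₃} → Conn r (E \ {l', l''}) := by
    intro l l' l'' i4 i5 i6 i7 i8 i9 i10 hset
    obtain ⟨c, hc, hlc⟩ := i10
    have : E \ {l', l''} = Insert.insert l C := by
      rw [← hall, ← hset]
      exact union_triple_sdiff i4 i5 i8 i9
    rw [this]
    exact hCc.insert hr hc hlc
  -- Two of the three neighbours are on the same side, and deleting them leaves `C` with the third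
  -- neighbour.
  by_cases h12 : s l₁ ↔ s l₂
  · exact ⟨l₁, m₁, l₂, m₂, k12, h12, fin l₃ l₁ l₂ k13.symm k23.symm k12 c₃ c₁ c₂ a₃
      (by rw [Set.insert_comm l₃, Set.pair_comm l₃])⟩
  by_cases h13 : s l₁ ↔ s l₃
  · exact ⟨l₁, m₁, l₃, m₃, k13, h13, fin l₂ l₁ l₃ k12.symm k23 k13 c₂ c₁ c₃ a₂
      (Set.insert_comm _ _ _)⟩
  · exact ⟨l₂, m₂, l₃, m₃, k23, by tauto, fin l₁ l₂ l₃ k12 k13 k23 c₁ c₂ c₃ a₁ rfl⟩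

/-- A connected graph with five vertices has a vertex of degree three or a path with five
vertices. -/
theorem Conn.exists_path (hr : ∀ e f, r e f → r f e)
    (hE : Conn r E) (hcard : 5 ≤ E.ncard)
    (h3 : ∀ w n₁ n₂ n₃, w ∈ E → n₁ ∈ E → n₂ ∈ E → n₃ ∈ E → n₁ ≠ n₂ → n₁ ≠ n₃ → n₂ ≠ n₃ →
      r n₁ w → r n₂ w → r n₃ w → False) :
    ∃ p₁ p₂ p₃ p₄ p₅, (p₁ ∈ E ∧ p₂ ∈ E ∧ p₃ ∈ E ∧ p₄ ∈ E ∧ p₅ ∈ E) ∧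
      (p₁ ≠ p₂ ∧ p₁ ≠ p₃ ∧ p₁ ≠ p₄ ∧ p₁ ≠ p₅ ∧ p₂ ≠ p₃ ∧ p₂ ≠ p₄ ∧ p₂ ≠ p₅ ∧ p₃ ≠ p₄ ∧ p₃ ≠ p₅ ∧
        p₄ ≠ p₅) ∧ r p₁ p₂ ∧ r p₂ p₃ ∧ r p₃ p₄ ∧ r p₄ p₅ := by
  -- Repetitions are allowed, so this extends paths with one to four vertices. A new neighbour of an
  -- inner vertex would give that vertex degree three, so longer paths are extended at an end.
  have hext : ∀ a ∈ E, ∀ b ∈ E, ∀ c ∈ E, ∀ d ∈ E,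
      ∃ z ∈ E, (z ≠ a ∧ z ≠ b ∧ z ≠ c ∧ z ≠ d) ∧ (r z a ∨ r z b ∨ r z c ∨ r z d) := by
    intro a ha b hb c hc d hd
    have hsub : ({a, b, c, d} : Set α) ⊆ E := by
      rintro y (rfl | rfl | rfl | rfl) <;> assumption
    have hlt : ({a, b, c, d} : Set α).ncard ≤ 4 := by
      refine (Set.ncard_insert_le _ _).trans (Nat.succ_le_succ ?_)
      refine (Set.ncard_insert_le _ _).trans (Nat.succ_le_succ ?_)
      exact (Set.ncard_insert_le _ _).trans (by rw [Set.ncard_singleton])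
    obtain ⟨z, hz, hzs, y, hy, hzy⟩ := hE.exists_adj hr hsub ⟨a, Or.inl rfl⟩
      (fun h => by rw [h] at hlt; omega)
    refine ⟨z, hz, ⟨?_, ?_, ?_, ?_⟩, ?_⟩
    · rintro rfl; exact hzs (Or.inl rfl)
    · rintro rfl; exact hzs (Or.inr (Or.inl rfl))
    · rintro rfl; exact hzs (Or.inr (Or.inr (Or.inl rfl)))
    · rintro rfl; exact hzs (Or.inr (Or.inr (Or.inr rfl)))
    · rcases hy with rfl | rfl | rfl | rfl <;> tauto
  have hne : E.Nonempty := Set.nonempty_of_ncard_ne_zero (by omega)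
  obtain ⟨c, hc⟩ := hne
  obtain ⟨p, hp, ⟨hpc, -⟩, hpw⟩ := hext c hc c hc c hc c hc
  replace hpw : r p c := by tauto
  obtain ⟨a, b, d, ha, hb, hd, hab, had, hbd, hrab, hrbd⟩ : ∃ a b d, a ∈ E ∧ b ∈ E ∧ d ∈ E ∧
      a ≠ b ∧ a ≠ d ∧ b ≠ d ∧ r a b ∧ r b d := by
    obtain ⟨q, hq, ⟨q1, q2, -⟩, hx⟩ := hext p hp c hc c hc c hc
    by_cases h : r q p
    · exact ⟨q, p, c, hq, hp, hc, q1, q2, hpc, h, hpw⟩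
    · exact ⟨q, c, p, hq, hc, hp, q2, q1, hpc.symm, by tauto, hr _ _ hpw⟩
  obtain ⟨p₁, p₂, p₃, p₄, m1, m2, m3, m4, d12, d13, d14, d23, d24, d34, r1, r2, r3⟩ :
      ∃ p₁ p₂ p₃ p₄, p₁ ∈ E ∧ p₂ ∈ E ∧ p₃ ∈ E ∧ p₄ ∈ E ∧ p₁ ≠ p₂ ∧ p₁ ≠ p₃ ∧ p₁ ≠ p₄ ∧
        p₂ ≠ p₃ ∧ p₂ ≠ p₄ ∧ p₃ ≠ p₄ ∧ r p₁ p₂ ∧ r p₂ p₃ ∧ r p₃ p₄ := by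
    obtain ⟨q, hq, ⟨q1, q2, q3, -⟩, hx | hx | hx⟩ := hext a ha b hb d hd d hd
    · exact ⟨q, a, b, d, hq, ha, hb, hd, q1, q2, q3, hab, had, hbd, hx, hrab, hrbd⟩
    · exact (h3 b a d q hb ha hd hq had (Ne.symm q1) (Ne.symm q3) hrab (hr _ _ hrbd) hx).elim
    · exact ⟨q, d, b, a, hq, hd, hb, ha, q3, q2, q1, hbd.symm, had.symm, hab.symm, by tauto,
        hr _ _ hrbd, hr _ _ hrab⟩
  obtain ⟨q, hq, ⟨q1, q2, q3, q4⟩, hx | hx | hx | hx⟩ := hext p₁ m1 p₂ m2 p₃ m3 p₄ m4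
  · exact ⟨q, p₁, p₂, p₃, p₄, ⟨hq, m1, m2, m3, m4⟩,
      ⟨q1, q2, q3, q4, d12, d13, d14, d23, d24, d34⟩, hx, r1, r2, r3⟩
  · exact (h3 p₂ p₁ p₃ q m2 m1 m3 hq d13 (Ne.symm q1) (Ne.symm q3) r1 (hr _ _ r2) hx).elim
  · exact (h3 p₃ p₂ p₄ q m3 m2 m4 hq d24 (Ne.symm q2) (Ne.symm q4) r2 (hr _ _ r3) hx).elim
  · exact ⟨q, p₄, p₃, p₂, p₁, ⟨hq, m4, m3, m2, m1⟩,
      ⟨q4, q3, q2, q1, d34.symm, d24.symm, d14.symm, d23.symm, d13.symm, d12.symm⟩, hx,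
      hr _ _ r3, hr _ _ r2, hr _ _ r1⟩

end Graph

/-! ### Connectivity of tableaux under pivoting. -/

section Separation

variable {α R : Type*} [CommRing R] [Nontrivial R]
  {M : Matroid α} {G : Subgroup Rˣ} {A : Set α → α → α → R} {X W K : Set α} {x y : α}

theorem Adj.mem_iff {e f : α} (h : Adj A X e f) : e ∈ X ↔ f ∉ X := by
  rcases h with ⟨h1, h2, -⟩ | ⟨h1, h2, -⟩ <;> tauto

theorem not_adj_self {e : α} : ¬ Adj A X e e := fun h => by have := h.mem_iff; tauto

/-- A separation is preserved by pivoting. -/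
theorem sep_pivot (hA : IsTableau M G A) (hX : M.IsBase X) (hW : W ⊆ M.E) (hK : K ⊆ W)
    (hx : x ∈ X ∩ W) (hy : y ∈ W \ X) (hxy : A X x y ≠ 0)
    (h : ∀ e ∈ K, ∀ f ∈ W, f ∉ K → ¬ Adj A X e f) :
    ∀ e ∈ K, ∀ f ∈ W, f ∉ K → ¬ Adj A (swap X x y) e f := by
  have hyE : y ∈ M.E \ X := ⟨hW hy.1, hy.2⟩
  have uA := hA.unit hX hx.1 hyE hxy
  have hs : ∀ e ∈ X, e ∈ W → ∀ f ∈ W, f ∉ X → A X e f ≠ 0 → (e ∈ K ↔ f ∈ K) := by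
    intro e heX heW f hf hfX h0
    constructor
    · intro heK
      by_contra hfK
      exact h e heK f hf hfK (Or.inl ⟨heX, hfX, h0⟩)
    · intro hfK
      by_contra heK
      exact h f hfK e heW heK (Or.inr ⟨heX, hfX, h0⟩)
  have hxyK := hs x hx.1 hx.2 y hy.1 hy.2 hxy
  have key : ∀ e ∈ swap X x y, e ∈ W → ∀ f ∈ W, f ∉ swap X x y → A (swap X x y) e f ≠ 0 →
      (e ∈ K ↔ f ∈ K) := by
    intro e he heW f hf hfX h0
    have hfx : f = x ∨ f ∉ X := by
      by_contra hcon
      push Not at hcon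
      exact hfX (Or.inr ⟨hcon.2, hcon.1⟩)
    rcases he with rfl | he
    · have e1 := hA.piv_row X x e f hX hx.1 hyE hxy (hW hf)
      rcases hfx with rfl | hfX'
      · exact hxyK.symm
      · rw [← hxyK]
        refine hs x hx.1 hx.2 f hf hfX' fun h1 => ?_
        rw [h1] at e1
        exact h0 (uA.isUnit.mul_left_eq_zero.1 e1)
    · have e1 := hA.piv X x y e f hX hx.1 hyE hxy he.1 he.2 (hW hf)
      rcases hfx with rfl | hfX'
      · rw [hA.self X f hX hx.1, hA.off X e f hX he.1 hx.1 (fun h => he.2 h.symm)] at e1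
        rw [hxyK]
        refine hs e he.1 heW y hy.1 hy.2 fun h1 => ?_
        rw [h1, zero_mul, zero_mul, sub_zero] at e1
        exact h0 (uA.isUnit.mul_left_eq_zero.1 e1)
      -- If a zero entry at `(e, f)` becomes nonzero, then those at `(e, y)` and `(x, f)` were
      -- nonzero, so that `e`, `y`, `x`, `f` lie in the same part.
      · by_cases h1 : A X e f = 0
        · have h2 : A X e y ≠ 0 := by
            intro h2
            rw [h1, h2, zero_mul, zero_mul, sub_zero] at e1
            exact h0 (uA.isUnit.mul_left_eq_zero.1 e1)
          have h3 : A X x f ≠ 0 := by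
            intro h3
            rw [h1, h3, zero_mul, mul_zero, sub_zero] at e1
            exact h0 (uA.isUnit.mul_left_eq_zero.1 e1)
          rw [hs e he.1 heW y hy.1 hy.2 h2, ← hxyK, hs x hx.1 hx.2 f hf hfX' h3]
        · exact hs e he.1 heW f hf hfX' h1
  rintro e he f hf hfK (⟨h1, h2, h3⟩ | ⟨h1, h2, h3⟩)
  · exact hfK ((key e h1 (hK he) f hf h2 h3).1 he)
  · exact hfK ((key f h1 hf e (hK he) h2 h3).2 he)

/-- A separation at the new base is carried back by the reverse pivot. -/
theorem conn_pivot (hA : IsTableau M G A) (hX : M.IsBase X) (hW : W ⊆ M.E)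
    (hx : x ∈ X ∩ W) (hy : y ∈ W \ X) (hxy : A X x y ≠ 0) (h : Conn (Adj A X) W) :
    Conn (Adj A (swap X x y)) W := by
  intro K hK hs
  have hyE : y ∈ M.E \ X := ⟨hW hy.1, hy.2⟩
  have hX' : M.IsBase (swap X x y) := (hA.base_iff X x y hX hx.1 hyE).2 hxy
  have hxne : x ≠ y := fun h => hy.2 (h ▸ hx.1)
  have hxX' : x ∉ swap X x y := by
    rintro (h' | h')
    · exact hxne h'
    · exact h'.2 rfl
  have hss := swap_swap hx.1 hy.2
  have hne' : A (swap X x y) y x ≠ 0 := by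
    rw [← hA.base_iff _ y x hX' (Or.inl rfl) ⟨hW hx.2, hxX'⟩, hss]
    exact hX
  have := sep_pivot hA hX' hW hK ⟨Or.inl rfl, hy.1⟩ ⟨hx.2, hxX'⟩ hne' hs
  rw [hss] at this
  exact h K hK this

/-- After at most one pivot, a connected tableau with at least five elements has two elements on
the same side whose deletion leaves it connected. -/
theorem exists_pair_of_path (hA : IsTableau M G A) (hX : M.IsBase X) (hfin : M.E.Finite)
    (hc : Conn (Adj A X) M.E)
    (h3 : ∀ w n₁ n₂ n₃, w ∈ M.E → n₁ ∈ M.E → n₂ ∈ M.E → n₃ ∈ M.E → n₁ ≠ n₂ → n₁ ≠ n₃ → n₂ ≠ n₃ →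
      Adj A X n₁ w → Adj A X n₂ w → Adj A X n₃ w → False)
    {p₁ p₂ p₃ p₄ p₅ : α} (m₁ : p₁ ∈ M.E) (m₂ : p₂ ∈ M.E) (m₃ : p₃ ∈ M.E) (m₄ : p₄ ∈ M.E)
    (m₅ : p₅ ∈ M.E) (hnd : p₁ ≠ p₂ ∧ p₁ ≠ p₃ ∧ p₁ ≠ p₄ ∧ p₁ ≠ p₅ ∧ p₂ ≠ p₃ ∧
      p₂ ≠ p₄ ∧ p₂ ≠ p₅ ∧ p₃ ≠ p₄ ∧ p₃ ≠ p₅ ∧ p₄ ≠ p₅) (r₁ : Adj A X p₁ p₂) (r₂ : Adj A X p₂ p₃)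
    (r₃ : Adj A X p₃ p₄) (r₄ : Adj A X p₄ p₅) (h : p₃ ∉ X) :
    ∃ X, M.IsBase X ∧ ∃ u ∈ M.E, ∃ v ∈ M.E, u ≠ v ∧ (u ∈ X ↔ v ∈ X) ∧
      Conn (Adj A X) (M.E \ {u, v}) := by
  obtain ⟨d12, d13, d14, d15, d23, d24, d25, d34, d35, d45⟩ := hnd
  have h2X : p₂ ∈ X := r₂.mem_iff.2 h
  have h4X : p₄ ∈ X := by by_contra h'; exact h (r₃.mem_iff.2 h')
  have h1X : p₁ ∉ X := fun h' => r₁.mem_iff.1 h' h2X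
  have h5X : p₅ ∉ X := r₄.mem_iff.1 h4X
  have e23 : A X p₂ p₃ ≠ 0 := by
    rcases r₂ with h' | h'
    · exact h'.2.2
    · exact absurd h'.1 h
  have e43 : A X p₄ p₃ ≠ 0 := by
    rcases r₃ with h' | h'
    · exact absurd h'.1 h
    · exact h'.2.2
  have e21 : A X p₂ p₁ ≠ 0 := by
    rcases r₁ with h' | h'
    · exact absurd h'.1 h1X
    · exact h'.2.2
  have e45 : A X p₄ p₅ ≠ 0 := by
    rcases r₄ with h' | h'
    · exact h'.2.2
    · exact absurd h'.1 h5X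
  have e41 : A X p₄ p₁ = 0 := by
    by_contra h0
    exact h3 p₄ p₁ p₃ p₅ m₄ m₁ m₃ m₅ d13 d15 d35 (Or.inr ⟨h4X, h1X, h0⟩) r₃ r₄.symm
  have e25 : A X p₂ p₅ = 0 := by
    by_contra h0
    exact h3 p₂ p₁ p₃ p₅ m₂ m₁ m₃ m₅ d13 d15 d35 r₁ r₂.symm (Or.inr ⟨h2X, h5X, h0⟩)
  -- After this pivot `p₄` has the three neighbours `p₁`, `p₂`, `p₅`.
  have hX' : M.IsBase (swap X p₂ p₃) := (hA.base_iff X p₂ p₃ hX h2X ⟨m₃, h⟩).2 e23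
  have h4X' : p₄ ∈ swap X p₂ p₃ := Or.inr ⟨h4X, Ne.symm d24⟩
  have uA := hA.unit hX h2X ⟨m₃, h⟩ e23
  have f5 := hA.piv_eq hX h2X ⟨m₃, h⟩ e23 h4X (Ne.symm d24) m₅ (Or.inr e25)
  have f1 := hA.piv X p₂ p₃ p₄ p₁ hX h2X ⟨m₃, h⟩ e23 h4X (Ne.symm d24) m₁
  have f2 := hA.piv X p₂ p₃ p₄ p₂ hX h2X ⟨m₃, h⟩ e23 h4X (Ne.symm d24) m₂
  rw [e41, zero_mul, zero_sub] at f1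
  rw [hA.self X p₂ hX h2X, hA.off X p₄ p₂ hX h4X h2X d24, zero_mul, zero_sub, mul_one] at f2
  have h2X' : p₂ ∉ swap X p₂ p₃ := by
    rintro (h' | h')
    · exact d23 h'
    · exact h'.2 rfl
  refine ⟨swap X p₂ p₃, hX', ?_⟩
  refine Conn.exists_pair (fun _ _ h => h.symm) (fun e => e ∈ swap X p₂ p₃) hfin
    (conn_pivot hA hX le_rfl ⟨h2X, m₂⟩ ⟨m₃, h⟩ e23 hc) (w := p₄) (n₁ := p₁) (n₂ := p₂) (n₃ := p₅)
    m₄ m₁ m₂ m₅ d12 d15 d25 d14 d24 (Ne.symm d45) ?_ ?_ ?_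
  · refine Or.inr ⟨h4X', notMem_swap h1X d13, fun h0 => ?_⟩
    rw [h0, zero_mul, eq_comm, neg_eq_zero] at f1
    exact e21 ((hA.unit hX h4X ⟨m₃, h⟩ e43).isUnit.mul_right_eq_zero.1 f1)
  · refine Or.inr ⟨h4X', h2X', fun h0 => ?_⟩
    rw [h0, zero_mul, eq_comm, neg_eq_zero] at f2
    exact e43 f2
  · refine Or.inr ⟨h4X', notMem_swap h5X (Ne.symm d35), ?_⟩
    rwa [f5]

/-- No pivot is needed if there is a vertex of degree three. Otherwise there is a path with five
vertices; duality ensures that its middle vertex is a column. -/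
theorem exists_pair (hG : -1 ∈ G) (hA : IsTableau M G A) (hX : M.IsBase X) (hfin : M.E.Finite)
    (hc : Conn (Adj A X) M.E) (hcard : 5 ≤ M.E.ncard) :
    ∃ X, M.IsBase X ∧ ∃ u ∈ M.E, ∃ v ∈ M.E, u ≠ v ∧ (u ∈ X ↔ v ∈ X) ∧
      Conn (Adj A X) (M.E \ {u, v}) := by
  by_cases h3 : ∀ w n₁ n₂ n₃, w ∈ M.E → n₁ ∈ M.E → n₂ ∈ M.E → n₃ ∈ M.E → n₁ ≠ n₂ → n₁ ≠ n₃ →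
      n₂ ≠ n₃ → Adj A X n₁ w → Adj A X n₂ w → Adj A X n₃ w → False
  · obtain ⟨p₁, p₂, p₃, p₄, p₅, ⟨m₁, m₂, m₃, m₄, m₅⟩, hnd, r₁, r₂, r₃, r₄⟩ :=
      hc.exists_path (fun _ _ h => h.symm) hcard h3
    by_cases h : p₃ ∈ X
    · have hXE := hX.subset_ground
      obtain ⟨Y, hY, u, hu, v, hv, huv, hs, hcon⟩ := exists_pair_of_path (hA.dual hG)
        hX.compl_isBase_dual (by simpa using hfin) ((conn_dual hXE le_rfl).2 hc)
        (fun w n₁ n₂ n₃ i1 i2 i3 i4 i5 i6 i7 i8 i9 i10 => h3 w n₁ n₂ n₃ i1 i2 i3 i4 i5 i6 i7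
          ((adj_dual hXE i2 i1).1 i8) ((adj_dual hXE i3 i1).1 i9) ((adj_dual hXE i4 i1).1 i10))
        m₁ m₂ m₃ m₄ m₅ hnd ((adj_dual hXE m₁ m₂).2 r₁) ((adj_dual hXE m₂ m₃).2 r₂)
        ((adj_dual hXE m₃ m₄).2 r₃) ((adj_dual hXE m₄ m₅).2 r₄) (fun h' => h'.2 h)
      have hu' : u ∈ M.E := hu
      have hv' : v ∈ M.E := hv
      have hYE : Y ⊆ M.E := hY.subset_ground
      refine ⟨M.E \ Y, hY.compl_isBase_of_dual, u, hu, v, hv, huv, ?_, ?_⟩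
      · simp only [Set.mem_sdiff, hu', hv', true_and, hs]
      · rw [← conn_dual (Set.sdiff_subset) (Set.sdiff_subset), Set.sdiff_sdiff_cancel_left hYE]
        exact hcon
    · exact exists_pair_of_path hA hX hfin hc h3 m₁ m₂ m₃ m₄ m₅ hnd r₁ r₂ r₃ r₄ h
  · push Not at h3
    obtain ⟨w, n₁, n₂, n₃, i1, i2, i3, i4, i5, i6, i7, i8, i9, i10, -⟩ := h3
    have hne : ∀ {n}, Adj A X n w → n ≠ w := by
      rintro n h rfl; exact not_adj_self h
    exact ⟨X, hX, Conn.exists_pair (fun _ _ h => h.symm) (fun e => e ∈ X) hfin hc i1 i2 i3 i4 i5 i6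
      i7 (hne i8) (hne i9) (hne i10) i8 i9 i10⟩

end Separation

/-! ### Gluing, and existence of lifts. -/

section Glue

variable {α R S : Type*} [CommRing R] [CommRing S] [Nontrivial R] [Nontrivial S]
  {M : Matroid α} {G : Subgroup Rˣ} {H : Subgroup Sˣ} {lam : R → S}
  {A : Set α → α → α → R} {B B₁ B₂ : Set α → α → α → S} {Fr : Set α → Prop} {X X₀ : Set α}
  {u v : α}

/-- Pivots inside `M.E \ {u}` never use column `u`, so the agreement at `X₀` spreads by exchanges to
all bases avoiding `u`. -/
theorem goodOff_of_agree [M.Finite] (hA : IsTableau M G A) (hB : IsFrameSystem M.E Fr B)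
    (h₁ : IsLift (M ＼ {u}) H lam A B₁) (hX₀ : M.IsBase X₀) (hu : u ∈ M.E \ X₀) (hF : Fr X₀)
    (hag : Agree B B₁ (M.E \ {u}) X₀) : GoodOff M H lam A Fr B u := by
  have hAu := hA.delete hX₀ hu
  have hb : ∀ {X}, M.IsBase X → u ∉ X → (M ＼ {u}).IsBase X := fun h h' =>
    (delete_isBase_iff_of_notMem hX₀ hu).2 ⟨h, h'⟩
  have key : ∀ X, M.IsBase X → u ∉ X → Fr X ∧ Agree B B₁ (M.E \ {u}) X := by
    intro X hX huX
    refine base_induction {u} (Q := fun X => Fr X ∧ Agree B B₁ (M.E \ {u}) X) hX₀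
      (by simpa using hu.2) ⟨hF, hag⟩ ?_ hX (by simpa using huX)
    rintro X x e hX hXu hx he heu hX' ⟨hFX, hagX⟩
    have huX : u ∉ X := by simpa using hXu
    have hxu : x ∈ M.E \ {u} := ⟨hX.subset_ground hx, fun h => huX (h ▸ hx)⟩
    have heW : e ∈ M.E \ {u} := ⟨he.1, heu⟩
    have hne : A X x e ≠ 0 := (hA.base_iff X x e hX hx he).1 hX'
    have hunit : IsUnit (B X x e) := by
      rw [hagX x hx hxu e heW]
      exact ((h₁.match_entry hAu (hb hX huX) hx ⟨heW, he.2⟩).2 hne).isUnit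
    exact ⟨hB.frame X x e hFX hx he hunit, hagX.pivot (E₂ := (M ＼ {u}).E) hB
      h₁.tab.frameSystem hFX (hb hX huX) Set.sdiff_subset le_rfl hx hxu he.2 heW hunit⟩
  refine ⟨fun X hX huX => (key X hX huX).1, ?_, ?_⟩
  · intro X x e hX huX hx he heu
    have hxu : x ∈ M.E \ {u} := ⟨hX.subset_ground hx, fun h => huX (h ▸ hx)⟩
    have := h₁.match_entry hAu (hb hX huX) hx ⟨⟨he.1, heu⟩, he.2⟩
    rwa [Match, ← (key X hX huX).2 x hx hxu e ⟨he.1, heu⟩] at this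
  · intro X a b c d hq huX hcu hdu p hp
    have hX := hq.base
    have hE : ∀ {x}, x ∈ X → x ∈ M.E \ {u} := fun {x} hx =>
      ⟨hX.subset_ground hx, fun h => huX (h ▸ hx)⟩
    have := h₁.good X a b c d ⟨hb hX huX, hq.ha, hq.hb, ⟨⟨hq.hc.1, hcu⟩, hq.hc.2⟩,
      ⟨⟨hq.hd.1, hdu⟩, hq.hd.2⟩, hq.ac, hq.ad, hq.bc, hq.bd⟩ p hp
    have hag := (key X hX huX).2
    rwa [← hag a hq.ha (hE hq.ha) c ⟨hq.hc.1, hcu⟩, ← hag a hq.ha (hE hq.ha) d ⟨hq.hd.1, hdu⟩,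
      ← hag b hq.hb (hE hq.hb) c ⟨hq.hc.1, hcu⟩, ← hag b hq.hb (hE hq.hb) d ⟨hq.hd.1, hdu⟩] at this

/-- Lifts of two single-element deletions that agree on their intersection fit together to a lift,
provided that the cross ratios that involve both elements are right. -/
theorem exists_lift_of_agree [M.Finite] (hl : IsLiftMap G H lam) (hA : IsTableau M G A)
    (h₁ : IsLift (M ＼ {u}) H lam A B₁) (h₂ : IsLift (M ＼ {v}) H lam A B₂) (hX₀ : M.IsBase X₀)
    (hu : u ∈ M.E \ X₀) (hv : v ∈ M.E \ X₀) (huv : u ≠ v)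
    (hag : ∀ x ∈ X₀, ∀ e ∈ M.E \ {u, v}, e ∉ X₀ → B₁ X₀ x e = B₂ X₀ x e)
    (hgood : ∀ (Fr : Set α → Prop) (B : Set α → α → α → S), IsFrameSystem M.E Fr B →
      GoodOff M H lam A Fr B u → GoodOff M H lam A Fr B v →
      (∀ x ∈ X₀, B X₀ x u = B₂ X₀ x u ∧ B X₀ x v = B₁ X₀ x v) →
      ∀ X a b, u ∉ X → v ∉ X → Quad M A X a b u v → Good lam A B X a b u v) :
    ∃ B, IsLift M H lam A B := by
  classical
  obtain ⟨Z, hZ⟩ := (M.ground_finite.subset hX₀.subset_ground).exists_finset_coe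
  -- Column `u` is available only from `B₂` and column `v` only from `B₁`; the other columns agree.
  set D : α → α → S := fun x y => if y = u then B₂ X₀ x u else B₁ X₀ x y with hD
  obtain ⟨hfr, hco⟩ := isFrame_rowSpace M.E Z D
  rw [hZ] at hfr hco
  have hFS := isFrameSystem_rowCoord (rowSpace M.E Z D) M.E
  set B := rowCoord (rowSpace M.E Z D)
  have hZ' : ∀ {x}, x ∈ X₀ → x ∈ Z := fun {x} hx => by rw [← hZ] at hx; exact hx
  have e₁ : ∀ x ∈ X₀, ∀ y ∈ M.E \ {u}, y ∉ X₀ → B X₀ x y = B₁ X₀ x y := by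
    intro x hx y hy hyX
    rw [hco x (hZ' hx) y ⟨hy.1, hyX⟩, hD]
    exact if_neg hy.2
  have e₂ : ∀ x ∈ X₀, ∀ y ∈ M.E \ {v}, y ∉ X₀ → B X₀ x y = B₂ X₀ x y := by
    intro x hx y hy hyX
    rw [hco x (hZ' hx) y ⟨hy.1, hyX⟩, hD]
    by_cases hyu : y = u
    · simp [hyu]
    · simp only [hyu, if_false]
      exact hag x hx y ⟨hy.1, by rintro (h | h); exacts [hyu h, hy.2 h]⟩ hyX
  have b₁ := (delete_isBase_iff_of_notMem hX₀ hu).2 ⟨hX₀, hu.2⟩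
  have b₂ := (delete_isBase_iff_of_notMem hX₀ hv).2 ⟨hX₀, hv.2⟩
  have hgu : GoodOff M H lam A _ B u := goodOff_of_agree hA hFS h₁ hX₀ hu hfr
    (Agree.of_notMem hFS h₁.tab.frameSystem hfr b₁ fun x hx _ => e₁ x hx)
  have hgv : GoodOff M H lam A _ B v := goodOff_of_agree hA hFS h₂ hX₀ hv hfr
    (Agree.of_notMem hFS h₂.tab.frameSystem hfr b₂ fun x hx _ => e₂ x hx)
  exact ⟨B, isLift_of_goodOff hl hA hFS hgv hgu huv hX₀ hu.2 hv.2
    (hgood _ B hFS hgu hgv fun x hx => ⟨e₂ x hx u ⟨hu.1, huv⟩ hu.2,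
      e₁ x hx v ⟨hv.1, huv.symm⟩ hv.2⟩)⟩

/-- Two columns whose deletion leaves a connected tableau, or that are separated. -/
theorem exists_lift_of_columns [M.Finite] (hl : IsLiftMap G H lam) (hA : IsTableau M G A)
    (h₁ : IsLift (M ＼ {u}) H lam A B₁) (h₂ : IsLift (M ＼ {v}) H lam A B₂) (hX₀ : M.IsBase X₀)
    (hu : u ∈ M.E \ X₀) (hv : v ∈ M.E \ X₀) (huv : u ≠ v)
    (hc : Conn (Adj A X₀) (M.E \ {u, v}) ∨
      ∃ K ⊆ M.E, u ∈ K ∧ v ∉ K ∧ ∀ e ∈ K, ∀ f ∈ M.E, f ∉ K → ¬ Adj A X₀ e f) :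
    ∃ B, IsLift M H lam A B := by
  have hW : (M.E \ {u, v}).Finite := M.ground_finite.subset Set.sdiff_subset
  have hdis : Disjoint X₀ {u, v} := by
    rw [Set.disjoint_right]
    rintro y (rfl | rfl)
    exacts [hu.2, hv.2]
  have hXW : ∀ {X}, M.IsBase X → Disjoint X {u, v} → X ⊆ M.E \ {u, v} := fun hX hd x hx =>
    ⟨hX.subset_ground hx, Set.disjoint_left.1 hd hx⟩
  have b₁ : (M ＼ {u}).IsBase X₀ := (delete_isBase_iff_of_notMem hX₀ hu).2 ⟨hX₀, hu.2⟩
  have b₂ : (M ＼ {v}).IsBase X₀ := (delete_isBase_iff_of_notMem hX₀ hv).2 ⟨hX₀, hv.2⟩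
  have hv₁ : v ∈ (M ＼ {u}).E \ X₀ := ⟨⟨hv.1, huv.symm⟩, hv.2⟩
  have hu₂ : u ∈ (M ＼ {v}).E \ X₀ := ⟨⟨hu.1, huv⟩, hu.2⟩
  have k₁ := h₁.delete b₁ hv₁
  have k₂ := h₂.delete b₂ hu₂
  have hA' := (hA.delete hX₀ hu).delete b₁ hv₁
  have b' := (delete_isBase_iff_of_notMem b₁ hv₁).2 ⟨b₁, hv.2⟩
  have hset : M ＼ {v} ＼ {u} = M ＼ {u} ＼ {v} := by
    rw [Matroid.delete_delete, Matroid.delete_delete, Set.union_comm]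
  rw [hset] at k₂
  -- Both lifts restrict to lifts of the deletion of `u` and `v`, so by uniqueness they agree there
  -- after scaling.
  obtain ⟨k, hk, hkeq⟩ := scaleEq_of_isLift hl _ _ A B₁ B₂ X₀ (M.E \ {u, v}) hA' k₁ k₂ b'
    (fun y hy => ⟨⟨hy.1, fun h => hy.2 (Or.inl h)⟩, fun h => hy.2 (Or.inr h)⟩) hW rfl
  refine exists_lift_of_agree hl hA (h₁.scale hk) h₂ hX₀ hu hv huv
    (fun x hx e he heX => hkeq x hx (hXW hX₀ hdis hx) e he heX) ?_
  intro Fr B hFS hgu hgv _ X a b huX hvX hq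
  have hXd : Disjoint X {u, v} := by
    rw [Set.disjoint_right]
    rintro y (rfl | rfl) <;> assumption
  rcases hc with hc | ⟨K, hK, huK, hvK, hs⟩
  · have hcX : Conn (Adj A X) (M.E \ {u, v}) := by
      refine base_induction {u, v} (Q := fun X => Conn (Adj A X) (M.E \ {u, v})) hX₀ hdis hc ?_
        hq.base hXd
      intro X x e hX hXd hx he heu hX' hcX
      exact conn_pivot hA hX Set.sdiff_subset ⟨hx, hXW hX hXd hx⟩ ⟨⟨he.1, heu⟩, he.2⟩
        ((hA.base_iff X x e hX hx he).1 hX') hcX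
    obtain ⟨n, hn⟩ := hcX.exists_rowPath ⟨hq.ha, hXW hq.base hXd hq.ha⟩
      ⟨hq.hb, hXW hq.base hXd hq.hb⟩
    exact good_of_rowPath hl hA hFS hgu hgv huv Set.sdiff_subset (by simp) (by simp) n X a b huX
      hvX hq (hXW hq.base hXd hq.ha) (hXW hq.base hXd hq.hb) hn
  -- The separation persists at every base avoiding `u` and `v`, so no row is nonzero in both
  -- columns.
  · have hsX : ∀ e ∈ K, ∀ f ∈ M.E, f ∉ K → ¬ Adj A X e f := by
      refine base_induction {u, v}
        (Q := fun X => ∀ e ∈ K, ∀ f ∈ M.E, f ∉ K → ¬ Adj A X e f) hX₀ hdis hs ?_ hq.base hXd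
      intro X x e hX hXd hx he heu hX' hcX
      exact sep_pivot hA hX le_rfl hK ⟨hx, hX.subset_ground hx⟩ he
        ((hA.base_iff X x e hX hx he).1 hX') hcX
    by_cases haK : a ∈ K
    · exact (hsX a haK v hv.1 hvK (Or.inl ⟨hq.ha, hvX, hq.ad⟩)).elim
    · exact (hsX u huK a (hq.base.subset_ground hq.ha) haK (Or.inr ⟨hq.ha, huX, hq.ac⟩)).elim

/-- The case of a two by two tableau. -/
theorem exists_lift_of_two [M.Finite] (hl : IsLiftMap G H lam) (hA : IsTableau M G A)
    (h₁ : IsLift (M ＼ {u}) H lam A B₁) (h₂ : IsLift (M ＼ {v}) H lam A B₂) (hX₀ : M.IsBase X₀)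
    (hu : u ∈ M.E \ X₀) (hv : v ∈ M.E \ X₀) (huv : u ≠ v) (hW : M.E \ {u, v} ⊆ X₀) {a b : α}
    (hne : a ≠ b) (hab : X₀ = {a, b}) : ∃ B, IsLift M H lam A B := by
  classical
  have b₁ : (M ＼ {u}).IsBase X₀ := (delete_isBase_iff_of_notMem hX₀ hu).2 ⟨hX₀, hu.2⟩
  have b₂ : (M ＼ {v}).IsBase X₀ := (delete_isBase_iff_of_notMem hX₀ hv).2 ⟨hX₀, hv.2⟩
  have hv₁ : v ∈ (M ＼ {u}).E \ X₀ := ⟨⟨hv.1, huv.symm⟩, hv.2⟩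
  have hu₂ : u ∈ (M ＼ {v}).E \ X₀ := ⟨⟨hu.1, huv⟩, hu.2⟩
  have honly : ∀ X, M.IsBase X → u ∉ X → v ∉ X → X = X₀ := by
    intro X hX huX hvX
    refine hX.eq_of_subset_isBase hX₀ fun x hx => hW ⟨hX.subset_ground hx, ?_⟩
    rintro (rfl | rfl)
    exacts [huX hx, hvX hx]
  by_cases hq : Quad M A X₀ a b u v
  · obtain ⟨p, hp, hpe⟩ := hq.exists_ratio hA
    have hac := (h₂.match_entry (hA.delete hX₀ hv) b₂ hq.ha hu₂).2 hq.ac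
    have hbc := (h₂.match_entry (hA.delete hX₀ hv) b₂ hq.hb hu₂).2 hq.bc
    have had := (h₁.match_entry (hA.delete hX₀ hu) b₁ hq.ha hv₁).2 hq.ad
    have hbd := (h₁.match_entry (hA.delete hX₀ hu) b₁ hq.hb hv₁).2 hq.bd
    -- The two columns have no further column in common to tie them together, so row `a` of `B₁` may
    -- be divided by the factor `t` that makes the single cross ratio right.
    obtain ⟨c, ⟨t, ht, rfl⟩, hc⟩ := ((hl.mem p hpe).mul (had.mul hbc)).exists_div (hac.mul hbd)
    refine exists_lift_of_agree hl hA (h₁.scale (k := fun e => if e = a then t else 1)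
      fun e => ?_) h₂ hX₀ hu hv huv (fun x hx e he heX => (heX (hW he)).elim) ?_
    · by_cases h : e = a
      · simpa [h] using ht
      · simp [h, one_mem]
    intro Fr B hFS hgu hgv hval X a' b' huX hvX hq'
    obtain rfl := honly X hq'.base huX hvX
    have hva : v ≠ a := fun h => hq.hd.2 (h ▸ hq.ha)
    have hg : Good lam A B X a b u v := by
      intro p' hp'
      obtain rfl : p = p' := by
        apply ((hA.unit hq.base hq.ha hq.hd hq.ad).mul (hA.unit hq.base hq.hb hq.hc hq.bc)).cancel
        linear_combination hp' - hp
      rw [(hval a hq.ha).1, (hval a hq.ha).2, (hval b hq.hb).1, (hval b hq.hb).2]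
      simp only [scaleTableau, if_pos, if_neg hne.symm, if_neg hva, inv_one, Units.val_one]
      linear_combination (-(t⁻¹ : Sˣ) : S) * hc - B₂ X a u * B₁ X b v * t.inv_mul
    have ha := hq'.ha
    have hb := hq'.hb
    rw [hab] at ha hb
    rcases ha with rfl | rfl <;> rcases hb with rfl | rfl
    · exact good_same_row hl hA hq'
    · exact hg
    · exact hg.swap_row hl hA hq
    · exact good_same_row hl hA hq'
  · refine exists_lift_of_agree hl hA h₁ h₂ hX₀ hu hv huv
      (fun x hx e he heX => (heX (hW he)).elim) ?_
    intro Fr B hFS hgu hgv _ X a' b' huX hvX hq'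
    obtain rfl := honly X hq'.base huX hvX
    have ha := hq'.ha
    have hb := hq'.hb
    rw [hab] at ha hb
    rcases ha with rfl | rfl <;> rcases hb with rfl | rfl
    · exact good_same_row hl hA hq'
    · exact (hq hq').elim
    · exact (hq hq'.swap_row).elim
    · exact good_same_row hl hA hq'

/-- The matroid has rank at most one. -/
theorem exists_lift_of_subsingleton (hl : IsLiftMap G H lam) (hA : IsTableau M G A)
    (h : ∀ X, M.IsBase X → X.Subsingleton) : ∃ B, IsLift M H lam A B := by
  classical
  -- With at most one row all cross ratios are `1`, so the pattern of zeros suffices.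
  refine ⟨fun X x e => if A X x e = 0 then 0 else 1, ⟨?_, ?_, ?_, ?_, ?_, ?_⟩, ?_⟩
  · intro X x hX hx
    simp [hA.self X x hX hx]
  · intro X x y hX hx hy hne
    simp [hA.off X x y hX hx hy hne]
  · intro X x e hX hx he
    by_cases h0 : A X x e = 0
    · simp [h0]
    · simp [h0, UnitsIn.one]
  · intro X x e hX hx he
    rw [hA.base_iff X x e hX hx he]
    simp
  · intro X x e f hX hx he hne hf
    have h0 : A X x e ≠ 0 := by simpa using hne
    have h1 := hA.piv_row X x e f hX hx he h0 hf
    have h2 : A (swap X x e) e f = 0 ↔ A X x f = 0 := by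
      rw [← h1, (hA.unit hX hx he h0).isUnit.mul_left_eq_zero]
    simp [h0, h2]
  · exact fun X x e y f hX hx he hne hy hyx => (hyx (h X hX hy hx)).elim
  · intro X a b c d hq
    obtain rfl := h X hq.base hq.ha hq.hb
    intro p hp
    have : p = 1 := by
      apply ((hA.unit hq.base hq.ha hq.hd hq.ad).mul (hA.unit hq.base hq.ha hq.hc hq.ac)).cancel
      linear_combination -hp
    simp [this, hl.one, mul_comm]

/-- Two elements on the same side whose deletion leaves a connected tableau, or that are
separated. -/
theorem exists_lift_of_pair [M.Finite] (hl : IsLiftMap G H lam) (hA : IsTableau M G A)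
    (ih : ∀ (M' : Matroid α) (A' : Set α → α → α → R), M'.E.Finite → M'.E.ncard < M.E.ncard →
      IsTableau M' G A' → ∃ B, IsLift M' H lam A' B) (hX₀ : M.IsBase X₀)
    (hu : u ∈ M.E) (hv : v ∈ M.E) (huv : u ≠ v) (hs : u ∈ X₀ ↔ v ∈ X₀)
    (hc : Conn (Adj A X₀) (M.E \ {u, v}) ∨
      ∃ K ⊆ M.E, u ∈ K ∧ v ∉ K ∧ ∀ e ∈ K, ∀ f ∈ M.E, f ∉ K → ¬ Adj A X₀ e f) :
    ∃ B, IsLift M H lam A B := by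
  have hfin := M.ground_finite
  have hlt : ∀ {z}, z ∈ M.E → (M.E \ {z}).ncard < M.E.ncard := fun hz =>
    Set.ncard_sdiff_singleton_lt_of_mem hz hfin
  by_cases huX : u ∈ X₀
  · have hvX := hs.1 huX
    have hXE := hX₀.subset_ground
    have hA' := hA.dual hl.neg_mem
    have hb := hX₀.compl_isBase_dual
    have hu' : u ∈ M✶.E \ (M.E \ X₀) := ⟨hu, fun h => h.2 huX⟩
    have hv' : v ∈ M✶.E \ (M.E \ X₀) := ⟨hv, fun h => h.2 hvX⟩
    obtain ⟨B₁, h₁⟩ := ih (M✶ ＼ {u}) _ (hfin.subset Set.sdiff_subset) (hlt hu)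
      (hA'.delete hb hu')
    obtain ⟨B₂, h₂⟩ := ih (M✶ ＼ {v}) _ (hfin.subset Set.sdiff_subset) (hlt hv)
      (hA'.delete hb hv')
    obtain ⟨B, hB⟩ := exists_lift_of_columns hl hA' h₁ h₂ hb hu' hv' huv (by
      refine hc.imp (conn_dual hXE Set.sdiff_subset).2 ?_
      rintro ⟨K, hK, huK, hvK, h⟩
      refine ⟨K, hK, huK, hvK, fun e he f hf hfK => ?_⟩
      rw [adj_dual hXE (hK he) hf]
      exact h e he f hf hfK)
    exact ⟨_, hB.of_dual hl⟩
  · have hvX : v ∉ X₀ := fun h => huX (hs.2 h)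
    obtain ⟨B₁, h₁⟩ := ih (M ＼ {u}) A (hfin.subset Set.sdiff_subset) (hlt hu)
      (hA.delete hX₀ ⟨hu, huX⟩)
    obtain ⟨B₂, h₂⟩ := ih (M ＼ {v}) A (hfin.subset Set.sdiff_subset) (hlt hv)
      (hA.delete hX₀ ⟨hv, hvX⟩)
    exact exists_lift_of_columns hl hA h₁ h₂ hX₀ ⟨hu, huX⟩ ⟨hv, hvX⟩ huv hc

/-- In a disconnected tableau there are two separated elements on the same side. -/
theorem exists_separated_pair (hX : M.IsBase X) (h2 : X.Nontrivial) (hc : ¬ Conn (Adj A X) M.E) :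
    ∃ u ∈ M.E, ∃ v ∈ M.E, u ≠ v ∧ (u ∈ X ↔ v ∈ X) ∧
      ∃ K ⊆ M.E, u ∈ K ∧ v ∉ K ∧ ∀ e ∈ K, ∀ f ∈ M.E, f ∉ K → ¬ Adj A X e f := by
  obtain ⟨K, hK, hs, hne, hne'⟩ : ∃ K ⊆ M.E, (∀ e ∈ K, ∀ f ∈ M.E, f ∉ K → ¬ Adj A X e f) ∧
      K.Nonempty ∧ K ≠ M.E := by
    by_contra hcon
    refine hc fun K hK hs => ?_
    by_contra h
    push Not at h
    exact hcon ⟨K, hK, hs, h.1, h.2⟩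
  by_cases hp : ∃ u ∈ K, ∃ v ∈ M.E, v ∉ K ∧ (u ∈ X ↔ v ∈ X)
  · obtain ⟨u, hu, v, hv, hvK, huv⟩ := hp
    exact ⟨u, hK hu, v, hv, fun h => hvK (h ▸ hu), huv, K, hK, hu, hvK, hs⟩
  push Not at hp
  -- In the remaining case `K` and its complement are the two sides of the bipartite graph. As they
  -- are separated, the graph has no edges, and any two elements of `X` will do.
  have hno : ∀ e f, e ∈ M.E → f ∈ M.E → ¬ Adj A X e f := by
    have hside : ∀ e f, e ∈ M.E → f ∈ M.E → (e ∈ K ↔ f ∈ K) → (e ∈ X ↔ f ∈ X) := by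
      intro e f he hf h
      obtain ⟨w, hw⟩ := hne
      obtain ⟨z, hz, hzK⟩ : ∃ z ∈ M.E, z ∉ K := by
        by_contra hcon
        push Not at hcon
        exact hne' (hK.antisymm hcon)
      by_cases heK : e ∈ K
      · have h1 := hp e heK z hz hzK
        have h2 := hp f (h.1 heK) z hz hzK
        tauto
      · have h1 := hp w hw e he heK
        have h2 := hp w hw f hf (fun h' => heK (h.2 h'))
        tauto
    intro e f he hf hef
    have h1 := hef.mem_iff
    by_cases heK : e ∈ K
    · by_cases hfK : f ∈ K
      · have := hside e f he hf (by tauto)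
        tauto
      · exact hs e heK f hf hfK hef
    · by_cases hfK : f ∈ K
      · exact hs f hfK e he heK hef.symm
      · have := hside e f he hf (by tauto)
        tauto
  obtain ⟨x, hx, y, hy, hxy⟩ := h2
  have hxE := hX.subset_ground hx
  refine ⟨x, hxE, y, hX.subset_ground hy, hxy, by tauto, {x}, by simpa using hxE, rfl,
    fun h => hxy h.symm, ?_⟩
  rintro e rfl f hf -
  exact hno e f hxE hf

/-- Every tableau has a lift. -/
theorem exists_isLift (hl : IsLiftMap G H lam) : ∀ (n : ℕ) (M : Matroid α)
    (A : Set α → α → α → R), M.E.Finite → M.E.ncard = n → IsTableau M G A →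
    ∃ B, IsLift M H lam A B := by
  intro n
  induction n using Nat.strong_induction_on with
  | _ n ih =>
  intro M A hfin hn hA
  have : M.Finite := ⟨hfin⟩
  have ih' : ∀ (M' : Matroid α) (A' : Set α → α → α → R), M'.E.Finite →
      M'.E.ncard < M.E.ncard → IsTableau M' G A' → ∃ B, IsLift M' H lam A' B :=
    fun M' A' hf hlt hA' => ih _ (hn ▸ hlt) M' A' hf rfl hA'
  obtain ⟨X₀, hX₀⟩ := M.exists_isBase
  have hXE := hX₀.subset_ground
  have hsub : ∀ (N : Matroid α) (X Y : Set α), N.IsBase X → N.IsBase Y → X.Subsingleton →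
      Y.Subsingleton := by
    intro N X Y hX hY h
    rw [← Set.encard_le_one_iff_subsingleton] at h ⊢
    rwa [hY.encard_eq_encard_of_isBase hX]
  by_cases h1 : X₀.Subsingleton
  · exact exists_lift_of_subsingleton hl hA fun X hX => hsub M X₀ X hX₀ hX h1
  by_cases h2 : (M.E \ X₀).Subsingleton
  · obtain ⟨B, hB⟩ := exists_lift_of_subsingleton hl (hA.dual hl.neg_mem)
      fun X hX => hsub M✶ _ X hX₀.compl_isBase_dual hX h2
    exact ⟨_, hB.of_dual hl⟩
  rw [Set.not_subsingleton_iff] at h1 h2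
  by_cases hc : Conn (Adj A X₀) M.E
  · by_cases h5 : 5 ≤ M.E.ncard
    · obtain ⟨X, hX, u, hu, v, hv, huv, hs, hcon⟩ := exists_pair hl.neg_mem hA hX₀ hfin hc h5
      exact exists_lift_of_pair hl hA ih' hX hu hv huv hs (Or.inl hcon)
    -- Both sides have at least two elements and there are at most four in all, so the tableau is
    -- two by two.
    · have := (hfin.subset hXE).to_subtype
      have := (hfin.subset (Set.sdiff_subset (t := X₀))).to_subtype
      have k1 := Set.one_lt_ncard_iff_nontrivial.2 h1
      have k2 := Set.one_lt_ncard_iff_nontrivial.2 h2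
      have k3 := Set.ncard_sdiff_add_ncard_of_subset hXE hfin
      obtain ⟨a, b, hab, hXab⟩ := Set.ncard_eq_two.1 (show X₀.ncard = 2 by omega)
      obtain ⟨u, v, huv, hXuv⟩ := Set.ncard_eq_two.1 (show (M.E \ X₀).ncard = 2 by omega)
      have hu : u ∈ M.E \ X₀ := by simp [hXuv]
      have hv : v ∈ M.E \ X₀ := by simp [hXuv]
      obtain ⟨B₁, hB₁⟩ := ih' (M ＼ {u}) A (hfin.subset Set.sdiff_subset)
        (Set.ncard_sdiff_singleton_lt_of_mem hu.1 hfin) (hA.delete hX₀ hu)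
      obtain ⟨B₂, hB₂⟩ := ih' (M ＼ {v}) A (hfin.subset Set.sdiff_subset)
        (Set.ncard_sdiff_singleton_lt_of_mem hv.1 hfin) (hA.delete hX₀ hv)
      refine exists_lift_of_two hl hA hB₁ hB₂ hX₀ hu hv huv ?_ hab hXab
      rw [← hXuv, Set.sdiff_sdiff_cancel_left hXE]
  · obtain ⟨u, hu, v, hv, huv, hs, hK⟩ := exists_separated_pair hX₀ h1 hc
    exact exists_lift_of_pair hl hA ih' hX₀ hu hv huv hs (Or.inr hK)

end Glue

/-! ### Subdeterminants of a tableau. -/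

section Subdeterminants

variable {α R : Type*} [CommRing R] [Nontrivial R]
  {M : Matroid α} {G : Subgroup Rˣ} {A : Set α → α → α → R} {X : Set α} {x e : α}

theorem swap_self (hx : x ∈ X) : swap X x x = X := by
  rw [swap, Set.insert_sdiff_singleton, Set.insert_eq_of_mem hx]

theorem IsTableau.eq_of_ne_zero (hA : IsTableau M G A) (hX : M.IsBase X) (hx : x ∈ X) (he : e ∈ X)
    (h : A X x e ≠ 0) : e = x := by
  by_contra hne
  exact h (hA.off X x e hX hx he hne)

/-- Pivoting on an entry that may belong to the identity matrix. -/
theorem IsTableau.pivot (hA : IsTableau M G A) (hX : M.IsBase X) (hx : x ∈ X) (he : e ∈ M.E)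
    (h : A X x e ≠ 0) : M.IsBase (swap X x e) ∧ UnitsIn G (A X x e) ∧
      ∀ y ∈ X, y ≠ x → ∀ f ∈ M.E,
        A (swap X x e) y f * A X x e = A X y f * A X x e - A X y e * A X x f := by
  by_cases heX : e ∈ X
  · obtain rfl := hA.eq_of_ne_zero hX hx heX h
    rw [swap_self hx, hA.self X e hX hx]
    refine ⟨hX, UnitsIn.one, fun y hy hyx f hf => ?_⟩
    rw [hA.off X y e hX hy hx hyx.symm]
    ring
  · exact ⟨(hA.base_iff X x e hX hx ⟨he, heX⟩).2 h, hA.unit hX hx ⟨he, heX⟩ h,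
      fun y hy hyx f hf => hA.piv X x e y f hX hx ⟨he, heX⟩ h hy hyx hf⟩

/-- The subdeterminants of the coordinate matrix of a base are zero or units from `G`, and their
being nonzero is determined by the matroid. -/
theorem IsTableau.det_submatrix (hG : -1 ∈ G) (hA : IsTableau M G A) : ∀ (n : ℕ) (X : Set α)
    (f g : Fin n → α), M.IsBase X → Function.Injective f → (∀ i, f i ∈ X) → (∀ j, g j ∈ M.E) →
    ((Matrix.of fun i j => A X (f i) (g j)).det ≠ 0 →
      UnitsIn G (Matrix.of fun i j => A X (f i) (g j)).det) ∧
    ((Matrix.of fun i j => A X (f i) (g j)).det ≠ 0 ↔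
      M.IsBase ((X \ Set.range f) ∪ Set.range g)) := by
  intro n
  induction n with
  | zero =>
    intro X f g hX _ _ _
    have : X \ Set.range f ∪ Set.range g = X := by simp [Set.range_eq_empty]
    rw [this, Matrix.det_fin_zero]
    exact ⟨fun _ => UnitsIn.one, iff_of_true one_ne_zero hX⟩
  | succ n ih =>
    intro X f g hX hf hfX hg
    set D : Matrix (Fin (n + 1)) (Fin (n + 1)) R := Matrix.of fun i j => A X (f i) (g j) with hD
    -- If this row vanishes, no element of the target set can replace `f 0` in `X`, so the target
    -- set is not a base.
    by_cases h0 : ∀ j, A X (f 0) (g j) = 0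
    · have hdet : D.det = 0 := Matrix.det_eq_zero_of_row_eq_zero 0 h0
      refine ⟨fun h => absurd hdet h, iff_of_false (fun h => h hdet) fun hY => ?_⟩
      have hnot : f 0 ∉ X \ Set.range f ∪ Set.range g := by
        rintro (h | ⟨j, hj⟩)
        · exact h.2 ⟨0, rfl⟩
        · have := h0 j
          rw [hj, hA.self X _ hX (hfX 0)] at this
          exact one_ne_zero this
      obtain ⟨y, hy, hb⟩ := hX.exchange hY ⟨hfX 0, hnot⟩
      obtain ⟨hy | ⟨j, rfl⟩, hyX⟩ := hy
      · exact hyX hy.1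
      · exact (hA.base_iff X (f 0) (g j) hX (hfX 0) ⟨hg j, hyX⟩).1 hb (h0 j)
    · push Not at h0
      obtain ⟨j, hj⟩ := h0
      obtain ⟨hX', hu, hpiv⟩ := hA.pivot hX (hfX 0) (hg j) hj
      set X' := swap X (f 0) (g j) with hXdef
      obtain ⟨b, hb, hab⟩ := hu.exists_inv
      have hf0 : ∀ i : Fin n, f i.succ ≠ f 0 := fun i h => Fin.succ_ne_zero i (hf h)
      have hfg : ∀ i : Fin n, f i.succ ≠ g j := by
        intro i h
        rw [← h] at hj
        exact hf0 i (hA.eq_of_ne_zero hX (hfX 0) (hfX i.succ) hj)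
      have hfX' : ∀ i : Fin n, f i.succ ∈ X' := fun i => Or.inr ⟨hfX _, hf0 i⟩
      -- The rows other than the first are replaced by their pivoted versions, a
      -- determinant-preserving row operation. Column `j` is then zero below its first entry, and
      -- the complementary minor consists of coordinates at `X'`.
      set D' : Matrix (Fin (n + 1)) (Fin (n + 1)) R := Matrix.of fun i k =>
        Fin.cases (A X (f 0) (g k)) (fun i => A X' (f i.succ) (g k)) i with hD'
      have e1 : D.det = D'.det := by
        refine Matrix.det_eq_of_forall_row_eq_smul_add_const
          (Fin.cases 0 fun i => A X (f i.succ) (g j) * b) 0 rfl fun i k => ?_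
        refine Fin.cases ?_ (fun i => ?_) i
        · simp [hD, hD']
        · have := hpiv (f i.succ) (hfX _) (hf0 i) (g k) (hg k)
          simp only [hD, hD', Matrix.of_apply, Fin.cases_succ, Fin.cases_zero]
          linear_combination (-b) * this + (A X' (f i.succ) (g k) - A X (f i.succ) (g k)) * hab
      have e2 : D'.det = (-1) ^ (j : ℕ) * A X (f 0) (g j) *
          (Matrix.of fun i k => A X' ((f ∘ Fin.succ) i) ((g ∘ j.succAbove) k)).det := by
        rw [Matrix.det_succ_column D' j, Finset.sum_eq_single 0]
        · simp only [Fin.val_zero, zero_add, Fin.succAbove_zero]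
          rfl
        · intro i _ hi
          obtain ⟨i, rfl⟩ := Fin.exists_succ_eq.2 hi
          have : D' i.succ j = 0 := by
            simp only [hD', Matrix.of_apply, Fin.cases_succ]
            exact hA.off X' _ _ hX' (hfX' i) (Or.inl rfl) (hfg i).symm
          rw [this]; ring
        · simp
      have hunit : UnitsIn G ((-1) ^ (j : ℕ) * A X (f 0) (g j)) := by
        refine UnitsIn.mul ⟨(-1) ^ (j : ℕ), pow_mem hG _, by simp⟩ hu
      have hset : X \ Set.range f ∪ Set.range g =
          X' \ Set.range (f ∘ Fin.succ) ∪ Set.range (g ∘ j.succAbove) := by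
        ext y
        constructor
        · rintro (⟨hy, hyf⟩ | ⟨k, rfl⟩)
          · refine Or.inl ⟨Or.inr ⟨hy, fun h => hyf ⟨0, h.symm⟩⟩, ?_⟩
            rintro ⟨i, rfl⟩
            exact hyf ⟨_, rfl⟩
          · by_cases hkj : k = j
            · subst hkj
              refine Or.inl ⟨Or.inl rfl, ?_⟩
              rintro ⟨i, hi⟩
              exact hfg i hi
            · obtain ⟨k, rfl⟩ := Fin.exists_succAbove_eq hkj
              exact Or.inr ⟨k, rfl⟩
        · rintro (⟨rfl | hy, hyf⟩ | ⟨k, rfl⟩)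
          · exact Or.inr ⟨j, rfl⟩
          · refine Or.inl ⟨hy.1, ?_⟩
            rintro ⟨i, rfl⟩
            refine Fin.cases (fun hy _ => hy.2 rfl) (fun i _ h => h ⟨i, rfl⟩) i hy hyf
          · exact Or.inr ⟨_, rfl⟩
      obtain ⟨i1, i2⟩ := ih X' (f ∘ Fin.succ) (g ∘ j.succAbove) hX'
        (hf.comp (Fin.succ_injective n)) hfX' fun k => hg _
      rw [e1, e2, hset, ← i2]
      have hne : ∀ z, (-1) ^ (j : ℕ) * A X (f 0) (g j) * z ≠ 0 ↔ z ≠ 0 := fun z =>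
        not_congr hunit.isUnit.mul_right_eq_zero
      rw [hne]
      exact ⟨fun h => hunit.mul (i1 h), Iff.rfl⟩

end Subdeterminants

/-! ### Representations and tableaux. -/

section Representation

variable {P : Type*} [PartialFieldData P] [IsPartialField P] {α : Type*} {M : Matroid α}

theorem unitsIn_unitSubgroup_iff {a : UniversalRing P} :
    UnitsIn (unitSubgroup P) a ↔ ∃ p : P, p ≠ 0 ∧ toRing P p = a := by
  constructor
  · rintro ⟨u, ⟨p, hp⟩, rfl⟩
    refine ⟨p, ?_, hp⟩
    rintro rfl
    rw [toRing_zero] at hp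
    exact u.ne_zero hp.symm
  · rintro ⟨p, hp, rfl⟩
    obtain ⟨q, hq⟩ := IsPartialField.exists_inv p hp
    have hpq : toRing P p * toRing P q = 1 := by rw [← map_mul, hq, map_one]
    exact ⟨⟨toRing P p, toRing P q, hpq, by rw [mul_comm, hpq]⟩, ⟨p, rfl⟩, rfl⟩

theorem neg_one_mem_unitSubgroup : -1 ∈ unitSubgroup P :=
  ⟨-1, by rw [toRing_neg, map_one]; simp⟩

theorem detNeZero_iff {n : ℕ} {A : Matrix (Fin n) (Fin n) P}
    (h : ∃ d, HasDet A d) : DetNeZero A ↔ (A.map (toRing P)).det ≠ 0 := by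
  constructor
  · rintro ⟨d, hd, hd0⟩
    rw [(hasDet_iff A d).1 hd]
    exact fun h0 => hd0 (toRing_eq_zero_iff.1 h0)
  · obtain ⟨d, hd⟩ := h
    refine fun h0 => ⟨d, hd, ?_⟩
    rintro rfl
    rw [hasDet_iff, toRing_zero] at hd
    exact h0 hd

/-- The coordinate matrix of a single base suffices: `IsTableau.det_submatrix` shows that all its
subdeterminants are defined and, applied to all rows, that the nonzero maximal minors belong to the
bases. -/
theorem isRepresentableOver_of_isTableau [M.Finite] {A : Set α → α → α → UniversalRing P}
    (hA : IsTableau M (unitSubgroup P) A) : IsRepresentableOver P M := by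
  classical
  obtain ⟨X, hX⟩ := M.exists_isBase
  have hfin := M.ground_finite.subset hX.subset_ground
  have := hfin.to_subtype
  have hentry : ∀ x ∈ X, ∀ e ∈ M.E, ∃ p : P, toRing P p = A X x e := by
    intro x hx e he
    by_cases h : A X x e = 0
    · exact ⟨0, by rw [toRing_zero, h]⟩
    · obtain ⟨p, -, hp⟩ := unitsIn_unitSubgroup_iff.1 (hA.pivot hX hx he h).2.1
      exact ⟨p, hp⟩
  have e : Fin (Nat.card X) ≃ X := (Finite.equivFin X).symm
  choose N hN using fun (i : Fin (Nat.card X)) (j : M.E) => hentry (e i) (e i).2 j j.2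
  have hmap : ∀ {n : ℕ} (f : Fin n → Fin (Nat.card X)) (g : Fin n → M.E),
      ((Matrix.of N).submatrix f g).map (toRing P) =
        Matrix.of fun i j => A X (e (f i)) (g j) := by
    intro n f g
    ext i j
    exact hN _ _
  have hdet : ∀ {n : ℕ} (f : Fin n ↪ Fin (Nat.card X)) (g : Fin n ↪ M.E),
      _ := fun {n} f g => hA.det_submatrix neg_one_mem_unitSubgroup n X
        (fun i => e (f i)) (fun j => g j) hX
        (Subtype.val_injective.comp (e.injective.comp f.injective)) (fun i => (e (f i)).2)
        fun j => (g j).2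
  have hP : IsPMatrix (Matrix.of N) := by
    intro n f g
    by_cases h : (Matrix.of fun i j => A X (e (f i)) (g j)).det = 0
    · exact ⟨0, by rw [hasDet_iff, hmap, h, toRing_zero]⟩
    · obtain ⟨p, -, hp⟩ := unitsIn_unitSubgroup_iff.1 ((hdet f g).1 h)
      exact ⟨p, by rw [hasDet_iff, hmap, hp]⟩
  have hbase : ∀ g : Fin (Nat.card X) ↪ M.E, DetNeZero ((Matrix.of N).submatrix id g) ↔
      M.IsBase (Set.range fun i => (g i : α)) := by
    intro g
    have h := (hdet (Function.Embedding.refl _) g).2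
    rw [← hmap, ← detNeZero_iff (hP _ _ _)] at h
    refine h.trans ?_
    have : (Set.range fun i => (e (Function.Embedding.refl (Fin (Nat.card X)) i) : α)) = X := by
      ext y
      constructor
      · rintro ⟨i, rfl⟩; exact (e i).2
      · intro hy; exact ⟨e.symm ⟨y, hy⟩, congrArg Subtype.val (e.apply_symm_apply ⟨y, hy⟩)⟩
    rw [this, Set.sdiff_self]
    simp
  have hex : ∀ B, M.IsBase B → ∃ g : Fin (Nat.card X) ↪ M.E, B = Set.range fun i => (g i : α) := by
    intro B hB
    have := (M.ground_finite.subset hB.subset_ground).to_subtype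
    have hcard : Nat.card X = Nat.card B := hX.ncard_eq_ncard_of_isBase hB
    let e' : Fin (Nat.card X) ≃ B := (finCongr hcard).trans (Finite.equivFin B).symm
    refine ⟨⟨fun i => ⟨e' i, hB.subset_ground (e' i).2⟩, fun i j h => ?_⟩, ?_⟩
    · exact e'.injective (Subtype.ext (congrArg (fun z : M.E => (z : α)) h))
    · ext y
      constructor
      · intro hy; exact ⟨e'.symm ⟨y, hy⟩, congrArg Subtype.val (e'.apply_symm_apply ⟨y, hy⟩)⟩
      · rintro ⟨i, rfl⟩; exact (e' i).2
  refine ⟨Nat.card X, Matrix.of N, hP, ⟨?_, ?_⟩, fun B => ⟨fun hB => ?_, ?_⟩⟩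
  · obtain ⟨g, hg⟩ := hex X hX
    exact ⟨Function.Embedding.refl _, g, (hbase g).2 (hg ▸ hX)⟩
  · rintro n ⟨f, -, -⟩
    have := Fintype.card_le_of_embedding f
    rwa [Fintype.card_fin, Fintype.card_fin] at this
  · obtain ⟨g, hg⟩ := hex B hB
    exact ⟨g, hg, (hbase g).2 (hg ▸ hB)⟩
  · rintro ⟨g, rfl, hg⟩
    exact (hbase g).1 hg

theorem det_submatrix_ne_zero_of_range_eq {n : ℕ} {β T : Type*} [CommRing T]
    (m : Matrix (Fin n) β T) {g h : Fin n → β} (hg : Function.Injective g)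
    (hh : Function.Injective h) (heq : Set.range g = Set.range h)
    (hne : (m.submatrix id g).det ≠ 0) : (m.submatrix id h).det ≠ 0 := by
  let σ : Equiv.Perm (Fin n) := (Equiv.ofInjective g hg).trans
    ((Equiv.setCongr heq).trans (Equiv.ofInjective h hh).symm)
  have hσ : ∀ i, h (σ i) = g i := by
    intro i
    exact Equiv.apply_ofInjective_symm hh _
  have e : m.submatrix id g = (m.submatrix id h).submatrix id σ := by
    ext i j
    simp [hσ]
  rw [e, Matrix.det_permute'] at hne
  exact right_ne_zero_of_mul hne

/-- The row space of the matrix supplies the coordinates. By Cramer's rule each of them is the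
quotient of two maximal minors, which are zero or come from `P`; the numerator is nonzero exactly
when the exchange gives a base. -/
theorem exists_isTableau_of_isRepresentableOver (h : IsRepresentableOver P M) :
    ∃ A : Set α → α → α → UniversalRing P, IsTableau M (unitSubgroup P) A := by
  classical
  obtain ⟨r, N, hN, -, hB⟩ := h
  set m : Matrix (Fin r) M.E (UniversalRing P) := N.map (toRing P) with hm
  have hunit : ∀ g : Fin r → M.E, (m.submatrix id g).det ≠ 0 →
      UnitsIn (unitSubgroup P) (m.submatrix id g).det := by
    intro g h0
    have hg : Function.Injective g := by
      intro i j hij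
      by_contra hne
      exact h0 (Matrix.det_zero_of_column_eq hne fun k => by simp [hij])
    obtain ⟨d, hd⟩ := hN r (Function.Embedding.refl _) ⟨g, hg⟩
    have hd' : (m.submatrix id g).det = toRing P d := (hasDet_iff _ _).1 hd
    rw [hd', unitsIn_unitSubgroup_iff]
    refine ⟨d, ?_, rfl⟩
    rintro rfl
    exact h0 (by rw [hd', toRing_zero])
  have hbase : ∀ g : Fin r ↪ M.E, (m.submatrix id g).det ≠ 0 ↔
      M.IsBase (Set.range fun i => (g i : α)) := by
    intro g
    have hdn : ∀ g : Fin r ↪ M.E, DetNeZero (N.submatrix id g) ↔ (m.submatrix id g).det ≠ 0 :=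
      fun g => detNeZero_iff (hN r (Function.Embedding.refl _) g)
    rw [hB]
    constructor
    · exact fun h => ⟨g, rfl, (hdn g).2 h⟩
    · rintro ⟨g', hg', hd⟩
      refine det_submatrix_ne_zero_of_range_eq m g'.injective g.injective ?_ ((hdn g').1 hd)
      apply Set.image_injective.2 Subtype.val_injective
      rw [← Set.range_comp, ← Set.range_comp]
      exact hg'.symm
  -- Values outside `M.E` are left arbitrary.
  let L : Submodule (UniversalRing P) (α → UniversalRing P) :=
    { carrier := {l | ∃ c : Fin r → UniversalRing P, ∀ e : M.E, l e = ∑ i, c i * m i e}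
      add_mem' := by
        rintro l l' ⟨c, hc⟩ ⟨c', hc'⟩
        exact ⟨c + c', fun e => by simp [hc, hc', add_mul, Finset.sum_add_distrib]⟩
      zero_mem' := ⟨0, fun e => by simp⟩
      smul_mem' := by
        rintro a l ⟨c, hc⟩
        exact ⟨a • c, fun e => by simp [hc, Finset.mul_sum, mul_assoc]⟩ }
  have hrow : ∀ (g : Fin r ↪ M.E), (m.submatrix id g).det ≠ 0 →
      IsFrame L M.E (Set.range fun i => (g i : α)) ∧ ∀ (i : Fin r) (e : M.E),
        (m.submatrix id g).det * rowCoord L (Set.range fun i => (g i : α)) (g i) e =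
          (m.submatrix id (Function.update g i e)).det := by
    intro g hg
    have hu := (hunit g hg).isUnit
    have hr : ∀ i : Fin r, IsRow L (Set.range fun i => (g i : α)) (g i)
        (fun e => if h : e ∈ M.E then ∑ k, (m.submatrix id g)⁻¹ i k * m k ⟨e, h⟩ else 0) := by
      intro i
      have hk : ∀ j, ∑ k, (m.submatrix id g)⁻¹ i k * m k (g j) =
          (1 : Matrix (Fin r) (Fin r) (UniversalRing P)) i j := fun j => by
        rw [← Matrix.nonsing_inv_mul _ hu]
        rfl
      refine ⟨⟨(m.submatrix id g)⁻¹ i, fun e => by simp⟩, ?_, ?_⟩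
      · simp [hk]
      · rintro y ⟨j, rfl⟩ hne
        have : i ≠ j := by rintro rfl; exact hne rfl
        simp [hk, this]
    have hF : IsFrame L M.E (Set.range fun i => (g i : α)) := by
      refine ⟨?_, ?_⟩
      · rintro l ⟨c, hc⟩ h0 e he
        have hc0 : c = 0 := by
          have : Matrix.vecMul c (m.submatrix id g) = 0 := by
            ext j
            rw [Pi.zero_apply, ← h0 _ ⟨j, rfl⟩, hc (g j)]
            rfl
          have h1 := congrArg (fun v => Matrix.vecMul v (m.submatrix id g)⁻¹) this
          simpa [Matrix.vecMul_vecMul, Matrix.mul_nonsing_inv _ hu] using h1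
        rw [hc ⟨e, he⟩, hc0]
        simp
      · rintro x ⟨i, rfl⟩
        exact ⟨_, hr i⟩
    refine ⟨hF, fun i e => ?_⟩
    rw [← hF.eq_rowCoord ⟨i, rfl⟩ (hr i) e.2]
    have h1 : (m.submatrix id g).cramer (fun k => m k e) i =
        (m.submatrix id (Function.update g i e)).det := by
      rw [Matrix.cramer_apply]
      congr 1
      ext k j
      by_cases hji : j = i
      · subst hji; simp
      · simp [Matrix.updateCol_ne hji, Function.update_of_ne hji]
    rw [← h1, Matrix.cramer_eq_adjugate_mulVec]
    have h2 : (m.submatrix id g).adjugate = (m.submatrix id g).det • (m.submatrix id g)⁻¹ := by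
      rw [Matrix.inv_def, smul_smul, Ring.mul_inverse_cancel _ hu, one_smul]
    rw [h2]
    simp [Matrix.mulVec, dotProduct, Finset.mul_sum, mul_assoc]
  have hFS := isFrameSystem_rowCoord L M.E
  have hfr : ∀ X, M.IsBase X → ∃ g : Fin r ↪ M.E, X = (Set.range fun i => (g i : α)) ∧
      (m.submatrix id g).det ≠ 0 := by
    intro X hX
    obtain ⟨g, rfl, -⟩ := (hB X).1 hX
    exact ⟨g, rfl, (hbase g).2 hX⟩
  have hframe : ∀ X, M.IsBase X → IsFrame L M.E X := by
    intro X hX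
    obtain ⟨g, rfl, hg⟩ := hfr X hX
    exact (hrow g hg).1
  have hzero : ∀ X x e, M.IsBase X → x ∈ X → e ∈ M.E \ X →
      (rowCoord L X x e = 0 ∨ UnitsIn (unitSubgroup P) (rowCoord L X x e)) ∧
      (M.IsBase (swap X x e) ↔ rowCoord L X x e ≠ 0) := by
    intro X x e hX hx he
    obtain ⟨g, rfl, hg⟩ := hfr X hX
    obtain ⟨i, rfl⟩ := hx
    have hco := (hrow g hg).2 i ⟨e, he.1⟩
    have hinj : Function.Injective (Function.update g i ⟨e, he.1⟩) := by
      intro j k hjk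
      have hne : ∀ j, g j ≠ ⟨e, he.1⟩ := fun j h => he.2 ⟨j, congrArg Subtype.val h⟩
      by_cases hj : j = i <;> by_cases hk : k = i
      · rw [hj, hk]
      · subst hj
        rw [Function.update_self, Function.update_of_ne hk] at hjk
        exact (hne k hjk.symm).elim
      · subst hk
        rw [Function.update_self, Function.update_of_ne hj] at hjk
        exact (hne j hjk).elim
      · rw [Function.update_of_ne hj, Function.update_of_ne hk] at hjk
        exact g.injective hjk
    have hrange : (Set.range fun j => ((Function.update g i ⟨e, he.1⟩ j : M.E) : α)) =
        swap (Set.range fun i => (g i : α)) (g i) e := by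
      ext y
      constructor
      · rintro ⟨j, rfl⟩
        by_cases hj : j = i
        · subst hj; left; simp
        · right
          simp only [Function.update_of_ne hj]
          exact ⟨⟨j, rfl⟩, fun h => hj (g.injective (Subtype.ext h))⟩
      · rintro (rfl | ⟨⟨j, rfl⟩, hj⟩)
        · exact ⟨i, by simp⟩
        · have : j ≠ i := by rintro rfl; exact hj rfl
          exact ⟨j, by simp [Function.update_of_ne this]⟩
    have hb := hbase ⟨_, hinj⟩
    rw [← hrange]
    refine ⟨?_, ?_⟩
    · by_cases h0 : (m.submatrix id (Function.update g i ⟨e, he.1⟩)).det = 0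
      · left
        rw [h0] at hco
        exact (hunit g hg).isUnit.mul_right_eq_zero.1 hco
      · right
        exact UnitsIn.of_mul_eq (hunit g hg) (hunit _ h0) (by rw [mul_comm, hco])
    · refine hb.symm.trans (not_congr ?_)
      exact (Eq.congr_left hco.symm).trans (hunit g hg).isUnit.mul_right_eq_zero
  refine ⟨rowCoord L, ⟨?_, ?_, ?_, ?_, ?_, ?_⟩⟩
  · exact fun X x hX hx => hFS.self X x (hframe X hX) hx
  · exact fun X x y hX hx hy hne => hFS.off X x y (hframe X hX) hx hy hne
  · exact fun X x e hX hx he => (hzero X x e hX hx he).1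
  · exact fun X x e hX hx he => (hzero X x e hX hx he).2
  · exact fun X x e f hX hx he hne hf => hFS.piv_row X x e f (hframe X hX) hx he
      ((hzero X x e hX hx he).1.resolve_left hne).isUnit hf
  · exact fun X x e y f hX hx he hne hy hyx hf => hFS.piv X x e y f (hframe X hX) hx he
      ((hzero X x e hX hx he).1.resolve_left hne).isUnit hy hyx hf

end Representation

/-! ### Partial fields inside rings. -/

section OfRing

variable {R : Type*} [CommRing R] {S : Set Rˣ}

theorem val_injective : Function.Injective (OfRing.val (S := S)) := Subtype.val_injective

theorem mem_padd_ofRing_iff {x y r : OfRing S} : r ∈ padd x y ↔ x.val + y.val = r.val :=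
  ⟨fun ⟨_, h⟩ => congrArg OfRing.val h, fun h => ⟨(congrArg (· ∈ ofRingCarrier S) h).mpr r.2, val_injective h⟩⟩

theorem sum_val_of_assoc {Z : Multiset (OfRing S)} {r : OfRing S} (h : Assoc Z r) :
    (Z.map OfRing.val).sum = r.val := by
  induction h with
  | leaf p => simp
  | node _ _ h h1 h2 => rw [Multiset.map_add, Multiset.sum_add, h1, h2, mem_padd_ofRing_iff.1 h]

instance isPartialField_ofRing [Nontrivial R] : IsPartialField (OfRing S) where
  zero_ne_one h := zero_ne_one (α := R) (congrArg OfRing.val h)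
  exists_inv p hp := by
    obtain h | ⟨u, hu, h⟩ := p.2
    · exact (hp (val_injective h)).elim
    · refine ⟨⟨(u⁻¹ : Rˣ), Or.inr ⟨u⁻¹, inv_mem hu, rfl⟩⟩, val_injective ?_⟩
      change p.val * (u⁻¹ : Rˣ) = 1
      rw [show p.val = u from h.symm, Units.mul_inv]
  padd_zero p := mem_padd_ofRing_iff.2 (add_zero _)
  padd_eq_zero_iff p q := by
    rw [mem_padd_ofRing_iff]
    constructor
    · exact fun h => val_injective (eq_neg_of_add_eq_zero_right h)
    · rintro rfl
      exact add_neg_cancel p.val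
  padd_comm p q := by
    ext r
    rw [mem_padd_ofRing_iff, mem_padd_ofRing_iff, add_comm]
  mul_padd p q r hp := by
    ext s
    rw [Part.mem_map_iff, mem_padd_ofRing_iff]
    constructor
    · rintro ⟨t, ht, rfl⟩
      rw [mem_padd_ofRing_iff] at ht
      change p.val * q.val + p.val * r.val = p.val * t.val
      rw [← ht, mul_add]
    · intro h
      replace h : p.val * q.val + p.val * r.val = s.val := h
      obtain h0 | ⟨u, hu, h0⟩ := p.2
      · exact (hp (val_injective h0)).elim
      replace h0 : (u : R) = p.val := h0
      let t : OfRing S := ⟨(u⁻¹ : Rˣ) * s.val,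
        mul_mem (Or.inr ⟨u⁻¹, inv_mem hu, rfl⟩) s.2⟩
      have ht : t.val = (u⁻¹ : Rˣ) * s.val := rfl
      refine ⟨t, mem_padd_ofRing_iff.2 ?_, val_injective ?_⟩
      · rw [ht, ← h, ← h0, ← mul_add, Units.inv_mul_cancel_left]
      · change p.val * t.val = s.val
        rw [ht, ← h0, Units.mul_inv_cancel_left]
  assoc Z T r u w h hZ hT := by
    have := sum_val_of_assoc h
    rw [Multiset.map_add, Multiset.sum_add, sum_val_of_assoc hZ, sum_val_of_assoc hT] at this
    exact mem_padd_ofRing_iff.2 this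

end OfRing

/-- Units stay units and `T` is not trivial, so the zeros, and with them the matroid, are the same.
-/
theorem IsTableau.map {α R T : Type*} [CommRing R] [CommRing T] [Nontrivial T] {M : Matroid α}
    {G : Subgroup Rˣ} {H : Subgroup Tˣ} {A : Set α → α → α → R} (hA : IsTableau M G A)
    (ψ : R →+* T) (hψ : ∀ u ∈ G, UnitsIn H (ψ u)) :
    IsTableau M H fun X x e => ψ (A X x e) := by
  have hu : ∀ {a}, UnitsIn G a → UnitsIn H (ψ a) := by
    rintro _ ⟨u, hu, rfl⟩
    exact hψ u hu
  have hne : ∀ {X x e}, ψ (A X x e) ≠ 0 → A X x e ≠ 0 := by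
    intro X x e h h0
    rw [h0, map_zero] at h
    exact h rfl
  refine ⟨?_, ?_, ?_, ?_, ?_, ?_⟩
  · intro X x hX hx
    rw [hA.self X x hX hx, map_one]
  · intro X x y hX hx hy hyx
    rw [hA.off X x y hX hx hy hyx, map_zero]
  · intro X x e hX hx he
    exact (hA.zero_or X x e hX hx he).imp (fun h => by rw [h, map_zero]) hu
  · intro X x e hX hx he
    rw [hA.base_iff X x e hX hx he]
    exact ⟨fun h => (hu (hA.unit hX hx he h)).ne_zero, hne⟩
  · intro X x e f hX hx he h hf
    rw [← map_mul, hA.piv_row X x e f hX hx he (hne h) hf]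
  · intro X x e y f hX hx he h hy hyx hf
    simp only [← map_mul, ← map_sub]
    rw [hA.piv X x e y f hX hx he (hne h) hy hyx hf]

/-! ### The lift of a partial field and its lifting map. -/

section Lift

variable {P : Type*} [PartialFieldData P]

theorem mk_eq_zero_of_liftRel {f : LiftPoly P} (h : LiftRel P f) :
    Ideal.Quotient.mk (liftIdeal P) f = 0 :=
  Ideal.Quotient.eq_zero_iff_mem.2 (Ideal.subset_span h)

variable [IsPartialField P]

/-- The ring homomorphism that sends an indeterminate to its fundamental element. -/
noncomputable def liftRingHom : LiftRing P →+* UniversalRing P :=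
  Ideal.Quotient.lift (liftIdeal P)
    (MvPolynomial.eval₂Hom (Int.castRingHom _) fun p : Fundamental P => toRing P p.1) (by
      have : liftIdeal P ≤ RingHom.ker
          (MvPolynomial.eval₂Hom (Int.castRingHom _) fun p : Fundamental P => toRing P p.1) := by
        rw [liftIdeal, Ideal.span_le]
        rintro f hf
        rw [SetLike.mem_coe, RingHom.mem_ker]
        cases hf with
        | zero p h => simp [tilde, h, toRing_zero]
        | one p h => simp [tilde, h]
        | neg_one p h => simp [tilde, h, toRing_neg]
        | add p q h => simp [tilde, toRing_add_eq_iff.2 h]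
        | inv p q h => simp [tilde, ← map_mul, h]
        | triple p q r h => simp [tilde, ← map_mul, h]
      exact fun f hf => this hf)

theorem liftRingHom_tilde (p : Fundamental P) :
    liftRingHom (Ideal.Quotient.mk (liftIdeal P) (tilde p)) = toRing P p.1 := by
  rw [liftRingHom]
  exact MvPolynomial.eval₂_X _ _ p

/-- The lift ring maps to the universal ring of `P`, which is nontrivial because `P` embeds in it.
-/
instance nontrivial_liftRing : Nontrivial (LiftRing P) :=
  (liftRingHom (P := P)).domain_nontrivial

/-- The homomorphism of partial fields from the lift of `P` to `P`. -/
noncomputable def ofLift : UniversalRing (Lift P) →+* UniversalRing P :=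
  liftHom
    { toFun := fun x => liftRingHom x.val
      map_one' := map_one liftRingHom
      map_mul' := fun x y => map_mul liftRingHom x.val y.val }
    (fun a b c h => by
      rw [mem_padd_ofRing_iff] at h
      change liftRingHom a.val + liftRingHom b.val = liftRingHom c.val
      rw [← map_add, h])

theorem ofLift_mem (u : (UniversalRing (Lift P))ˣ) (hu : u ∈ unitSubgroup (Lift P)) :
    UnitsIn (unitSubgroup P) (ofLift (u : UniversalRing (Lift P))) := by
  have hle : Subgroup.closure (liftGenerators P ∪ {-1}) ≤
      (unitSubgroup P).comap (Units.map (liftRingHom (P := P) : LiftRing P →* UniversalRing P)) := by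
    rw [Subgroup.closure_le]
    rintro v (⟨p, hp⟩ | rfl)
    · exact ⟨p.1, by rw [← liftRingHom_tilde, ← hp]; rfl⟩
    · exact ⟨-1, by rw [toRing_neg, map_one]; simp⟩
  obtain ⟨x, hx⟩ := hu
  have h1 : ofLift (u : UniversalRing (Lift P)) = liftRingHom x.val := by
    rw [← hx, ofLift, liftHom_toRing]
    rfl
  rw [h1]
  obtain h | ⟨v, hv, h⟩ := x.2
  · have : x = 0 := val_injective h
    rw [this, toRing_zero] at hx
    exact (u.ne_zero hx.symm).elim
  · exact ⟨_, hle hv, congrArg liftRingHom h⟩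

theorem dom_iff {p : P} : (padd 1 (-p)).Dom ↔ ∃ c, 1 - toRing P p = toRing P c := by
  have : ∀ c, 1 - toRing P p = toRing P c ↔ c ∈ padd 1 (-p) := fun c => by
    rw [← toRing_add_eq_iff, toRing_neg, map_one, sub_eq_add_neg]
  simp only [this]
  exact Part.dom_iff_mem

/-- The fundamental element `0` is left out, since its indeterminate vanishes in the lift. -/
theorem fund_iff {a : UniversalRing P} :
    Fund (unitSubgroup P) a ↔ ∃ p : Fundamental P, p.1 ≠ 0 ∧ toRing P p.1 = a := by
  constructor
  · rintro ⟨h, h'⟩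
    obtain ⟨p, hp, rfl⟩ := unitsIn_unitSubgroup_iff.1 h
    refine ⟨⟨p, dom_iff.2 ?_⟩, hp, rfl⟩
    rcases h' with h' | h'
    · exact ⟨0, by rw [h', toRing_zero]⟩
    · obtain ⟨c, -, hc⟩ := unitsIn_unitSubgroup_iff.1 h'
      exact ⟨c, hc.symm⟩
  · rintro ⟨p, hp, rfl⟩
    refine ⟨unitsIn_unitSubgroup_iff.2 ⟨_, hp, rfl⟩, ?_⟩
    obtain ⟨c, hc⟩ := dom_iff.1 p.2
    by_cases h0 : c = 0
    · left; rw [hc, h0, toRing_zero]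
    · right; exact unitsIn_unitSubgroup_iff.2 ⟨c, h0, hc.symm⟩

/-- The inverse of a nonzero fundamental element is again fundamental, so the relation for inverses
applies. -/
theorem exists_liftGenerators {p : Fundamental P} (hp : p.1 ≠ 0) :
    ∃ u ∈ liftGenerators P, (u : LiftRing P) = Ideal.Quotient.mk (liftIdeal P) (tilde p) := by
  obtain ⟨q, hq⟩ := IsPartialField.exists_inv p.1 hp
  have hpq : toRing P p.1 * toRing P q = 1 := by rw [← map_mul, hq, map_one]
  have hF := (fund_iff.2 ⟨p, hp, rfl⟩).inv neg_one_mem_unitSubgroup hpq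
  obtain ⟨q', -, hq'⟩ := fund_iff.1 hF
  have hmul : p.1 * q'.1 = 1 := by rw [toRing_injective hq', hq]
  have := mk_eq_zero_of_liftRel (LiftRel.inv p q' hmul)
  rw [map_sub, map_mul, map_one, sub_eq_zero] at this
  exact ⟨⟨_, _, this, by rw [mul_comm, this]⟩, ⟨p, rfl⟩, rfl⟩

/-- The element of the lift that belongs to a fundamental element. -/
noncomputable def liftElement (p : Fundamental P) : Lift P :=
  ⟨Ideal.Quotient.mk (liftIdeal P) (tilde p), by
    by_cases hp : p.1 = 0
    · exact Or.inl (mk_eq_zero_of_liftRel (LiftRel.zero p hp))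
    · obtain ⟨u, hu, h⟩ := exists_liftGenerators hp
      exact Or.inr ⟨u, Subgroup.subset_closure (Or.inl hu), h⟩⟩

open Classical in
/-- The lifting map from the fundamental elements of `P` to the lift of `P`. -/
noncomputable def liftMap (a : UniversalRing P) : UniversalRing (Lift P) :=
  if h : ∃ p : Fundamental P, toRing P p.1 = a then toRing (Lift P) (liftElement h.choose) else 0

theorem liftMap_toRing (p : Fundamental P) :
    liftMap (toRing P p.1) = toRing (Lift P) (liftElement p) := by
  have h : ∃ q : Fundamental P, toRing P q.1 = toRing P p.1 := ⟨p, rfl⟩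
  rw [liftMap, dif_pos h]
  have : h.choose = p := Subtype.ext (toRing_injective h.choose_spec)
  rw [this]

/-- Injectivity of `toRing` pulls each equation back to `P`, where it yields the corresponding
generator of the ideal. -/
theorem isLiftMap_liftMap :
    IsLiftMap (unitSubgroup P) (unitSubgroup (Lift P)) (liftMap (P := P)) where
  neg_mem := neg_one_mem_unitSubgroup
  neg_mem' := neg_one_mem_unitSubgroup
  mem a ha := by
    obtain ⟨p, hp, rfl⟩ := fund_iff.1 ha
    rw [liftMap_toRing, unitsIn_unitSubgroup_iff]
    refine ⟨_, fun h => ?_, rfl⟩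
    obtain ⟨u, -, hu⟩ := exists_liftGenerators hp
    exact u.ne_zero (hu.trans (congrArg OfRing.val h))
  one := by
    obtain ⟨p, -, hp⟩ := fund_iff.1 (Fund.one (G := unitSubgroup P))
    rw [← map_one (toRing P)] at hp
    have h := mk_eq_zero_of_liftRel (LiftRel.one p (toRing_injective hp))
    rw [map_sub, map_one, sub_eq_zero] at h
    rw [← map_one (toRing P), ← hp, liftMap_toRing,
      show liftElement p = 1 from val_injective h, map_one]
  sub a ha h1 := by
    obtain ⟨q, -, hq⟩ := fund_iff.1 (ha.sub h1)
    obtain ⟨p, -, rfl⟩ := fund_iff.1 ha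
    have h : 1 ∈ padd p.1 q.1 := by
      rw [← toRing_add_eq_iff, hq, map_one]
      ring
    have h' := mk_eq_zero_of_liftRel (LiftRel.add p q h)
    rw [map_sub, map_add, map_one, sub_eq_zero] at h'
    have h2 : (1 : Lift P) ∈ padd (liftElement p) (liftElement q) := mem_padd_ofRing_iff.2 h'
    rw [← toRing_add_eq_iff, map_one] at h2
    rw [← hq, liftMap_toRing, liftMap_toRing, ← h2]
    ring
  triple a b c ha hb hc h := by
    obtain ⟨p, -, rfl⟩ := fund_iff.1 ha
    obtain ⟨q, -, rfl⟩ := fund_iff.1 hb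
    obtain ⟨r, -, rfl⟩ := fund_iff.1 hc
    rw [← map_mul, ← map_mul, ← map_one (toRing P)] at h
    have h' := mk_eq_zero_of_liftRel (LiftRel.triple p q r (toRing_injective h))
    rw [map_sub, map_mul, map_mul, map_one, sub_eq_zero] at h'
    rw [liftMap_toRing, liftMap_toRing, liftMap_toRing, ← map_mul, ← map_mul,
      show liftElement p * liftElement q * liftElement r = 1 from val_injective h', map_one]
  neg_one h := by
    obtain ⟨p, -, hp⟩ := fund_iff.1 h
    have hp' : toRing P p.1 = toRing P (-1) := by rw [hp, toRing_neg, map_one]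
    have h := mk_eq_zero_of_liftRel (LiftRel.neg_one p (toRing_injective hp'))
    rw [map_add, map_one] at h
    rw [← hp, liftMap_toRing,
      show liftElement p = -1 from val_injective (eq_neg_of_add_eq_zero_left h), toRing_neg, map_one]

end Lift

end PartialField

/-! ### The lift theorem. -/

theorem mainTheorem6 (P : Type*) [PartialFieldData P] [IsPartialField P] :
    IsPartialField (Lift P) ∧
      ∀ (α : Type*) (M : Matroid α) [M.Finite],
        IsRepresentableOver P M ↔ IsRepresentableOver (Lift P) M := by
  refine ⟨inferInstance, fun α M _ => ⟨fun h => ?_, fun h => ?_⟩⟩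
  · obtain ⟨A, hA⟩ := PartialField.exists_isTableau_of_isRepresentableOver h
    obtain ⟨B, hB⟩ := PartialField.exists_isLift PartialField.isLiftMap_liftMap _ M A
      M.ground_finite rfl hA
    exact PartialField.isRepresentableOver_of_isTableau hB.tab
  · obtain ⟨A, hA⟩ := PartialField.exists_isTableau_of_isRepresentableOver h
    exact PartialField.isRepresentableOver_of_isTableau
      (hA.map PartialField.ofLift PartialField.ofLift_mem)
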